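/- **Corollary 5.5 (the linearized model is a Gaussian process during all the evolution).** *Circuits.* Let $\mathcal X$ be a finite set of inputs. For every $m\in\mathbb N$ let a parameterized quantum circuit on $m$ qubits with $L=L(m)$ layers be given, $$U(\Theta,x)=V_L(x)W_L(\Theta)\cdots V_1(x)W_1(\Theta),\qquad \Theta=(\theta_{\ell k})_{1\le \ell\le L,\,1\le k\le m}\in\mathbb R^{Lm},$$ where $W_\ell(\Theta)=\bigotimes_{k=1}^m e^{-i\theta_{\ell k}\mathcal G_{\ell k}}$ with Hermitian single-qubit operators $\mathcal G_{\ell k}$ of spectrum $\{-1,1\}$, and $V_\ell(x)$ is a tensor product of unitary one-qubit and two-qubit gates acting on disjoint sets of qubits; the gates may depend on $x$, the set of pairs of qubits that interact in layer $\ell$ does not. Let $\mathcal O_k$ ($1\le k\le m$) act on qubit $k$ as a Hermitian, traceless operator with spectrum in $[-1,1]$ and as the identity elsewhere, let $N(m)>0$, and put $$f_k(\Theta,x)=\langle 0^m|U^\dagger(\Theta,x)\,\mathcal O_k\,U(\Theta,x)|0^m\rangle,\qquad f(\Theta,x)=f^{(m)}(\Theta,x)=\frac1{N(m)}\sum_{k=1}^m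 f_k(\Theta,x).$$ *Light cones.* Let $\mathcal I_{\ell,k}$ consist of $k$ and of the qubit, if any, that interacts with $k$ in layer $\ell$. Put $\mathcal J_k^L=\mathcal I_{L,k}$, $\mathcal J_k^\ell=\bigcup_{k'\in\mathcal J_k^{\ell+1}}\mathcal I_{\ell,k'}$ for $\ell<L$, and $$\mathcal N_k=\{(\ell,k'):k'\in\mathcal J^\ell_k\},\quad \mathcal M_{(\ell,k')}=\{k:(\ell,k')\in\mathcal N_k\},\quad |\mathcal N|=\max_k|\mathcal N_k|,\quad |\mathcal M|=\max_i|\mathcal M_i|,\quad \Sigma_2=\sum_i|\mathcal M_i|^2 .$$ *Training.* Let $(x^{(i)},y^{(i)})_{1\le i\le n}$ be a training set in $\mathcal X\times\mathbb R$, and put $X=(x^{(i)})_i$, $Y=(y^{(i)})_i$. Let $\Theta_0=\Theta_0^{(m)}$ be a random vector in $\mathbb R^{Lm}$ with independent components (for instance, uniform on $[0,\pi]$), let $N_K(m)>0$ and $\eta_0>0$, and put $$\hat K_\Theta(x,x')=\frac{1}{N_K(m)}\nabla_\Theta f(\Theta,x)\cdot\nabla_\Theta f(\Theta,x'),\qquad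 f^{\mathrm{lin}}(\Theta,x)=f(\Theta_0,x)+\nabla_\Theta f(\Theta_0,x)\cdot(\Theta-\Theta_0).$$ Let $\Theta^{\mathrm{lin}}_t$, $t\ge0$, be the solution of the gradient flow $$\dot\Theta_t^{\mathrm{lin}}=-\eta\,\nabla\mathcal L^{\mathrm{lin}}(\Theta_t^{\mathrm{lin}}),\qquad \Theta^{\mathrm{lin}}_0=\Theta_0,\qquad \mathcal L^{\mathrm{lin}}(\Theta)=\frac1n\sum_{i=1}^n\frac12\bigl(f^{\mathrm{lin}}(\Theta,x^{(i)})-y^{(i)}\bigr)^2,\qquad \eta=\frac{n}{N_K(m)}\,\eta_0 .$$ *Assumptions.* 1. $\mathbb E[f_k(\Theta_0,x)]=0$ for all $m$, $k$, $x$, and $\mathbb E[f(\Theta_0,x)f(\Theta_0,x')]\to\mathcal K_0(x,x')$ uniformly in $x,x'\in\mathcal X$ as $m\to\infty$, where $\mathcal K_0(x,x)>0$ for all $x$. 2. $\mathbb E[\hat K_{\Theta_0}(x,x')]\to\bar K(x,x')$ uniformly in $x,x'\in\mathcal X$ as $m\to\infty$, where the matrix $\bar K=\bar K(X,X^T)=(\bar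 K(x^{(i)},x^{(j)}))_{i,j}$ is positive definite. 3. $\displaystyle\lim_{m\to\infty}\frac{m|\mathcal M|^2|\mathcal N|^2}{N(m)^3}=0$ and $\displaystyle\lim_{m\to\infty}\frac1{N_K(m)^2}\,\frac{\Sigma_2|\mathcal M|^2|\mathcal N|^2}{N(m)^4}=0$. *Conclusion.* For every $t\ge0$, as $m\to\infty$, $\{f^{\mathrm{lin}}(\Theta^{\mathrm{lin}}_t,x)\}_{x\in\mathcal X}$ converges in distribution to a Gaussian process $\{f_t^{(\infty)}(x)\}_{x\in\mathcal X}$ with mean and covariance $$\mu_t(x)=\bar K(x,X^T)\,\bar K^{-1}\bigl(1-e^{-\eta_0\bar Kt}\bigr)Y,$$ $$\begin{aligned}\mathcal K_t(x,x')={}&\mathcal K_0(x,x')-\bar K(x,X^T)\bar K^{-1}\bigl(1-e^{-\eta_0\bar Kt}\bigr)\mathcal K_0(X,x')-\bar K(x',X^T)\bar K^{-1}\bigl(1-e^{-\eta_0\bar Kt}\bigr)\mathcal K_0(X,x)\\&+\bar K(x,X^T)\bar K^{-1}\bigl(1-e^{-\eta_0\bar Kt}\bigr)\mathcal K_0(X,X^T)\bigl(1-e^{-\eta_0\bar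 Kt}\bigr)\bar K^{-1}\bar K(X,x').\end{aligned}$$ -/

import Mathlib

open MeasureTheory ProbabilityTheory Filter Topology

noncomputable section

namespace QNN

/-! ### Qubits, tensor products and circuits -/

/-- Operators on one qubit, in the computational basis. -/
abbrev Op1 := Matrix (Fin 2) (Fin 2) ℂ

/-- Operators on `m` qubits; the computational basis of `(ℂ²)^{⊗ m}` is indexed by bit strings. -/
abbrev Op (m : ℕ) := Matrix (Fin m → Fin 2) (Fin m → Fin 2) ℂ

/-- The tensor product `A 0 ⊗ A 1 ⊗ ⋯ ⊗ A (m - 1)` of single-qubit operators. -/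
def tensor {m : ℕ} (A : Fin m → Op1) : Op m :=
  Matrix.of fun a b => ∏ k, A k (a k) (b k)

/-- The operator acting as `A` on the qubit `k` and as the identity on all other qubits. -/
def onQubit {m : ℕ} (k : Fin m) (A : Op1) : Op m :=
  tensor (Function.update (fun _ => 1) k A)

/-- The vector of the parameters, one parameter for each layer and each qubit. -/
abbrev Params (L m : ℕ) := EuclideanSpace ℝ (Fin L × Fin m)

/-- A parameterized quantum circuit with inputs in `𝒳`, on `m` qubits, with `L` layers.

In the layer `ℓ`, the qubits `k` and `partner ℓ k` interact through a two-qubit gate if they are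
different; if `partner ℓ k = k`, only a one-qubit gate acts on `k`. Of `gate1 ℓ k` and `gate2 ℓ k`
only those which this rule needs enter the circuit: `gate1 ℓ k` when `partner ℓ k = k`, and
`gate2 ℓ k`, acting on the ordered pair of qubits `(k, partner ℓ k)`, when `k < partner ℓ k`. -/
structure Circuit (𝒳 : Type*) (m L : ℕ) where
  /-- the generators of the single-qubit parameterized gates -/
  gen : Fin L → Fin m → Op1
  gen_isHermitian : ∀ ℓ k, (gen ℓ k).IsHermitian
  gen_spectrum : ∀ ℓ k, spectrum ℝ (gen ℓ k) = {-1, 1}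
  /-- the pairing of the qubits in each layer -/
  partner : Fin L → Fin m → Fin m
  partner_involutive : ∀ ℓ, Function.Involutive (partner ℓ)
  /-- the one-qubit gates, which may depend on the input -/
  gate1 : Fin L → Fin m → 𝒳 → Matrix.unitaryGroup (Fin 2) ℂ
  /-- the two-qubit gates, which may depend on the input -/
  gate2 : Fin L → Fin m → 𝒳 → Matrix.unitaryGroup (Fin 2 × Fin 2) ℂ
  /-- the single-qubit observables, the sum of which is measured -/
  obs : Fin m → Op1
  obs_isHermitian : ∀ k, (obs k).IsHermitian
  obs_trace : ∀ k, (obs k).trace = 0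
  obs_spectrum : ∀ k, spectrum ℝ (obs k) ⊆ Set.Icc (-1) 1

namespace Circuit

variable {𝒳 : Type*} {m L : ℕ} (C : Circuit 𝒳 m L)

/-- The parameterized gates of the layer `ℓ`: the tensor product over the qubits `k` of
`exp (-i θ 𝒢)`, where `θ` and `𝒢` are the parameter and the generator with index `(ℓ, k)`. -/
def paramLayer (ℓ : Fin L) (Θ : Params L m) : Op m :=
  tensor fun k => NormedSpace.exp ((-Complex.I * (Θ (ℓ, k) : ℂ)) • C.gen ℓ k)

/-- The input-dependent gates of the layer `ℓ`: the tensor product, over the blocks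
`{k, partner ℓ k}`, of the gate acting on the block. A block with two qubits is counted at its
smaller qubit. -/
def inputLayer (ℓ : Fin L) (x : 𝒳) : Op m :=
  Matrix.of fun a b => ∏ k,
    if C.partner ℓ k = k then
      (C.gate1 ℓ k x : Op1) (a k) (b k)
    else if k < C.partner ℓ k then
      (C.gate2 ℓ k x : Matrix (Fin 2 × Fin 2) (Fin 2 × Fin 2) ℂ)
        (a k, a (C.partner ℓ k)) (b k, b (C.partner ℓ k))
    else 1

/-- One layer of the circuit. -/
def layer (Θ : Params L m) (x : 𝒳) (ℓ : Fin L) : Op m :=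
  C.inputLayer ℓ x * C.paramLayer ℓ Θ

/-- The unitary operator of the circuit, `U_L ⋯ U_2 U_1`. -/
def unitary (Θ : Params L m) (x : 𝒳) : Op m :=
  (List.ofFn (C.layer Θ x)).reverse.prod

/-- The expectation value `⟨0^m| U† 𝒪_k U |0^m⟩` of the local observable at the qubit `k`, which is
a diagonal entry of a Hermitian matrix and hence real. -/
def localOutput (k : Fin m) (Θ : Params L m) (x : 𝒳) : ℝ :=
  ((((C.unitary Θ x).conjTranspose * onQubit k (C.obs k) * C.unitary Θ x)
    (fun _ => 0) (fun _ => 0)) : ℂ).re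

/-- The model function with the normalization `N`. -/
def model (N : ℝ) (Θ : Params L m) (x : 𝒳) : ℝ :=
  (1 / N) * ∑ k, C.localOutput k Θ x

/-! ### Light cones -/

/-- The qubits interacting with `k` in the layer `ℓ`, together with `k`. -/
def interaction (ℓ : Fin L) (k : Fin m) : Finset (Fin m) := {k, C.partner ℓ k}

/-- The qubits in the layer `ℓ` which lie in the past of the qubit `k` at the end of the
circuit, built backwards from the last layer. -/
def pastQubits (k : Fin m) (ℓ : Fin L) : Finset (Fin m) :=
  if h : ℓ.val + 1 < L then
    (pastQubits k ⟨ℓ.val + 1, h⟩).biUnion fun k' => C.interaction ℓ k'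
  else C.interaction ℓ k
termination_by L - ℓ.val

/-- The extended past light cone of the qubit `k`, a set of indices of parameters. -/
def pastCone (k : Fin m) : Finset (Fin L × Fin m) :=
  Finset.univ.filter fun i => i.2 ∈ C.pastQubits k i.1

/-- The extended future light cone of a parameter, a set of qubits. -/
def futureCone (i : Fin L × Fin m) : Finset (Fin m) :=
  Finset.univ.filter fun k => i ∈ C.pastCone k

/-- The maximal cardinality `|ℳ|` of an extended future light cone. -/
def maxFuture : ℕ := Finset.univ.sup fun i => (C.futureCone i).card

/-- The maximal cardinality `|𝒩|` of an extended past light cone. -/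
def maxPast : ℕ := Finset.univ.sup fun k => (C.pastCone k).card

/-- The sum `Σ_r` of the `r`-th powers of the cardinalities of the extended future light cones. -/
def sumFuture (r : ℕ) : ℕ := ∑ i, (C.futureCone i).card ^ r

end Circuit

/-! ### Training of the linearized model -/

section Training

variable {𝒳 : Type*} {L m n : ℕ}

/-- The mean squared error of `g` on the training set `(X i, Y i)`. -/
def mse (X : Fin n → 𝒳) (Y : Fin n → ℝ) (g : 𝒳 → ℝ) : ℝ :=
  (1 / (n : ℝ)) * ∑ i, (1 / 2) * (g (X i) - Y i) ^ 2

/-- The first order expansion at `Θ₀` of the model `f`, evaluated at the parameters `Θ`. -/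
def linModel (f : Params L m → 𝒳 → ℝ) (Θ₀ Θ : Params L m) (x : 𝒳) : ℝ :=
  f Θ₀ x + inner ℝ (gradient (fun θ => f θ x) Θ₀) (Θ - Θ₀)

/-- `γ` solves the gradient flow equation `γ' = -η ∇ ℒ(γ)` for all times `t ≥ 0`, with the initial
value `Θ₀`. -/
structure IsGradientFlow (η : ℝ) (ℒ : Params L m → ℝ) (Θ₀ : Params L m) (γ : ℝ → Params L m) :
    Prop where
  init : γ 0 = Θ₀
  flow : ∀ t, 0 ≤ t → HasDerivWithinAt γ (-(η • gradient ℒ (γ t))) (Set.Ici 0) t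

/-- The empirical neural tangent kernel of the model `f`, with the normalization `NK`. -/
def empiricalNTK (f : Params L m → 𝒳 → ℝ) (NK : ℝ) (Θ : Params L m) (x x' : 𝒳) : ℝ :=
  (1 / NK) * inner ℝ (gradient (fun θ => f θ x) Θ) (gradient (fun θ => f θ x') Θ)

end Training

/-! ### The limiting mean and covariance -/

section Limit

variable {𝒳 : Type*} {n : ℕ}

/-- The matrix `k(X, Xᵀ)` of a kernel on the training inputs. -/
def gram (k : 𝒳 → 𝒳 → ℝ) (X : Fin n → 𝒳) : Matrix (Fin n) (Fin n) ℝ :=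
  Matrix.of fun i j => k (X i) (X j)

/-- The matrix `K̄⁻¹ (1 - exp (-η₀ K̄ t))`, where `K̄ = K̄(X, Xᵀ)`. -/
def propagator (Kbar : 𝒳 → 𝒳 → ℝ) (X : Fin n → 𝒳) (η₀ t : ℝ) : Matrix (Fin n) (Fin n) ℝ :=
  (gram Kbar X)⁻¹ * (1 - NormedSpace.exp (-(η₀ * t) • gram Kbar X))

open Matrix in
/-- `μ_t(x) = K̄(x, Xᵀ) K̄⁻¹ (1 - exp (-η₀ K̄ t)) Y`. -/
def limitMean (Kbar : 𝒳 → 𝒳 → ℝ) (X : Fin n → 𝒳) (Y : Fin n → ℝ) (η₀ t : ℝ) (x : 𝒳) : ℝ :=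
  (fun i => Kbar x (X i)) ⬝ᵥ (propagator Kbar X η₀ t *ᵥ Y)

open Matrix in
/-- `𝒦_t(x, x') = 𝒦₀(x, x')
  - K̄(x, Xᵀ) K̄⁻¹ (1 - exp (-η₀ K̄ t)) 𝒦₀(X, x')
  - K̄(x', Xᵀ) K̄⁻¹ (1 - exp (-η₀ K̄ t)) 𝒦₀(X, x)
  + K̄(x, Xᵀ) K̄⁻¹ (1 - exp (-η₀ K̄ t)) 𝒦₀(X, Xᵀ) (1 - exp (-η₀ K̄ t)) K̄⁻¹ K̄(X, x')`. -/
def limitCov (𝒦₀ Kbar : 𝒳 → 𝒳 → ℝ) (X : Fin n → 𝒳) (η₀ t : ℝ) (x x' : 𝒳) : ℝ :=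
  𝒦₀ x x'
  - (fun i => Kbar x (X i)) ⬝ᵥ (propagator Kbar X η₀ t *ᵥ fun i => 𝒦₀ (X i) x')
  - (fun i => Kbar x' (X i)) ⬝ᵥ (propagator Kbar X η₀ t *ᵥ fun i => 𝒦₀ (X i) x)
  + (fun i => Kbar x (X i)) ⬝ᵥ
      ((propagator Kbar X η₀ t * gram 𝒦₀ X *
        ((1 - NormedSpace.exp (-(η₀ * t) • gram Kbar X)) * (gram Kbar X)⁻¹)) *ᵥ
        fun i => Kbar (X i) x')

end Limit

end QNN

end

noncomputable section

namespace QNN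

/-! ### Algebra of tensor products and of operators on one qubit -/

open Matrix

variable {m : ℕ}

/-! For fixed `m` the linearized training is solved exactly. The pair formed by the model values on
`𝒳` and the residuals on the training set obeys a linear differential equation with constant
coefficients, whose generator is linear in the empirical kernel at initialization. Hence the trained
linear model is `evolution X η₀ t K̂` applied to `(F, F(X) - Y)`, with `F` the model and `K̂` the
empirical kernel at `Θ₀` (`linModel_gradientFlow`). What remains is a Slutsky argument: `K̂` tends
to `Kbar` in mean square, `F` tends in law to a centred Gaussian vector with covariance `𝒦₀`, and
`evolution` is continuous in the kernel, with no inverse of a random Gram matrix involved.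

Both probabilistic inputs come from locality. Pulled back through the layers, an observable commutes
with every operator on a qubit outside its backward light cone (`commute_heisenberg`). So each local
output is a function, bounded by 1, of the independent parameters in its past cone only
(`localOutput_congr`); by the parameter-shift rule its partial derivatives inherit this locality,
are bounded by 2, and vanish off the cone. Functions of disjoint sets of independent coordinates are
independent, and counting overlaps of cones gives two estimates:

(a) the variance of the empirical kernel is at most a constant times `Σ₂ |ℳ|² |𝒩|² / (N_K² N⁴)`
(`integral_sq_empiricalNTK_sub_le`);

(b) the characteristic function of a linear statistic of `F` differs from that of the centred normal
law of the same variance by at most a constant times `m |ℳ|² |𝒩|² / N³`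
(`norm_integral_exp_sum_sub_exp_le`). With `φ(s) = E exp(isW)`, removing from the sum `W` the terms
that share parameters with a given one shows that `φ' = -s V φ` up to a small error, where `V = E
W²`; an integrating factor then compares `φ(1)` with `exp(-V/2)`.

With the limiting kernel the evolution is affine in `F` and given by matrix exponentials
(`evolution_apply_fst`). A test vector `a` on the trained model therefore becomes the test vector
`adjointWeight a` on `F`, plus the deterministic mean. This identifies the limit of the
characteristic functions, and Lévy's continuity theorem concludes. -/

lemma tensor_mul (A B : Fin m → Op1) : tensor A * tensor B = tensor fun k => A k * B k := by
  ext a b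
  simp only [tensor, Matrix.mul_apply, Matrix.of_apply, ← Finset.prod_mul_distrib]
  rw [Finset.prod_univ_sum, Fintype.piFinset_univ]

lemma tensor_one : tensor (fun _ : Fin m => (1 : Op1)) = 1 := by
  ext a b
  simp only [tensor, Matrix.of_apply, Matrix.one_apply, Finset.prod_ite_zero, Finset.mem_univ,
    forall_const, Finset.prod_const_one, funext_iff]

lemma tensor_conjTranspose (A : Fin m → Op1) : (tensor A)ᴴ = tensor fun k => (A k)ᴴ := by
  ext a b
  simp [tensor, Matrix.conjTranspose_apply]

lemma tensor_mem_unitaryGroup {A : Fin m → Op1}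
    (hA : ∀ k, A k ∈ Matrix.unitaryGroup (Fin 2) ℂ) :
    tensor A ∈ Matrix.unitaryGroup (Fin m → Fin 2) ℂ := by
  rw [Matrix.mem_unitaryGroup_iff, Matrix.star_eq_conjTranspose, tensor_conjTranspose, tensor_mul,
    ← tensor_one]
  congr 1
  funext k
  exact Matrix.mem_unitaryGroup_iff.1 (hA k)

lemma onQubit_mul (k : Fin m) (A B : Op1) : onQubit k (A * B) = onQubit k A * onQubit k B := by
  rw [onQubit, onQubit, onQubit, tensor_mul]
  congr 1
  funext j
  by_cases h : j = k
  · subst h; simp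
  · simp [h]

lemma onQubit_one (k : Fin m) : onQubit k 1 = 1 := by
  rw [onQubit, Function.update_eq_self_iff.2 rfl, tensor_one]

lemma onQubit_conjTranspose (k : Fin m) (A : Op1) : (onQubit k A)ᴴ = onQubit k Aᴴ := by
  rw [onQubit, onQubit, tensor_conjTranspose]
  congr 1
  funext j
  by_cases h : j = k
  · subst h; simp
  · simp [h]

lemma onQubit_commute {j k : Fin m} (h : j ≠ k) (A B : Op1) :
    Commute (onQubit j A) (onQubit k B) := by
  rw [Commute, SemiconjBy, onQubit, onQubit, tensor_mul, tensor_mul]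
  congr 1
  funext i
  by_cases hj : i = j
  · subst hj; simp [h]
  · simp [hj]

lemma tensor_mul_onQubit (k : Fin m) (A : Fin m → Op1) (B : Op1) :
    tensor A * onQubit k B = tensor (Function.update A k (A k * B)) := by
  rw [onQubit, tensor_mul]
  congr 1
  funext j
  by_cases h : j = k
  · subst h; simp
  · simp [h]

lemma onQubit_apply (k : Fin m) (A : Op1) (a b : Fin m → Fin 2) :
    onQubit k A a b = if b = Function.update a k (b k) then A (a k) (b k) else 0 := by
  rw [onQubit, tensor, Matrix.of_apply, Fintype.prod_eq_mul_prod_compl k]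
  have h : ∏ j ∈ ({k} : Finset (Fin m))ᶜ, Function.update (fun _ => (1 : Op1)) k A j (a j) (b j)
      = if b = Function.update a k (b k) then 1 else 0 := by
    have h1 : ∀ j ∈ ({k} : Finset (Fin m))ᶜ, Function.update (fun _ => (1 : Op1)) k A j (a j) (b j)
        = if a j = b j then 1 else 0 := by
      intro j hj
      rw [Function.update_of_ne (by simpa using hj), Matrix.one_apply]
    rw [Finset.prod_congr rfl h1, Finset.prod_ite_zero, Finset.prod_const_one]
    congr 1
    simp only [Finset.mem_compl, Finset.mem_singleton, eq_iff_iff, funext_iff,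
      Function.update_apply]
    refine forall_congr' fun j => ?_
    by_cases hj : j = k <;> simp [hj, eq_comm]
  rw [h]
  simp

lemma onQubit_mul_apply (k : Fin m) (A : Op1) (M : Op m) (a b : Fin m → Fin 2) :
    (onQubit k A * M) a b = ∑ γ, A (a k) γ * M (Function.update a k γ) b := by
  rw [Matrix.mul_apply]
  symm
  refine Finset.sum_of_injOn (fun γ => Function.update a k γ) ?_ (by simp) ?_ ?_
  · intro γ _ δ _ h
    exact Function.update_injective a k h
  · intro c _ hc
    rw [onQubit_apply, if_neg, zero_mul]
    intro h
    exact hc ⟨c k, by simp, h.symm⟩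
  · intro γ _
    rw [onQubit_apply]
    simp

lemma mul_onQubit_apply (k : Fin m) (A : Op1) (M : Op m) (a b : Fin m → Fin 2) :
    (M * onQubit k A) a b = ∑ γ, M a (Function.update b k γ) * A γ (b k) := by
  have h := onQubit_mul_apply k Aᴴ Mᴴ b a
  rw [← onQubit_conjTranspose, ← Matrix.conjTranspose_mul, Matrix.conjTranspose_apply] at h
  have h' := congrArg star h
  rw [star_star] at h'
  rw [h', star_sum]
  refine Finset.sum_congr rfl fun γ _ => ?_
  simp [mul_comm]

/-- Summation over the assignments to all sites of a product of functions, each of which looks at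
the sites of one fibre of `r` only. -/
lemma sum_prod_fiber {κ ι α R : Type*} [Fintype κ] [DecidableEq κ] [Fintype ι] [DecidableEq ι]
    [Fintype α] [CommSemiring R] (r : κ → ι) (c₀ : α) (F : ι → (κ → α) → R)
    (hF : ∀ b c c', (∀ j, r j = b → c j = c' j) → F b c = F b c') :
    ∑ c, ∏ b, F b c
      = ∏ b, ∑ δ : {j // r j = b} → α, F b fun j => if h : r j = b then δ ⟨j, h⟩ else c₀ := by
  rw [Finset.prod_univ_sum, Fintype.piFinset_univ]
  refine Fintype.sum_bijective
    (fun c b (j : {j // r j = b}) => c j.1) ⟨?_, ?_⟩ _ _ ?_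
  · intro c c' h
    funext j
    exact congrFun (congrFun h (r j)) ⟨j, rfl⟩
  · intro d
    refine ⟨fun j => d (r j) ⟨j, rfl⟩, ?_⟩
    funext b ⟨j, hj⟩
    subst hj
    rfl
  · intro c
    refine Finset.prod_congr rfl fun b _ => hF _ _ _ fun j hj => ?_
    simp [hj]

/-! ### Unitarity of the input-dependent layers -/

namespace Circuit

variable {𝒳 : Type*} {L : ℕ} (C : Circuit 𝒳 m L)

/-- The matrix entry of the input-dependent gate of the block counted at the qubit `k`. -/
def blockEntry (ℓ : Fin L) (x : 𝒳) (k : Fin m) (a b : Fin m → Fin 2) : ℂ :=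
  if C.partner ℓ k = k then
    (C.gate1 ℓ k x : Op1) (a k) (b k)
  else if k < C.partner ℓ k then
    (C.gate2 ℓ k x : Matrix (Fin 2 × Fin 2) (Fin 2 × Fin 2) ℂ)
      (a k, a (C.partner ℓ k)) (b k, b (C.partner ℓ k))
  else 1

lemma inputLayer_apply (ℓ : Fin L) (x : 𝒳) (a b : Fin m → Fin 2) :
    C.inputLayer ℓ x a b = ∏ k, C.blockEntry ℓ x k a b := rfl

/-- One block's factor of an entry of `V† V`. The fibre of `j ↦ min j (partner j)` over `b` is the
block counted at `b`: two sites, one site, or no site if `b` is the larger qubit of its block. In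
the first two cases the sum is an entry of `g† g` for the unitary gate `g` of the block; in the last
it is the empty sum with factor 1. The value 0 off the fibre is never read. -/
lemma sum_blockEntry_fiber (ℓ : Fin L) (x : 𝒳) (b : Fin m) (a a' : Fin m → Fin 2) :
    ∑ δ : {j // min j (C.partner ℓ j) = b} → Fin 2,
      (star (C.blockEntry ℓ x b
          (fun j => if h : min j (C.partner ℓ j) = b then δ ⟨j, h⟩ else 0) a)
        * C.blockEntry ℓ x b
          (fun j => if h : min j (C.partner ℓ j) = b then δ ⟨j, h⟩ else 0) a')
      = if b ≤ C.partner ℓ b then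
          (if a b = a' b ∧ a (C.partner ℓ b) = a' (C.partner ℓ b) then 1 else 0) else 1 := by
  have hinv := C.partner_involutive ℓ
  rcases lt_trichotomy b (C.partner ℓ b) with hb | hb | hb
  · have h0 : min b (C.partner ℓ b) = b := min_eq_left hb.le
    have h1 : min (C.partner ℓ b) (C.partner ℓ (C.partner ℓ b)) = b := by
      rw [hinv b]; exact min_eq_right hb.le
    have hu := Matrix.mem_unitaryGroup_iff'.1 (C.gate2 ℓ b x).2
    have hu' := congrFun (congrFun hu (a b, a (C.partner ℓ b))) (a' b, a' (C.partner ℓ b))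
    rw [Matrix.star_eq_conjTranspose, Matrix.mul_apply, Matrix.one_apply] at hu'
    simp only [if_pos hb.le, ← Prod.mk_inj]
    rw [← hu']
    refine Fintype.sum_bijective
      (fun δ : {j // min j (C.partner ℓ j) = b} → Fin 2 => (δ ⟨b, h0⟩, δ ⟨C.partner ℓ b, h1⟩))
      ⟨?_, ?_⟩ _ _ ?_
    · intro δ δ' h
      funext ⟨j, hj⟩
      rcases min_choice j (C.partner ℓ j) with h2 | h2
      · have : j = b := by rw [← hj, h2]
        subst this
        exact (Prod.mk_inj.1 h).1
      · have : j = C.partner ℓ b := by rw [← hj, h2, hinv j]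
        subst this
        exact (Prod.mk_inj.1 h).2
    · rintro ⟨u, v⟩
      refine ⟨fun j => if j.1 = b then u else v, ?_⟩
      simp [hb.ne']
    · intro δ
      simp [blockEntry, hb.ne', hb, h0, h1, Matrix.conjTranspose_apply]
  · have h0 : min b (C.partner ℓ b) = b := min_eq_left hb.le
    have hu := Matrix.mem_unitaryGroup_iff'.1 (C.gate1 ℓ b x).2
    have hu' := congrFun (congrFun hu (a b)) (a' b)
    rw [Matrix.star_eq_conjTranspose, Matrix.mul_apply, Matrix.one_apply] at hu'
    simp only [← hb, and_self, le_refl, if_true]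
    rw [← hu']
    refine Fintype.sum_bijective
      (fun δ : {j // min j (C.partner ℓ j) = b} → Fin 2 => δ ⟨b, h0⟩) ⟨?_, ?_⟩ _ _ ?_
    · intro δ δ' h
      funext ⟨j, hj⟩
      have : j = b := by
        rcases min_choice j (C.partner ℓ j) with h2 | h2
        · rw [← hj, h2]
        · exact hinv.injective (by rw [← hb, ← h2, hj])
      subst this
      exact h
    · intro u
      exact ⟨fun _ => u, rfl⟩
    · intro δ
      simp [blockEntry, hb.symm, Matrix.conjTranspose_apply]
  · have he : IsEmpty {j // min j (C.partner ℓ j) = b} := by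
      refine ⟨fun ⟨j, hj⟩ => ?_⟩
      rcases min_choice j (C.partner ℓ j) with h2 | h2
      · have : j = b := by rw [← hj, h2]
        subst this
        rw [h2] at hj
        exact absurd (min_eq_left_iff.1 h2) (not_le.2 hb)
      · have h3 : C.partner ℓ j = b := by rw [← hj, h2]
        have h4 : j = C.partner ℓ b := by rw [← h3, hinv j]
        have h5 := min_eq_right_iff.1 h2
        rw [h3, h4] at h5
        exact absurd h5 (not_le.2 hb)
    simp [blockEntry, hb.ne, not_lt.2 hb.le, not_le.2 hb]

/-- The blocks are disjoint, so the sum over intermediate bit strings in an entry of `V† V`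
factorizes over blocks (`sum_prod_fiber`). Each block yields a Kronecker delta on its own qubits,
and the blocks cover all qubits. -/
lemma inputLayer_mem_unitaryGroup (ℓ : Fin L) (x : 𝒳) :
    C.inputLayer ℓ x ∈ Matrix.unitaryGroup (Fin m → Fin 2) ℂ := by
  rw [Matrix.mem_unitaryGroup_iff', Matrix.star_eq_conjTranspose]
  ext a a'
  rw [Matrix.mul_apply]
  simp only [Matrix.conjTranspose_apply, inputLayer_apply, star_prod, ← Finset.prod_mul_distrib]
  rw [sum_prod_fiber (fun j => min j (C.partner ℓ j)) 0
    (fun k c => star (C.blockEntry ℓ x k c a) * C.blockEntry ℓ x k c a')]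
  · simp only [C.sum_blockEntry_fiber ℓ x, Matrix.one_apply]
    by_cases h : a = a'
    · subst h; simp
    · rw [if_neg h]
      obtain ⟨j, hj⟩ := Function.ne_iff.1 h
      -- The factor that vanishes is that of the block containing `j`, which is counted at the
      -- smaller of `j` and its partner.
      rcases le_total j (C.partner ℓ j) with h1 | h1
      · refine Finset.prod_eq_zero (Finset.mem_univ j) ?_
        simp [h1, hj]
      · refine Finset.prod_eq_zero (Finset.mem_univ (C.partner ℓ j)) ?_
        simp [h1, C.partner_involutive ℓ j, hj]
  · intro b c c' h
    have hE : ∀ a'' : Fin m → Fin 2, C.blockEntry ℓ x b c a'' = C.blockEntry ℓ x b c' a'' := by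
      intro a''
      unfold blockEntry
      split_ifs with h1 h2
      · rw [h b (by simp [h1])]
      · rw [h b (by simp [h2.le]), h (C.partner ℓ b) (by
          rw [C.partner_involutive ℓ b]; exact min_eq_right h2.le)]
      · rfl
    rw [hE, hE]

end Circuit

/-! ### Locality of the input-dependent layers -/

open Matrix

variable {m : ℕ}

/-- The operator acting as `Z` on the ordered pair `(j, q)` of qubits. -/
def onPair (j q : Fin m) (Z : Matrix (Fin 2 × Fin 2) (Fin 2 × Fin 2) ℂ) : Op m :=
  ∑ α, ∑ β, ∑ γ, ∑ δ, Z (α, β) (γ, δ) •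
    (onQubit j (Matrix.single α γ 1) * onQubit q (Matrix.single β δ 1))

lemma commute_onPair {j q : Fin m} {M : Op m} (hj : ∀ A, Commute M (onQubit j A))
    (hq : ∀ A, Commute M (onQubit q A)) (Z : Matrix (Fin 2 × Fin 2) (Fin 2 × Fin 2) ℂ) :
    Commute M (onPair j q Z) :=
  Commute.sum_right _ _ _ fun _ _ => Commute.sum_right _ _ _ fun _ _ =>
    Commute.sum_right _ _ _ fun _ _ => Commute.sum_right _ _ _ fun _ _ =>
      ((hj _).mul_right (hq _)).smul_right _

lemma onPair_mul_apply {j q : Fin m} (h : j ≠ q)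
    (Z : Matrix (Fin 2 × Fin 2) (Fin 2 × Fin 2) ℂ) (M : Op m) (a b : Fin m → Fin 2) :
    (onPair j q Z * M) a b = ∑ γ, ∑ δ, Z (a j, a q) (γ, δ) *
      M (Function.update (Function.update a j γ) q δ) b := by
  simp only [onPair, Finset.sum_mul, Matrix.sum_apply, Matrix.smul_mul, Matrix.smul_apply,
    Matrix.mul_assoc, onQubit_mul_apply, Matrix.single_apply, smul_eq_mul,
    Function.update_of_ne h.symm, Finset.mul_sum, ite_and, ite_mul, mul_ite, mul_zero, zero_mul,
    one_mul]
  rw [Finset.sum_eq_single (a j) (fun α _ hα => by simp [hα]) (by simp),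
    Finset.sum_eq_single (a q) (fun α _ hα => by simp [hα]) (by simp)]
  simp

namespace Circuit

variable {𝒳 : Type*} {L : ℕ} (C : Circuit 𝒳 m L)

lemma blockEntry_congr {ℓ : Fin L} {x : 𝒳} {k : Fin m} {a b a' b' : Fin m → Fin 2}
    (ha : a k = a' k) (ha' : a (C.partner ℓ k) = a' (C.partner ℓ k))
    (hb : b k = b' k) (hb' : b (C.partner ℓ k) = b' (C.partner ℓ k)) :
    C.blockEntry ℓ x k a b = C.blockEntry ℓ x k a' b' := by
  simp only [blockEntry, ha, ha', hb, hb']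

/-- Splits off the gate acting on `j`. No other block reads the bit at `j`, since the pairing is an
involution fixing `j`. -/
lemma exists_inputLayer_eq_one {ℓ : Fin L} {j : Fin m} (hj : C.partner ℓ j = j) (x : 𝒳) :
    ∃ g ∈ Matrix.unitaryGroup (Fin 2) ℂ, ∃ rest : (Fin m → Fin 2) → (Fin m → Fin 2) → ℂ,
      (∀ a b, C.inputLayer ℓ x a b = g (a j) (b j) * rest a b) ∧
      (∀ a b a' b', (∀ k, k ≠ j → a k = a' k) → (∀ k, k ≠ j → b k = b' k) →
        rest a b = rest a' b') := by
  refine ⟨_, (C.gate1 ℓ j x).2, fun a b => ∏ k ∈ {j}ᶜ, C.blockEntry ℓ x k a b, ?_, ?_⟩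
  · intro a b
    rw [inputLayer_apply, Fintype.prod_eq_mul_prod_compl j]
    simp [blockEntry, hj]
  · intro a b a' b' ha hb
    refine Finset.prod_congr rfl fun k hk => ?_
    have hk' : k ≠ j := by simpa using hk
    have hk'' : C.partner ℓ k ≠ j := fun h =>
      hk' ((C.partner_involutive ℓ).injective (h.trans hj.symm))
    exact C.blockEntry_congr (ha _ hk') (ha _ hk'') (hb _ hk') (hb _ hk'')

/-- The analogue for a qubit with a genuine partner, with the gate indexed from the side of `j`,
whichever of the two qubits is smaller. -/
lemma exists_inputLayer_eq_two {ℓ : Fin L} {j : Fin m} (hj : C.partner ℓ j ≠ j) (x : 𝒳) :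
    ∃ g ∈ Matrix.unitaryGroup (Fin 2 × Fin 2) ℂ,
      ∃ rest : (Fin m → Fin 2) → (Fin m → Fin 2) → ℂ,
      (∀ a b, C.inputLayer ℓ x a b
        = g (a j, a (C.partner ℓ j)) (b j, b (C.partner ℓ j)) * rest a b) ∧
      (∀ a b a' b', (∀ k, k ≠ j → k ≠ C.partner ℓ j → a k = a' k) →
        (∀ k, k ≠ j → k ≠ C.partner ℓ j → b k = b' k) → rest a b = rest a' b') := by
  set q := C.partner ℓ j with hq
  have hqj : C.partner ℓ q = j := C.partner_involutive ℓ j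
  have hfac : ∀ a b, C.inputLayer ℓ x a b
      = (C.blockEntry ℓ x j a b * C.blockEntry ℓ x q a b)
        * ∏ k ∈ ({j, q} : Finset (Fin m))ᶜ, C.blockEntry ℓ x k a b := by
    intro a b
    rw [inputLayer_apply, ← Finset.prod_mul_prod_compl {j, q}, Finset.prod_pair hj.symm]
  have hrest : ∀ a b a' b' : Fin m → Fin 2, (∀ k, k ≠ j → k ≠ q → a k = a' k) →
        (∀ k, k ≠ j → k ≠ q → b k = b' k) →
        ∏ k ∈ ({j, q} : Finset (Fin m))ᶜ, C.blockEntry ℓ x k a b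
          = ∏ k ∈ ({j, q} : Finset (Fin m))ᶜ, C.blockEntry ℓ x k a' b' := by
    intro a b a' b' ha hb
    refine Finset.prod_congr rfl fun k hk => ?_
    simp only [Finset.mem_compl, Finset.mem_insert, Finset.mem_singleton, not_or] at hk
    have h1 : C.partner ℓ k ≠ j := fun h =>
      hk.2 (by rw [hq, ← h, C.partner_involutive ℓ k])
    have h2 : C.partner ℓ k ≠ q := fun h => hk.1 ((C.partner_involutive ℓ).injective h)
    exact C.blockEntry_congr (ha _ hk.1 hk.2) (ha _ h1 h2) (hb _ hk.1 hk.2) (hb _ h1 h2)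
  rcases lt_or_gt_of_ne hj with h | h
  -- Here `j` is the larger qubit, so the gate is stored at `q` and its two tensor factors must be
  -- exchanged.
  · refine ⟨(C.gate2 ℓ q x).1.submatrix Prod.swap Prod.swap, ?_, _, fun a b => ?_, hrest⟩
    · have hu := Matrix.mem_unitaryGroup_iff.1 (C.gate2 ℓ q x).2
      rw [Matrix.mem_unitaryGroup_iff, Matrix.star_eq_conjTranspose,
        Matrix.conjTranspose_submatrix,
        ← Equiv.coe_prodComm, Matrix.submatrix_mul_equiv, ← Matrix.star_eq_conjTranspose, hu,
        Matrix.submatrix_one_equiv]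
    · rw [hfac]
      congr 1
      simp [blockEntry, hqj, ← hq, hj, hj.symm, h, not_lt.2 h.le]
  · refine ⟨_, (C.gate2 ℓ j x).2, _, fun a b => ?_, hrest⟩
    rw [hfac]
    congr 1
    simp [blockEntry, hqj, ← hq, hj, hj.symm, h, not_lt.2 h.le]

/-- The conjugate by the input-dependent gates of a layer of an operator on the qubit `j` commutes
with everything that commutes with the operators on `j` and on its partner. -/
lemma exists_inputLayer_mul_onQubit (ℓ : Fin L) (x : 𝒳) (j : Fin m) (B : Op1) :
    ∃ Y : Op m, C.inputLayer ℓ x * onQubit j B = Y * C.inputLayer ℓ x ∧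
      ∀ M : Op m, (∀ A, Commute M (onQubit j A)) →
        (∀ A, Commute M (onQubit (C.partner ℓ j) A)) → Commute M Y := by
  by_cases hj : C.partner ℓ j = j
  · obtain ⟨g, hg, rest, h1, h2⟩ := C.exists_inputLayer_eq_one hj x
    -- Conjugating by the layer only sees the gate on `j`: all other gates cancel.
    refine ⟨onQubit j (g * B * gᴴ), ?_, fun M hM _ => hM _⟩
    have hg' : g * B * gᴴ * g = g * B := by
      rw [Matrix.mul_assoc, ← Matrix.star_eq_conjTranspose, Matrix.mem_unitaryGroup_iff'.1 hg,
        Matrix.mul_one]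
    ext a b
    rw [mul_onQubit_apply, onQubit_mul_apply]
    have e1 : ∀ γ, rest a (Function.update b j γ) = rest a b := fun γ =>
      h2 _ _ _ _ (fun _ _ => rfl) fun k hk => Function.update_of_ne hk _ _
    have e2 : ∀ γ, rest (Function.update a j γ) b = rest a b := fun γ =>
      h2 _ _ _ _ (fun k hk => Function.update_of_ne hk _ _) fun _ _ => rfl
    have h3 := congrFun (congrFun hg' (a j)) (b j)
    rw [Matrix.mul_apply (M := g * B * gᴴ), Matrix.mul_apply (M := g)] at h3
    simp only [h1, e1, e2, Function.update_self]
    calc ∑ γ, g (a j) γ * rest a b * B γ (b j)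
        = (∑ γ, g (a j) γ * B γ (b j)) * rest a b := by
          rw [Finset.sum_mul]; exact Finset.sum_congr rfl fun _ _ => by ring
      _ = _ := by
          rw [← h3, Finset.sum_mul]; exact Finset.sum_congr rfl fun _ _ => by ring
  · obtain ⟨g, hg, rest, h1, h2⟩ := C.exists_inputLayer_eq_two hj x
    set q := C.partner ℓ j with hq
    -- `B'` is `B ⊗ 1` on the pair `(j, q)`, so that conjugation by the two-qubit gate makes sense.
    set B' : Matrix (Fin 2 × Fin 2) (Fin 2 × Fin 2) ℂ :=
      Matrix.of fun u v => if u.2 = v.2 then B u.1 v.1 else 0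
    have hB' : ∀ u v, B' u v = if u.2 = v.2 then B u.1 v.1 else 0 := fun _ _ => rfl
    refine ⟨onPair j q (g * B' * gᴴ), ?_, fun M hM hM' => commute_onPair hM hM' _⟩
    have hg' : g * B' * gᴴ * g = g * B' := by
      rw [Matrix.mul_assoc, ← Matrix.star_eq_conjTranspose, Matrix.mem_unitaryGroup_iff'.1 hg,
        Matrix.mul_one]
    ext a b
    rw [mul_onQubit_apply, onPair_mul_apply (Ne.symm hj)]
    have e1 : ∀ γ, rest a (Function.update b j γ) = rest a b := fun γ =>
      h2 _ _ _ _ (fun _ _ _ => rfl) fun k hk _ => Function.update_of_ne hk _ _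
    have e2 : ∀ γ δ, rest (Function.update (Function.update a j γ) q δ) b = rest a b := fun γ δ =>
      h2 _ _ _ _ (fun k hk hk' => by
        rw [Function.update_of_ne hk', Function.update_of_ne hk]) fun _ _ _ => rfl
    have h3 := congrFun (congrFun hg' (a j, a q)) (b j, b q)
    rw [Matrix.mul_apply (M := g * B' * gᴴ), Matrix.mul_apply (M := g), Fintype.sum_prod_type,
      Fintype.sum_prod_type] at h3
    simp only [hB', mul_ite, mul_zero, Finset.sum_ite_eq',
      Finset.mem_univ, if_true] at h3
    simp only [h1, e1, e2, Function.update_self, Function.update_of_ne hj,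
      Function.update_of_ne (Ne.symm hj)]
    calc ∑ γ, g (a j, a q) (γ, b q) * rest a b * B γ (b j)
        = (∑ γ, g (a j, a q) (γ, b q) * B γ (b j)) * rest a b := by
          rw [Finset.sum_mul]; exact Finset.sum_congr rfl fun _ _ => by ring
      _ = _ := by
          rw [← h3, Finset.sum_mul]
          refine Finset.sum_congr rfl fun _ _ => ?_
          rw [Finset.sum_mul]
          exact Finset.sum_congr rfl fun _ _ => by ring

end Circuit

/-! ### Single-qubit rotations and bounds on expectation values -/

open Matrix

variable {m : ℕ}

lemma exists_diagonalization {A : Op1} (hA : A.IsHermitian) :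
    ∃ V ∈ Matrix.unitaryGroup (Fin 2) ℂ, ∃ d : Fin 2 → ℝ, (∀ i, d i ∈ spectrum ℝ A) ∧
      A = V * Matrix.diagonal (fun i => (d i : ℂ)) * Vᴴ := by
  refine ⟨_, hA.eigenvectorUnitary.2, hA.eigenvalues, hA.eigenvalues_mem_spectrum_real, ?_⟩
  conv_lhs => rw [hA.spectral_theorem, Unitary.conjStarAlgAut_apply]
  rfl

/-- The single-qubit gate `exp (-i θ G)` for an involution `G`. -/
def rotation (G : Op1) (θ : ℝ) : Op1 :=
  (Real.cos θ : ℂ) • (1 : Op1) - (Complex.I * (Real.sin θ : ℂ)) • G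

/-- In an eigenbasis of `G` this is Euler's formula at the eigenvalues ±1. The closed form makes the
dependence on `θ` explicitly trigonometric. -/
lemma exp_eq_rotation {G : Op1} (hG : G.IsHermitian) (hs : spectrum ℝ G = {-1, 1}) (θ : ℝ) :
    NormedSpace.exp ((-Complex.I * (θ : ℂ)) • G) = rotation G θ := by
  obtain ⟨V, hV, d, hd, hA⟩ := exists_diagonalization hG
  have hVV : V * Vᴴ = 1 := Matrix.mem_unitaryGroup_iff.1 hV
  have hinv : V⁻¹ = Vᴴ := Matrix.inv_eq_right_inv hVV
  have hunit : IsUnit V := ⟨⟨V, Vᴴ, hVV, Matrix.mem_unitaryGroup_iff'.1 hV⟩, rfl⟩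
  have h1 : (-Complex.I * (θ : ℂ)) • G
      = V * Matrix.diagonal (fun i => -Complex.I * θ * (d i : ℂ)) * V⁻¹ := by
    conv_lhs => rw [hA]
    rw [hinv, ← Matrix.smul_mul, ← Matrix.mul_smul, ← Matrix.diagonal_smul]
    rfl
  have h2 : NormedSpace.exp (fun i => -Complex.I * θ * (d i : ℂ))
      = fun i => (Real.cos θ : ℂ) - Complex.I * (Real.sin θ : ℂ) * (d i : ℂ) := by
    funext i
    rw [Pi.coe_exp, ← Complex.exp_eq_exp_ℂ]
    have h := hd i
    rw [hs] at h
    rcases h with h | h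
    · rw [h]
      have : -Complex.I * (θ : ℂ) * ((-1 : ℝ) : ℂ) = θ * Complex.I := by push_cast; ring
      rw [this, Complex.exp_mul_I]
      push_cast; ring
    · rw [Set.mem_singleton_iff.1 h]
      have : -Complex.I * (θ : ℂ) * ((1 : ℝ) : ℂ) = (-θ) * Complex.I := by push_cast; ring
      rw [this, Complex.exp_mul_I, Complex.cos_neg, Complex.sin_neg]
      push_cast; ring
  have h3 : Matrix.diagonal (fun i => (Real.cos θ : ℂ) - Complex.I * (Real.sin θ : ℂ) * (d i : ℂ))
      = (Real.cos θ : ℂ) • (1 : Op1)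
        - (Complex.I * (Real.sin θ : ℂ)) • Matrix.diagonal (fun i => (d i : ℂ)) := by
    rw [← Matrix.diagonal_one, ← Matrix.diagonal_smul, ← Matrix.diagonal_smul, Matrix.diagonal_sub]
    congr 1
    funext i
    simp
  rw [h1, Matrix.exp_conj _ _ hunit, Matrix.exp_diagonal, h2, h3, hinv, Matrix.mul_sub,
    Matrix.sub_mul, Matrix.mul_smul, Matrix.mul_smul, Matrix.mul_one, Matrix.smul_mul,
    Matrix.smul_mul, hVV, ← hA, rotation]

lemma mul_self_eq_one {G : Op1} (hG : G.IsHermitian) (hs : spectrum ℝ G = {-1, 1}) :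
    G * G = 1 := by
  obtain ⟨V, hV, d, hd, hA⟩ := exists_diagonalization hG
  have hVV : V * Vᴴ = 1 := Matrix.mem_unitaryGroup_iff.1 hV
  have hVV' : Vᴴ * V = 1 := Matrix.mem_unitaryGroup_iff'.1 hV
  have hD : Matrix.diagonal (fun i => (d i : ℂ)) * Matrix.diagonal (fun i => (d i : ℂ)) = 1 := by
    rw [Matrix.diagonal_mul_diagonal, ← Matrix.diagonal_one]
    congr 1
    funext i
    have h := hd i
    rw [hs] at h
    rcases h with h | h
    · simp [h]
    · simp [Set.mem_singleton_iff.1 h]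
  rw [hA]
  calc V * Matrix.diagonal (fun i => (d i : ℂ)) * Vᴴ
        * (V * Matrix.diagonal (fun i => (d i : ℂ)) * Vᴴ)
      = V * (Matrix.diagonal (fun i => (d i : ℂ)) * (Vᴴ * V)
          * Matrix.diagonal (fun i => (d i : ℂ))) * Vᴴ := by simp only [Matrix.mul_assoc]
    _ = 1 := by rw [hVV', Matrix.mul_one, hD, Matrix.mul_one, hVV]

lemma rotation_add {G : Op1} (hG : G * G = 1) (θ s : ℝ) :
    rotation G (θ + s) = rotation G θ * rotation G s := by
  have h : ((Complex.I * (Real.sin θ : ℂ)) • G) * ((Complex.I * (Real.sin s : ℂ)) • G)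
      = (-((Real.sin θ : ℂ) * Real.sin s)) • (1 : Op1) := by
    rw [Matrix.smul_mul, Matrix.mul_smul, hG, smul_smul]
    congr 1
    linear_combination ((Real.sin θ : ℂ) * Real.sin s) * Complex.I_mul_I
  rw [rotation, rotation, rotation, Matrix.mul_sub, Matrix.sub_mul, Matrix.sub_mul, h,
    Real.cos_add, Real.sin_add]
  simp only [Matrix.smul_mul, Matrix.mul_smul, Matrix.one_mul, Matrix.mul_one]
  push_cast
  module

lemma rotation_zero (G : Op1) : rotation G 0 = 1 := by simp [rotation]

lemma rotation_conjTranspose {G : Op1} (hG : G.IsHermitian) (s : ℝ) :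
    (rotation G s)ᴴ = rotation G (-s) := by
  simp only [rotation, Matrix.conjTranspose_sub, Matrix.conjTranspose_smul, hG.eq,
    Matrix.conjTranspose_one, star_mul', RCLike.star_def, Complex.conj_I, Complex.conj_ofReal,
    Real.cos_neg, Real.sin_neg]
  push_cast
  module

lemma rotation_mem_unitaryGroup {G : Op1} (hG : G.IsHermitian) (hG' : G * G = 1) (s : ℝ) :
    rotation G s ∈ Matrix.unitaryGroup (Fin 2) ℂ := by
  rw [Matrix.mem_unitaryGroup_iff, Matrix.star_eq_conjTranspose, rotation_conjTranspose hG,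
    ← rotation_add hG', add_neg_cancel, rotation_zero]

lemma onQubit_rotation (k : Fin m) (G : Op1) (s : ℝ) :
    onQubit k (rotation G s)
      = (Real.cos s : ℂ) • (1 : Op m) - (Complex.I * (Real.sin s : ℂ)) • onQubit k G := by
  rw [← onQubit_one k]
  ext a b
  simp only [Matrix.sub_apply, Matrix.smul_apply, onQubit_apply, rotation]
  split_ifs <;> simp

lemma onQubit_mem_unitaryGroup (k : Fin m) {A : Op1} (hA : A ∈ Matrix.unitaryGroup (Fin 2) ℂ) :
    onQubit k A ∈ Matrix.unitaryGroup (Fin m → Fin 2) ℂ := by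
  rw [Matrix.mem_unitaryGroup_iff, Matrix.star_eq_conjTranspose] at *
  rw [onQubit_conjTranspose, ← onQubit_mul, hA, onQubit_one]

lemma onQubit_diagonal (k : Fin m) (d : Fin 2 → ℂ) :
    onQubit k (Matrix.diagonal d) = Matrix.diagonal fun a => d (a k) := by
  ext a b
  rw [onQubit_apply, Matrix.diagonal_apply, Matrix.diagonal_apply]
  by_cases h : a = b
  · subst h; simp
  · rw [if_neg h]
    split_ifs with h1 h2
    · exact absurd (by rw [h1, ← h2, Function.update_eq_self]) h
    · rfl
    · rfl

/-- After diagonalizing `A` by a unitary `V` on the qubit `k`, the diagonal entry is an average of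
eigenvalues of `A` with the weights `|W c a|²`, `W = V† U`. These sum to 1 because `W` is unitary.
-/
lemma abs_re_conj_onQubit_apply_le (k : Fin m) {A : Op1} (hA : A.IsHermitian)
    (hs : spectrum ℝ A ⊆ Set.Icc (-1) 1) {U : Op m}
    (hU : U ∈ Matrix.unitaryGroup (Fin m → Fin 2) ℂ) (a : Fin m → Fin 2) :
    |((Uᴴ * onQubit k A * U) a a).re| ≤ 1 := by
  obtain ⟨V, hV, d, hd, hA⟩ := exists_diagonalization hA
  set W : Op m := (onQubit k V)ᴴ * U with hW
  have hWu : W ∈ Matrix.unitaryGroup (Fin m → Fin 2) ℂ :=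
    mul_mem (Unitary.star_mem (onQubit_mem_unitaryGroup k hV)) hU
  have h1 : Uᴴ * onQubit k A * U = Wᴴ * (Matrix.diagonal fun c => (d (c k) : ℂ)) * W := by
    rw [hA, onQubit_mul, onQubit_mul, onQubit_diagonal k (fun i => (d i : ℂ)), hW,
      Matrix.conjTranspose_mul, Matrix.conjTranspose_conjTranspose, onQubit_conjTranspose]
    simp only [Matrix.mul_assoc]
  have h2 : ((Uᴴ * onQubit k A * U) a a).re = ∑ c, Complex.normSq (W c a) * d (c k) := by
    rw [h1, Matrix.mul_apply, Complex.re_sum]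
    refine Finset.sum_congr rfl fun c _ => ?_
    rw [Matrix.mul_diagonal, Matrix.conjTranspose_apply]
    have : star (W c a) * (d (c k) : ℂ) * W c a = ((Complex.normSq (W c a) * d (c k) : ℝ) : ℂ) := by
      push_cast
      rw [Complex.normSq_eq_conj_mul_self]
      simp only [RCLike.star_def]
      ring
    rw [this, Complex.ofReal_re]
  have h3 : ∑ c, Complex.normSq (W c a) = 1 := by
    have h := congrFun (congrFun (Matrix.mem_unitaryGroup_iff'.1 hWu) a) a
    rw [Matrix.star_eq_conjTranspose, Matrix.mul_apply, Matrix.one_apply_eq] at h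
    have h' := congrArg Complex.re h
    rw [Complex.re_sum, Complex.one_re] at h'
    rw [← h']
    refine Finset.sum_congr rfl fun c _ => ?_
    rw [Matrix.conjTranspose_apply, RCLike.star_def, ← Complex.normSq_eq_conj_mul_self,
      Complex.ofReal_re]
  rw [h2, ← h3]
  refine (Finset.abs_sum_le_sum_abs _ _).trans (Finset.sum_le_sum fun c _ => ?_)
  rw [abs_mul, abs_of_nonneg (Complex.normSq_nonneg _)]
  exact mul_le_of_le_one_right (Complex.normSq_nonneg _) (abs_le.2 (hs (hd _)))

/-! ### Ordered products -/

section OrderedProducts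

variable {M : Type*} [Monoid M] {L : ℕ}

/-- The product `F (L - 1) ⋯ F n` of the factors from the index `n` on, the last one leftmost. -/
def prodFrom (F : Fin L → M) (n : ℕ) : M := ((List.ofFn F).drop n).reverse.prod

/-- The product `F (n - 1) ⋯ F 0` of the factors before the index `n`, the last one leftmost. -/
def prodTo (F : Fin L → M) (n : ℕ) : M := ((List.ofFn F).take n).reverse.prod

lemma prodFrom_mul_prodTo (F : Fin L → M) (n : ℕ) :
    prodFrom F n * prodTo F n = (List.ofFn F).reverse.prod := by
  rw [prodFrom, prodTo, ← List.prod_append, ← List.reverse_append, List.take_append_drop]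

lemma prodFrom_eq_mul (F : Fin L → M) (ℓ : Fin L) :
    prodFrom F ℓ = prodFrom F (ℓ + 1) * F ℓ := by
  rw [prodFrom, prodFrom, List.drop_eq_getElem_cons (by simp)]
  simp

lemma prodFrom_of_le (F : Fin L → M) {n : ℕ} (h : L ≤ n) : prodFrom F n = 1 := by
  rw [prodFrom, List.drop_of_length_le (by simpa using h)]
  simp

lemma prodTo_succ (F : Fin L → M) (ℓ : Fin L) : prodTo F (ℓ + 1) = F ℓ * prodTo F ℓ := by
  rw [prodTo, prodTo, List.take_succ_eq_append_getElem (by simp)]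
  simp

lemma prodFrom_mem {S : Submonoid M} {F : Fin L → M} (hF : ∀ ℓ, F ℓ ∈ S) (n : ℕ) :
    prodFrom F n ∈ S := by
  refine S.list_prod_mem fun x hx => ?_
  obtain ⟨ℓ, rfl⟩ := (List.mem_ofFn' _ _).1 (List.mem_of_mem_drop (List.mem_reverse.1 hx))
  exact hF ℓ

lemma prodFrom_congr {F F' : Fin L → M} {n : ℕ} (h : ∀ ℓ : Fin L, n ≤ ℓ → F ℓ = F' ℓ) :
    prodFrom F n = prodFrom F' n := by
  -- Downward induction on `n`: `d` bounds the number of factors still present.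
  suffices ∀ d n, L ≤ n + d → (∀ ℓ : Fin L, n ≤ ℓ → F ℓ = F' ℓ) → prodFrom F n = prodFrom F' n from
    this L n (by omega) h
  intro d
  induction d with
  | zero => intro n hn _; rw [prodFrom_of_le F (by omega), prodFrom_of_le F' (by omega)]
  | succ d ih =>
    intro n hn h
    by_cases hL : n < L
    · have := prodFrom_eq_mul F ⟨n, hL⟩
      have h' := prodFrom_eq_mul F' ⟨n, hL⟩
      simp only at this h'
      rw [this, h', ih (n + 1) (by omega) fun ℓ hℓ => h ℓ (by omega), h ⟨n, hL⟩ le_rfl]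
    · rw [prodFrom_of_le F (not_lt.1 hL), prodFrom_of_le F' (not_lt.1 hL)]

lemma prodTo_congr {F F' : Fin L → M} {n : ℕ} (h : ∀ ℓ : Fin L, ℓ < n → F ℓ = F' ℓ) :
    prodTo F n = prodTo F' n := by
  induction n with
  | zero => simp [prodTo]
  | succ n ih =>
    by_cases hL : n < L
    · have := prodTo_succ F ⟨n, hL⟩
      have h' := prodTo_succ F' ⟨n, hL⟩
      simp only at this h'
      rw [this, h', ih fun ℓ hℓ => h ℓ (by omega), h ⟨n, hL⟩ (by simp)]
    · have : ∀ G : Fin L → M, prodTo G (n + 1) = prodTo G n := by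
        intro G
        rw [prodTo, prodTo, List.take_of_length_le (by simp; omega),
          List.take_of_length_le (by simp; omega)]
      rw [this, this, ih fun ℓ hℓ => h ℓ (by omega)]

/-- Isolates the effect of moving one parameter: a single factor is multiplied on its right, and
everything before and after stays fixed. -/
lemma prod_reverse_ofFn_of_eq_mul {F F' : Fin L → M} (ℓ : Fin L) {D : M} (hℓ : F' ℓ = F ℓ * D)
    (h : ∀ j, j ≠ ℓ → F' j = F j) :
    (List.ofFn F').reverse.prod = prodFrom F ℓ * D * prodTo F ℓ := by
  rw [← prodFrom_mul_prodTo F' ℓ, prodFrom_eq_mul F' ℓ, prodFrom_eq_mul F ℓ, hℓ,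
    prodFrom_congr (F := F') (F' := F) fun j hj => h j (by rintro rfl; omega),
    prodTo_congr (F := F') (F' := F) fun j hj => h j (by rintro rfl; omega)]
  simp only [mul_assoc]

end OrderedProducts

/-! ### Parameter-shift rule and light cones of the local outputs -/

namespace Circuit

open Matrix

variable {𝒳 : Type*} {m L : ℕ} (C : Circuit 𝒳 m L)

lemma paramLayer_eq (ℓ : Fin L) (Θ : Params L m) :
    C.paramLayer ℓ Θ = tensor fun k => rotation (C.gen ℓ k) (Θ (ℓ, k)) := by
  rw [paramLayer]
  congr 1
  funext k
  exact exp_eq_rotation (C.gen_isHermitian ℓ k) (C.gen_spectrum ℓ k) _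

lemma gen_mul_gen (ℓ : Fin L) (k : Fin m) : C.gen ℓ k * C.gen ℓ k = 1 :=
  mul_self_eq_one (C.gen_isHermitian ℓ k) (C.gen_spectrum ℓ k)

lemma layer_mem_unitaryGroup (Θ : Params L m) (x : 𝒳) (ℓ : Fin L) :
    C.layer Θ x ℓ ∈ Matrix.unitaryGroup (Fin m → Fin 2) ℂ := by
  refine mul_mem (C.inputLayer_mem_unitaryGroup ℓ x) ?_
  rw [paramLayer_eq]
  exact tensor_mem_unitaryGroup fun k =>
    rotation_mem_unitaryGroup (C.gen_isHermitian ℓ k) (C.gen_mul_gen ℓ k) _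

lemma unitary_mem_unitaryGroup (Θ : Params L m) (x : 𝒳) :
    C.unitary Θ x ∈ Matrix.unitaryGroup (Fin m → Fin 2) ℂ :=
  prodFrom_mem (F := C.layer Θ x) (C.layer_mem_unitaryGroup Θ x) 0

lemma abs_localOutput_le (k : Fin m) (Θ : Params L m) (x : 𝒳) : |C.localOutput k Θ x| ≤ 1 :=
  abs_re_conj_onQubit_apply_le k (C.obs_isHermitian k) (C.obs_spectrum k)
    (C.unitary_mem_unitaryGroup Θ x) _

/-- The rotations with a fixed generator form a one-parameter group, so a shift of the angle is an
extra rotation on that qubit. -/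
lemma paramLayer_add_single (Θ : Params L m) (i : Fin L × Fin m) (s : ℝ) :
    C.paramLayer i.1 (Θ + EuclideanSpace.single i s)
      = C.paramLayer i.1 Θ * onQubit i.2 (rotation (C.gen i.1 i.2) s) := by
  rw [paramLayer_eq, paramLayer_eq, tensor_mul_onQubit]
  congr 1
  funext k
  by_cases h : k = i.2
  · subst h
    rw [Function.update_self, ← rotation_add (C.gen_mul_gen _ _)]
    simp
  · have h' : (i.1, k) ≠ i := fun e => h (congrArg Prod.snd e)
    rw [Function.update_of_ne h]
    simp [h']

lemma layer_add_single_self (Θ : Params L m) (x : 𝒳) (i : Fin L × Fin m) (s : ℝ) :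
    C.layer (Θ + EuclideanSpace.single i s) x i.1
      = C.layer Θ x i.1 * onQubit i.2 (rotation (C.gen i.1 i.2) s) := by
  rw [layer, layer, paramLayer_add_single, Matrix.mul_assoc]

lemma layer_add_single_of_ne (Θ : Params L m) (x : 𝒳) (i : Fin L × Fin m) (s : ℝ) {ℓ : Fin L}
    (h : ℓ ≠ i.1) : C.layer (Θ + EuclideanSpace.single i s) x ℓ = C.layer Θ x ℓ := by
  rw [layer, layer, paramLayer, paramLayer]
  congr 2
  funext k
  have h' : (ℓ, k) ≠ i := fun e => h (congrArg Prod.fst e)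
  simp [h']

/-- The Heisenberg evolution of the observable at `k` through the layers from `n` on. -/
def heisenberg (k : Fin m) (Θ : Params L m) (x : 𝒳) (n : ℕ) : Op m :=
  (prodFrom (C.layer Θ x) n)ᴴ * onQubit k (C.obs k) * prodFrom (C.layer Θ x) n

lemma heisenberg_eq (k : Fin m) (Θ : Params L m) (x : 𝒳) (ℓ : Fin L) :
    C.heisenberg k Θ x ℓ
      = (C.layer Θ x ℓ)ᴴ * C.heisenberg k Θ x (ℓ + 1) * C.layer Θ x ℓ := by
  rw [heisenberg, heisenberg, prodFrom_eq_mul, Matrix.conjTranspose_mul]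
  simp only [Matrix.mul_assoc]

/-- The shift conjugates the observable, already evolved back to the layer of the parameter, by one
rotation. Both the parameter-shift rule and the light-cone property are read off from this formula.
-/
lemma localOutput_add_single (k : Fin m) (Θ : Params L m) (x : 𝒳) (i : Fin L × Fin m) (s : ℝ) :
    C.localOutput k (Θ + EuclideanSpace.single i s) x
      = (((prodTo (C.layer Θ x) i.1)ᴴ * ((onQubit i.2 (rotation (C.gen i.1 i.2) s))ᴴ
          * C.heisenberg k Θ x i.1 * onQubit i.2 (rotation (C.gen i.1 i.2) s))
          * prodTo (C.layer Θ x) i.1) (fun _ => 0) (fun _ => 0)).re := by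
  rw [localOutput, unitary, prod_reverse_ofFn_of_eq_mul (F := C.layer Θ x) i.1
    (C.layer_add_single_self Θ x i s) fun j hj => C.layer_add_single_of_ne Θ x i s hj, heisenberg]
  simp only [Matrix.conjTranspose_mul, Matrix.mul_assoc]

/-- As a function of one parameter, the local output is a trigonometric polynomial. -/
lemma exists_localOutput_add_single_eq (k : Fin m) (Θ : Params L m) (x : 𝒳) (i : Fin L × Fin m) :
    ∃ α β γ : ℝ, ∀ s, C.localOutput k (Θ + EuclideanSpace.single i s) x
      = α * Real.cos s ^ 2 + β * (Real.sin s * Real.cos s) + γ * Real.sin s ^ 2 := by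
  set R := prodTo (C.layer Θ x) i.1
  set H := C.heisenberg k Θ x i.1
  set Z := onQubit i.2 (C.gen i.1 i.2) with hZ
  -- The coefficients of `cos²`, `sin cos` and `sin²` in the expansion of `(cos - i sin Z)† H (cos -
  -- i sin Z)`.
  refine ⟨((Rᴴ * H * R) (fun _ => 0) (fun _ => 0)).re,
    ((Rᴴ * (Complex.I • (Zᴴ * H) - Complex.I • (H * Z)) * R) (fun _ => 0) (fun _ => 0)).re,
    ((Rᴴ * (Zᴴ * H * Z) * R) (fun _ => 0) (fun _ => 0)).re, fun s => ?_⟩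
  rw [localOutput_add_single, onQubit_rotation, ← hZ]
  have h : Rᴴ * (((Real.cos s : ℂ) • (1 : Op m) - (Complex.I * (Real.sin s : ℂ)) • Z)ᴴ * H
        * ((Real.cos s : ℂ) • (1 : Op m) - (Complex.I * (Real.sin s : ℂ)) • Z)) * R
      = ((Real.cos s ^ 2 : ℝ) : ℂ) • (Rᴴ * H * R)
        + ((Real.sin s * Real.cos s : ℝ) : ℂ) •
            (Rᴴ * (Complex.I • (Zᴴ * H) - Complex.I • (H * Z)) * R)
        + ((Real.sin s ^ 2 : ℝ) : ℂ) • (Rᴴ * (Zᴴ * H * Z) * R) := by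
    simp only [Matrix.conjTranspose_sub, Matrix.conjTranspose_smul, Matrix.conjTranspose_one,
      star_mul', RCLike.star_def, Complex.conj_I, Complex.conj_ofReal, Matrix.mul_sub,
      Matrix.sub_mul, Matrix.smul_mul, Matrix.mul_smul, Matrix.one_mul, Matrix.mul_one, smul_sub,
      smul_smul, Matrix.mul_assoc]
    have h2 : (-Complex.I * (Real.sin s : ℂ)) * (Complex.I * (Real.sin s : ℂ))
        = ((Real.sin s ^ 2 : ℝ) : ℂ) := by
      push_cast
      linear_combination (-(Complex.sin s) ^ 2) * Complex.I_mul_I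
    have h2' : (Complex.I * (Real.sin s : ℂ)) * (-Complex.I * (Real.sin s : ℂ))
        = ((Real.sin s ^ 2 : ℝ) : ℂ) := by rw [mul_comm, h2]
    simp only [h2']
    push_cast
    module
  rw [h]
  simp only [Matrix.add_apply, Matrix.smul_apply, smul_eq_mul, Complex.add_re,
    Complex.re_ofReal_mul]
  ring

/-- The parameter-shift rule. -/
lemma hasDerivAt_localOutput_add_single (k : Fin m) (Θ : Params L m) (x : 𝒳)
    (i : Fin L × Fin m) :
    HasDerivAt (fun s => C.localOutput k (Θ + EuclideanSpace.single i s) x)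
      (C.localOutput k (Θ + EuclideanSpace.single i (Real.pi / 4)) x
        - C.localOutput k (Θ + EuclideanSpace.single i (-(Real.pi / 4))) x) 0 := by
  obtain ⟨α, β, γ, h⟩ := C.exists_localOutput_add_single_eq k Θ x i
  -- At `±π/4` the squares cancel in the difference and `sin cos = ±1/2`, which leaves `β`; this is
  -- also the derivative at 0.
  have h1 : C.localOutput k (Θ + EuclideanSpace.single i (Real.pi / 4)) x
        - C.localOutput k (Θ + EuclideanSpace.single i (-(Real.pi / 4))) x = β := by
    rw [h, h, Real.cos_neg, Real.sin_neg, Real.cos_pi_div_four, Real.sin_pi_div_four]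
    have := Real.sq_sqrt (show (0 : ℝ) ≤ 2 by norm_num)
    linear_combination (β / 2) * this
  rw [h1]
  simp only [h]
  have hc := Real.hasDerivAt_cos 0
  have hs := Real.hasDerivAt_sin 0
  have := (((hc.pow 2).const_mul α).add ((hs.mul hc).const_mul β)).add ((hs.pow 2).const_mul γ)
  convert! this using 1
  simp

/-- The qubits on which the observable at `k` acts after its evolution through the layers from `n`
on. -/
def support (k : Fin m) (n : ℕ) : Finset (Fin m) :=
  if h : n < L then C.pastQubits k ⟨n, h⟩ else {k}

lemma support_eq_biUnion (k : Fin m) (ℓ : Fin L) :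
    C.support k ℓ = (C.support k (ℓ + 1)).biUnion fun k' => C.interaction ℓ k' := by
  have h0 : C.support k ℓ = C.pastQubits k ℓ := by simp [support]
  rw [h0, pastQubits, support]
  split_ifs with h
  · rfl
  · simp

/-- Backward induction over the layers. If `j` is outside the support before a layer, then `j` and
its partner are outside the support after it. Moving an operator on `j` through the layer produces
an operator on these two qubits, which commutes with the observable evolved so far. -/
lemma commute_heisenberg (k : Fin m) (Θ : Params L m) (x : 𝒳) (n : ℕ) :
    ∀ j ∉ C.support k n, ∀ A, Commute (C.heisenberg k Θ x n) (onQubit j A) := by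
  suffices ∀ d n, L ≤ n + d → ∀ j ∉ C.support k n, ∀ A,
      Commute (C.heisenberg k Θ x n) (onQubit j A) from this L n (by omega)
  intro d
  induction d with
  | zero =>
    intro n hn j hj A
    rw [support, dif_neg (by omega), Finset.mem_singleton] at hj
    rw [heisenberg, prodFrom_of_le _ (by omega), Matrix.conjTranspose_one, Matrix.one_mul,
      Matrix.mul_one]
    exact onQubit_commute (Ne.symm hj) _ _
  | succ d ih =>
    intro n hn j hj A
    by_cases hL : n < L
    swap
    · exact ih n (by omega) j hj A
    obtain ⟨ℓ, rfl⟩ : ∃ ℓ : Fin L, (ℓ : ℕ) = n := ⟨⟨n, hL⟩, rfl⟩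
    rw [support_eq_biUnion] at hj
    simp only [Finset.mem_biUnion, not_exists, not_and, interaction, Finset.mem_insert,
      Finset.mem_singleton, not_or] at hj
    have hj1 : j ∉ C.support k (ℓ + 1) := fun h => (hj j h).1 rfl
    have hj2 : C.partner ℓ j ∉ C.support k (ℓ + 1) := fun h =>
      (hj _ h).2 (C.partner_involutive ℓ j).symm
    set W := C.paramLayer ℓ Θ with hW
    set V := C.inputLayer ℓ x with hV
    set w := rotation (C.gen ℓ j) (Θ (ℓ, j)) with hw
    have hwu : w ∈ Matrix.unitaryGroup (Fin 2) ℂ :=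
      rotation_mem_unitaryGroup (C.gen_isHermitian ℓ j) (C.gen_mul_gen ℓ j) _
    have hww : wᴴ * w = 1 := Matrix.mem_unitaryGroup_iff'.1 hwu
    have hWA : W * onQubit j A = onQubit j (w * A * wᴴ) * W := by
      rw [hW, paramLayer_eq, tensor_mul_onQubit, onQubit, tensor_mul]
      congr 1
      funext i
      by_cases hi : i = j
      · subst hi
        rw [Function.update_self, Function.update_self, ← hw, Matrix.mul_assoc, hww,
          Matrix.mul_one]
      · rw [Function.update_of_ne hi, Function.update_of_ne hi, Matrix.one_mul]
    -- The parameterized gates turn `A` into another operator on `j`; the input-dependent gates then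
    -- turn it into `Y`, living on `j` and its partner.
    obtain ⟨Y, hY, hYc⟩ := C.exists_inputLayer_mul_onQubit ℓ x j (w * A * wᴴ)
    have hHY := hYc _ (ih (ℓ + 1) (by omega) j hj1) (ih (ℓ + 1) (by omega) _ hj2)
    set H := C.heisenberg k Θ x (ℓ + 1)
    set U := C.layer Θ x ℓ with hU
    have hUu := C.layer_mem_unitaryGroup Θ x ℓ
    rw [← hU] at hUu
    have hUA : U * onQubit j A = Y * U := by
      rw [hU, layer, ← hW, ← hV, Matrix.mul_assoc, hWA, ← Matrix.mul_assoc, hY, Matrix.mul_assoc]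
    have hUA' : Uᴴ * Y = onQubit j A * Uᴴ := by
      have h1 : Uᴴ * U = 1 := Matrix.mem_unitaryGroup_iff'.1 hUu
      have h2 : U * Uᴴ = 1 := Matrix.mem_unitaryGroup_iff.1 hUu
      calc Uᴴ * Y = Uᴴ * (Y * U) * Uᴴ := by
            rw [Matrix.mul_assoc, Matrix.mul_assoc, h2, Matrix.mul_one]
        _ = onQubit j A * Uᴴ := by
            rw [← hUA, ← Matrix.mul_assoc, h1, Matrix.one_mul]
    rw [heisenberg_eq]
    change Uᴴ * H * U * onQubit j A = onQubit j A * (Uᴴ * H * U)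
    calc Uᴴ * H * U * onQubit j A = Uᴴ * (H * Y) * U := by
          rw [Matrix.mul_assoc, hUA]; simp only [Matrix.mul_assoc]
      _ = onQubit j A * (Uᴴ * H * U) := by
          rw [hHY.eq, ← Matrix.mul_assoc, hUA']; simp only [Matrix.mul_assoc]

/-- The extra rotation commutes with the evolved observable, so the conjugation by it cancels. -/
lemma localOutput_add_single_of_notMem {k : Fin m} {i : Fin L × Fin m} (hi : i ∉ C.pastCone k)
    (Θ : Params L m) (x : 𝒳) (s : ℝ) :
    C.localOutput k (Θ + EuclideanSpace.single i s) x = C.localOutput k Θ x := by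
  have hi' : i.2 ∉ C.support k i.1 := by
    simpa [support, pastCone] using hi
  have key : ∀ s, (onQubit i.2 (rotation (C.gen i.1 i.2) s))ᴴ * C.heisenberg k Θ x i.1
      * onQubit i.2 (rotation (C.gen i.1 i.2) s) = C.heisenberg k Θ x i.1 := by
    intro s
    have hu := onQubit_mem_unitaryGroup i.2 (rotation_mem_unitaryGroup
      (C.gen_isHermitian i.1 i.2) (C.gen_mul_gen i.1 i.2) s)
    rw [Matrix.mul_assoc, (C.commute_heisenberg k Θ x i.1 i.2 hi' _).eq, ← Matrix.mul_assoc,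
      ← Matrix.star_eq_conjTranspose, Matrix.mem_unitaryGroup_iff'.1 hu, Matrix.one_mul]
  have h0 := C.localOutput_add_single k Θ x i 0
  have hz : Θ + EuclideanSpace.single i (0 : ℝ) = Θ := by
    ext j
    by_cases h : j = i <;> simp [h]
  rw [key, hz] at h0
  rw [localOutput_add_single, key, ← h0]

/-- The local output depends on the parameters in the past light cone only. -/
lemma localOutput_congr (k : Fin m) (x : 𝒳) {Θ Θ' : Params L m}
    (h : ∀ i ∈ C.pastCone k, Θ i = Θ' i) : C.localOutput k Θ x = C.localOutput k Θ' x := by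
  -- The coordinates outside the cone are changed one at a time.
  suffices ∀ s : Finset (Fin L × Fin m), Disjoint s (C.pastCone k) → ∀ Θ : Params L m,
      (∀ i ∉ s, Θ i = Θ' i) → C.localOutput k Θ x = C.localOutput k Θ' x from
    this (C.pastCone k)ᶜ disjoint_compl_left Θ fun i hi => h i (by simpa using hi)
  intro s
  induction s using Finset.induction_on with
  | empty =>
    intro _ Θ hΘ
    congr 1
    ext i
    exact hΘ i (by simp)
  | insert i s hi ih =>
    intro hs Θ hΘ
    rw [Finset.disjoint_insert_left] at hs
    rw [← C.localOutput_add_single_of_notMem hs.1 Θ x (Θ' i - Θ i)]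
    refine ih hs.2 _ fun j hj => ?_
    by_cases hji : j = i
    · subst hji; simp
    · simpa [hji] using hΘ j (by simp [hji, hj])

/-- Differentiability is followed entry by entry, which needs no choice of a norm on matrices. -/
lemma differentiable_entries_mul {E : Type*} [NormedAddCommGroup E] [NormedSpace ℝ E]
    {F G : E → Op m} (hF : ∀ a b, Differentiable ℝ fun v => F v a b)
    (hG : ∀ a b, Differentiable ℝ fun v => G v a b) (a b : Fin m → Fin 2) :
    Differentiable ℝ fun v => (F v * G v) a b := by
  simp only [Matrix.mul_apply]
  exact Differentiable.fun_sum fun c _ => (hF a c).mul (hG c b)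

lemma differentiable_layer (x : 𝒳) (ℓ : Fin L) (a b : Fin m → Fin 2) :
    Differentiable ℝ fun Θ => C.layer Θ x ℓ a b := by
  refine differentiable_entries_mul (F := fun _ => C.inputLayer ℓ x)
    (fun _ _ => differentiable_const _) (fun a b => ?_) a b
  simp only [paramLayer_eq, tensor, Matrix.of_apply, rotation, Matrix.sub_apply, Matrix.smul_apply,
    smul_eq_mul]
  suffices ∀ k : Fin m, Differentiable ℝ fun Θ : Params L m =>
      (Real.cos (Θ (ℓ, k)) : ℂ) * (1 : Op1) (a k) (b k)
        - Complex.I * (Real.sin (Θ (ℓ, k)) : ℂ) * C.gen ℓ k (a k) (b k) from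
    fun Θ => (HasFDerivAt.finsetProd fun k _ => (this k Θ).hasFDerivAt).differentiableAt
  intro k
  have h0 : Differentiable ℝ fun Θ : Params L m => Θ (ℓ, k) := by fun_prop
  have h1 : Differentiable ℝ fun Θ : Params L m => ((Real.cos (Θ (ℓ, k)) : ℝ) : ℂ) :=
    Complex.ofRealCLM.differentiable.comp h0.cos
  have h2 : Differentiable ℝ fun Θ : Params L m => ((Real.sin (Θ (ℓ, k)) : ℝ) : ℂ) :=
    Complex.ofRealCLM.differentiable.comp h0.sin
  fun_prop

lemma differentiable_unitary (x : 𝒳) (a b : Fin m → Fin 2) :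
    Differentiable ℝ fun Θ => C.unitary Θ x a b := by
  suffices ∀ n, ∀ a b, Differentiable ℝ fun Θ => prodTo (C.layer Θ x) n a b by
    have h : ∀ Θ, C.unitary Θ x = prodTo (C.layer Θ x) L := by
      intro Θ
      rw [unitary, ← prodFrom_mul_prodTo _ L, prodFrom_of_le _ le_rfl, Matrix.one_mul]
    simpa only [h] using this L a b
  intro n
  induction n with
  | zero => intro a b; simp [prodTo]
  | succ n ih =>
    intro a b
    by_cases h : n < L
    · have := fun Θ => prodTo_succ (C.layer Θ x) ⟨n, h⟩
      simp only at this
      simp only [this]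
      exact differentiable_entries_mul (C.differentiable_layer x ⟨n, h⟩) ih a b
    · have : ∀ Θ, prodTo (C.layer Θ x) (n + 1) = prodTo (C.layer Θ x) n := by
        intro Θ
        rw [prodTo, prodTo, List.take_of_length_le (by simp; omega),
          List.take_of_length_le (by simp; omega)]
      simpa only [this] using ih a b

lemma differentiable_localOutput (k : Fin m) (x : 𝒳) :
    Differentiable ℝ fun Θ => C.localOutput k Θ x := by
  have h : ∀ a b, Differentiable ℝ fun Θ : Params L m => ((C.unitary Θ x)ᴴ) a b := by
    intro a b
    simp only [Matrix.conjTranspose_apply]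
    exact (Complex.conjCLE.toContinuousLinearMap.differentiable).comp
      (C.differentiable_unitary x b a)
  have h' : ∀ a b, Differentiable ℝ fun Θ : Params L m =>
      ((C.unitary Θ x)ᴴ * onQubit k (C.obs k)) a b :=
    differentiable_entries_mul h fun _ _ => differentiable_const _
  have h'' := differentiable_entries_mul h' (C.differentiable_unitary x) (fun _ => 0) (fun _ => 0)
  simp only [localOutput]
  exact Complex.reCLM.differentiable.comp h''

end Circuit

/-! ### Functions of independent coordinates -/

section Coordinates

variable {ι : Type*} [DecidableEq ι] {μ : Measure (ι → ℝ)}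

lemma indepFun_of_dependsOn (hμ : iIndepFun (fun i (u : ι → ℝ) => u i) μ) {β γ : Type*}
    [MeasurableSpace β] [MeasurableSpace γ] {f : (ι → ℝ) → β} {g : (ι → ℝ) → γ} {S T : Finset ι}
    (hf : Measurable f) (hg : Measurable g) (hfS : DependsOn f (S : Set ι))
    (hgT : DependsOn g (T : Set ι)) (hST : Disjoint S T) : IndepFun f g μ := by
  -- Extending by 0 off `S` lets a function that depends on `S` only factor through the coordinates
  -- in `S`; the filler value is immaterial.
  have hext : ∀ S : Finset ι, Measurable fun (v : S → ℝ) (i : ι) =>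
      if h : i ∈ S then v ⟨i, h⟩ else 0 := by
    intro S
    refine measurable_pi_lambda _ fun i => ?_
    by_cases h : i ∈ S
    · simpa [h] using measurable_pi_apply _
    · simp [h]
  have h := (hμ.indepFun_finset S T hST fun i => measurable_pi_apply i).comp
    (hf.comp (hext S)) (hg.comp (hext T))
  convert! h using 1
  · funext u
    exact hfS fun i hi => by simp [Finset.mem_coe.1 hi]
  · funext u
    exact hgT fun i hi => by simp [Finset.mem_coe.1 hi]

lemma integral_mul_of_dependsOn (hμ : iIndepFun (fun i (u : ι → ℝ) => u i) μ) {𝕜 : Type*}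
    [RCLike 𝕜] {f g : (ι → ℝ) → 𝕜} {S T : Finset ι}
    (hf : Measurable f) (hg : Measurable g) (hfS : DependsOn f (S : Set ι))
    (hgT : DependsOn g (T : Set ι)) (hST : Disjoint S T) :
    ∫ u, f u * g u ∂μ = (∫ u, f u ∂μ) * ∫ u, g u ∂μ :=
  (indepFun_of_dependsOn hμ hf hg hfS hgT hST).integral_fun_mul_eq_mul_integral
    hf.aestronglyMeasurable hg.aestronglyMeasurable

end Coordinates

lemma integrable_of_norm_le {Ω E : Type*} [MeasurableSpace Ω] {μ : Measure Ω} [IsFiniteMeasure μ]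
    [NormedAddCommGroup E] {f : Ω → E} (hf : AEStronglyMeasurable f μ) {C : ℝ}
    (h : ∀ u, ‖f u‖ ≤ C) : Integrable f μ :=
  Integrable.of_bound hf C (ae_of_all _ h)

lemma norm_integral_le_of_forall_norm_le {Ω E : Type*} [MeasurableSpace Ω] {μ : Measure Ω}
    [IsProbabilityMeasure μ] [NormedAddCommGroup E] [NormedSpace ℝ E] {f : Ω → E} {C : ℝ}
    (h : ∀ u, ‖f u‖ ≤ C) : ‖∫ u, f u ∂μ‖ ≤ C := by
  simpa using norm_integral_le_of_norm_le_const (μ := μ) (ae_of_all _ h)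

/-! ### Variance of a sum of local functions -/

/-- Expand the variance into covariances. Those with disjoint `S p`, `S q` vanish. The others are at
most `(2 b p) (2 b q)`, the 2 coming from centring, and are charged to every shared coordinate `j`;
summing over `p` and `q` for fixed `j` produces a square. -/
lemma integral_sq_sub_integral_le {ι κ : Type*} [Fintype ι] [DecidableEq ι] [Fintype κ]
    {μ : Measure (ι → ℝ)} [IsProbabilityMeasure μ] (hμ : iIndepFun (fun i (u : ι → ℝ) => u i) μ)
    {g : κ → (ι → ℝ) → ℝ} (hg : ∀ p, Measurable (g p)) {S : κ → Finset ι}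
    (hS : ∀ p, DependsOn (g p) (S p : Set ι)) {b : κ → ℝ} (hb : ∀ p u, |g p u| ≤ b p) :
    ∫ u, (∑ p, g p u - ∫ v, ∑ p, g p v ∂μ) ^ 2 ∂μ
      ≤ 4 * ∑ j, (∑ p with j ∈ S p, b p) ^ 2 := by
  have hb0 : ∀ p, 0 ≤ b p := fun p => (abs_nonneg _).trans (hb p 0)
  set e : κ → ℝ := fun p => ∫ v, g p v ∂μ with he
  have hint : ∀ p, Integrable (g p) μ := fun p =>
    integrable_of_norm_le (hg p).aestronglyMeasurable (hb p)
  have he' : ∀ p, ‖e p‖ ≤ b p := fun p => norm_integral_le_of_forall_norm_le (hb p)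
  have hg' : ∀ p, Measurable fun u => g p u - e p := fun p => (hg p).sub_const _
  have hbd : ∀ p u, |g p u - e p| ≤ 2 * b p := fun p u => by
    have := abs_sub (g p u) (e p)
    have h' := he' p
    rw [Real.norm_eq_abs] at h'
    linarith [hb p u]
  have hcov : ∀ p q, ∫ u, (g p u - e p) * (g q u - e q) ∂μ
      ≤ ∑ j, if j ∈ S p ∧ j ∈ S q then 4 * (b p * b q) else 0 := by
    intro p q
    by_cases hd : Disjoint (S p) (S q)
    · have h0 : ∫ u, (g p u - e p) ∂μ = 0 := by
        rw [integral_sub (hint p) (integrable_const _)]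
        simp [he]
      rw [integral_mul_of_dependsOn hμ (hg' p) (hg' q)
        (fun u v h => by simp only [hS p h]) (fun u v h => by simp only [hS q h]) hd, h0, zero_mul]
      exact Finset.sum_nonneg fun j _ => by
        split_ifs
        · exact mul_nonneg (by norm_num) (mul_nonneg (hb0 p) (hb0 q))
        · exact le_rfl
    · obtain ⟨j, hjp, hjq⟩ := Finset.not_disjoint_iff.1 hd
      calc ∫ u, (g p u - e p) * (g q u - e q) ∂μ
          ≤ ‖∫ u, (g p u - e p) * (g q u - e q) ∂μ‖ := le_abs_self _
        _ ≤ 4 * (b p * b q) := norm_integral_le_of_forall_norm_le fun u => by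
            rw [Real.norm_eq_abs, abs_mul]
            calc _ ≤ (2 * b p) * (2 * b q) :=
                  mul_le_mul (hbd p u) (hbd q u) (abs_nonneg _) (by linarith [hb0 p])
              _ = _ := by ring
        _ = if j ∈ S p ∧ j ∈ S q then 4 * (b p * b q) else 0 := by rw [if_pos ⟨hjp, hjq⟩]
        _ ≤ _ := Finset.single_le_sum
            (f := fun j => if j ∈ S p ∧ j ∈ S q then 4 * (b p * b q) else 0)
            (fun j _ => by
              split_ifs
              · exact mul_nonneg (by norm_num) (mul_nonneg (hb0 p) (hb0 q))
              · exact le_rfl) (Finset.mem_univ j)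
  have hint2 : ∀ p q, Integrable (fun u => (g p u - e p) * (g q u - e q)) μ := fun p q =>
    integrable_of_norm_le ((hg' p).mul (hg' q)).aestronglyMeasurable (C := (2 * b p) * (2 * b q))
      fun u => by
        rw [Real.norm_eq_abs, abs_mul]
        exact mul_le_mul (hbd p u) (hbd q u) (abs_nonneg _) (by linarith [hb0 p])
  have hsq : ∀ u, (∑ p, g p u - ∫ v, ∑ p, g p v ∂μ) ^ 2
      = ∑ p, ∑ q, (g p u - e p) * (g q u - e q) := by
    intro u
    rw [integral_finsetSum _ fun p _ => hint p, ← Finset.sum_sub_distrib, sq,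
      Finset.sum_mul_sum]
  simp only [hsq]
  rw [integral_finsetSum _ fun p _ => integrable_finsetSum _ fun q _ => hint2 p q]
  simp only [integral_finsetSum _ fun q _ => hint2 _ q]
  calc ∑ p, ∑ q, ∫ u, (g p u - e p) * (g q u - e q) ∂μ
      ≤ ∑ p, ∑ q, ∑ j, (if j ∈ S p ∧ j ∈ S q then 4 * (b p * b q) else 0) :=
        Finset.sum_le_sum fun p _ => Finset.sum_le_sum fun q _ => hcov p q
    _ = ∑ j, ∑ p, ∑ q, (if j ∈ S p ∧ j ∈ S q then 4 * (b p * b q) else 0) := by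
        rw [Finset.sum_comm (s := (Finset.univ : Finset ι))]
        exact Finset.sum_congr rfl fun p _ => Finset.sum_comm
    _ = 4 * ∑ j, (∑ p with j ∈ S p, b p) ^ 2 := by
        rw [Finset.mul_sum]
        refine Finset.sum_congr rfl fun j _ => ?_
        rw [sq, Finset.sum_mul_sum, Finset.mul_sum, Finset.sum_filter]
        refine Finset.sum_congr rfl fun p _ => ?_
        by_cases hp : j ∈ S p
        · simp [hp, Finset.sum_filter, Finset.mul_sum]
        · simp [hp]

/-! ### A central limit theorem for sums of locally dependent functions -/

/-- The constant 3 is not sharp: 1 suffices for `|x| ≤ 1`, and for `|x| ≥ 1` the left side is at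
most `2 |x|`. -/
lemma norm_exp_I_mul_sub_one_sub_le (x : ℝ) :
    ‖Complex.exp (Complex.I * x) - 1 - Complex.I * x‖ ≤ 3 * x ^ 2 := by
  have hn : ‖Complex.I * (x : ℂ)‖ = |x| := by simp
  rcases le_total |x| 1 with h | h
  · have := Complex.norm_exp_sub_one_sub_id_le (x := Complex.I * x) (by rwa [hn])
    rw [hn, sq_abs] at this
    linarith [sq_nonneg x]
  · have h1 : ‖Complex.exp (Complex.I * x) - 1‖ ≤ |x| := Real.norm_exp_I_mul_ofReal_sub_one_le
    have h2 := norm_sub_le (Complex.exp (Complex.I * x) - 1) (Complex.I * x)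
    rw [hn] at h2
    nlinarith [sq_abs x]

lemma norm_exp_I_mul (x : ℝ) : ‖Complex.exp (Complex.I * x)‖ = 1 := by
  rw [mul_comm, Complex.norm_exp_ofReal_mul_I]

lemma norm_exp_I_mul_sub_exp_I_mul_le (a b : ℝ) :
    ‖Complex.exp (Complex.I * a) - Complex.exp (Complex.I * b)‖ ≤ |a - b| := by
  have h : Complex.exp (Complex.I * a) - Complex.exp (Complex.I * b)
      = Complex.exp (Complex.I * b) * (Complex.exp (Complex.I * ((a - b : ℝ) : ℂ)) - 1) := by
    rw [mul_sub, ← Complex.exp_add]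
    push_cast
    ring_nf
  rw [h, norm_mul, norm_exp_I_mul, one_mul]
  exact Real.norm_exp_I_mul_ofReal_sub_one_le

lemma norm_exp_I_mul_sub_exp_I_mul_sub_le (a b : ℝ) :
    ‖Complex.exp (Complex.I * a) - Complex.exp (Complex.I * b)
        - Complex.exp (Complex.I * a) * (Complex.I * ((a - b : ℝ) : ℂ))‖ ≤ 3 * (a - b) ^ 2 := by
  have h : Complex.exp (Complex.I * a) - Complex.exp (Complex.I * b)
        - Complex.exp (Complex.I * a) * (Complex.I * ((a - b : ℝ) : ℂ))
      = -(Complex.exp (Complex.I * a) * (Complex.exp (Complex.I * ((b - a : ℝ) : ℂ)) - 1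
          - Complex.I * ((b - a : ℝ) : ℂ))) := by
    have : Complex.exp (Complex.I * b)
        = Complex.exp (Complex.I * a) * Complex.exp (Complex.I * ((b - a : ℝ) : ℂ)) := by
      rw [← Complex.exp_add]
      push_cast
      ring_nf
    rw [this]
    push_cast
    ring
  rw [h, norm_neg, norm_mul, norm_exp_I_mul, one_mul]
  refine (norm_exp_I_mul_sub_one_sub_le _).trans (le_of_eq ?_)
  ring

lemma abs_sum_le_card_mul {α κ : Type*} {g : κ → α → ℝ} {B : ℝ} (hB : ∀ k u, |g k u| ≤ B)
    (N : Finset κ) (u : α) :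
    |∑ k ∈ N, g k u| ≤ N.card * B := by
  refine (Finset.abs_sum_le_sum_abs _ _).trans ?_
  rw [← nsmul_eq_mul]
  exact Finset.sum_le_card_nsmul _ _ _ fun k _ => hB k u

section LocalDependence

variable {ι κ : Type*} [Fintype ι] [DecidableEq ι] [Fintype κ] [DecidableEq κ]

/-- The indices whose sets of coordinates meet that of `k`. -/
def neighbours (S : κ → Finset ι) (k : κ) : Finset κ := {l | ¬ Disjoint (S k) (S l)}

/-- The decoupling device: once the terms touching `T` are removed, the sum no longer reads the
coordinates in `T`. -/
lemma dependsOn_sum_sub_sum {S : κ → Finset ι} {g : κ → (ι → ℝ) → ℝ}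
    (hS : ∀ k, DependsOn (g k) (S k : Set ι)) (N : Finset κ) (T : Finset ι)
    (hN : ∀ l ∉ N, Disjoint T (S l)) :
    DependsOn (fun u => ∑ k, g k u - ∑ l ∈ N, g l u) ((Tᶜ : Finset ι) : Set ι) := by
  intro u v h
  have : ∀ u, ∑ k, g k u - ∑ l ∈ N, g l u = ∑ k ∈ Nᶜ, g k u := fun u => by
    rw [← Finset.sum_compl_add_sum N, add_sub_cancel_right]
  simp only [this]
  refine Finset.sum_congr rfl fun l hl => hS l fun i hi => h i ?_
  have := Finset.disjoint_right.1 (hN l (by simpa using hl)) (Finset.mem_coe.1 hi)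
  simpa using this

variable {μ : Measure (ι → ℝ)} [IsProbabilityMeasure μ] {g : κ → (ι → ℝ) → ℝ} {S : κ → Finset ι}
  {B D : ℝ}

/-- Removing from the exponent the neighbours of `k` and of `l`, at most `2 D` terms, makes the
exponential independent of `g k * g l`. This costs `2 s D B` in the exponential and is done in both
integrals, hence the 4. -/
lemma norm_integral_mul_mul_exp_sub_le (hμ : iIndepFun (fun i (u : ι → ℝ) => u i) μ)
    (hg : ∀ k, Measurable (g k)) (hS : ∀ k, DependsOn (g k) (S k : Set ι))
    (hB0 : 0 ≤ B) (hB : ∀ k u, |g k u| ≤ B)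
    (hD : ∀ k, ((neighbours S k).card : ℝ) ≤ D) (k l : κ) {s : ℝ} (hs : 0 ≤ s) :
    ‖∫ u, ((g k u * g l u : ℝ) : ℂ) * Complex.exp (Complex.I * ((s * ∑ j, g j u : ℝ) : ℂ)) ∂μ
      - ((∫ u, g k u * g l u ∂μ : ℝ) : ℂ)
        * ∫ u, Complex.exp (Complex.I * ((s * ∑ j, g j u : ℝ) : ℂ)) ∂μ‖
      ≤ 4 * s * D * B ^ 3 := by
  set N := neighbours S k ∪ neighbours S l with hN
  set e : (ι → ℝ) → ℂ := fun u => Complex.exp (Complex.I * ((s * ∑ j, g j u : ℝ) : ℂ)) with he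
  set R : (ι → ℝ) → ℂ := fun u =>
    Complex.exp (Complex.I * ((s * (∑ j, g j u - ∑ j ∈ N, g j u) : ℝ) : ℂ)) with hR
  have hem : Measurable e := by fun_prop
  have hRm : Measurable R := by fun_prop
  have hcard : (N.card : ℝ) ≤ 2 * D := by
    have h1 : (N.card : ℝ) ≤ (neighbours S k).card + (neighbours S l).card := by
      exact_mod_cast Finset.card_union_le _ _
    linarith [hD k, hD l]
  have hdiff : ∀ u, ‖e u - R u‖ ≤ 2 * s * D * B := by
    intro u
    refine (norm_exp_I_mul_sub_exp_I_mul_le _ _).trans ?_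
    have : s * ∑ j, g j u - s * (∑ j, g j u - ∑ j ∈ N, g j u) = s * ∑ j ∈ N, g j u := by ring
    rw [this, abs_mul, abs_of_nonneg hs]
    calc s * |∑ j ∈ N, g j u| ≤ s * (2 * D * B) :=
          mul_le_mul_of_nonneg_left ((abs_sum_le_card_mul hB N u).trans
            (mul_le_mul_of_nonneg_right hcard hB0)) hs
      _ = _ := by ring
  have hprod : ∀ u, |g k u * g l u| ≤ B ^ 2 := fun u => by
    rw [abs_mul, sq]; exact mul_le_mul (hB k u) (hB l u) (abs_nonneg _) hB0
  have hind : ∫ u, ((g k u * g l u : ℝ) : ℂ) * R u ∂μ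
      = ((∫ u, g k u * g l u ∂μ : ℝ) : ℂ) * ∫ u, R u ∂μ := by
    rw [← integral_complex_ofReal]
    refine integral_mul_of_dependsOn hμ (S := S k ∪ S l) (T := (S k ∪ S l)ᶜ) (by fun_prop) hRm
      ?_ ?_ disjoint_compl_right
    · intro u v h
      simp only [hS k fun i hi => h i (by simp [Finset.mem_coe.1 hi]),
        hS l fun i hi => h i (by simp [Finset.mem_coe.1 hi])]
    · intro u v h
      have h' := dependsOn_sum_sub_sum hS N (S k ∪ S l) (fun j hj => by
        simp only [hN, neighbours, Finset.mem_union, Finset.mem_filter, Finset.mem_univ, true_and,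
          not_or, not_not] at hj
        exact Finset.disjoint_union_left.2 hj) h
      simp only at h'
      simp only [hR, h']
  have hie : Integrable e μ := integrable_of_norm_le hem.aestronglyMeasurable
    fun u => (norm_exp_I_mul _).le
  have hiR : Integrable R μ := integrable_of_norm_le hRm.aestronglyMeasurable
    fun u => (norm_exp_I_mul _).le
  have hpm : Measurable fun u => ((g k u * g l u : ℝ) : ℂ) := by fun_prop
  have hie' : Integrable (fun u => ((g k u * g l u : ℝ) : ℂ) * e u) μ :=
    integrable_of_norm_le (hpm.mul hem).aestronglyMeasurable (C := B ^ 2 * 1) fun u => by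
      rw [norm_mul, Complex.norm_real]
      exact mul_le_mul (hprod u) (norm_exp_I_mul _).le (norm_nonneg _) (sq_nonneg _)
  have hiR' : Integrable (fun u => ((g k u * g l u : ℝ) : ℂ) * R u) μ :=
    integrable_of_norm_le (hpm.mul hRm).aestronglyMeasurable (C := B ^ 2 * 1) fun u => by
      rw [norm_mul, Complex.norm_real]
      exact mul_le_mul (hprod u) (norm_exp_I_mul _).le (norm_nonneg _) (sq_nonneg _)
  have hsplit : ∫ u, ((g k u * g l u : ℝ) : ℂ) * e u ∂μ
        - ((∫ u, g k u * g l u ∂μ : ℝ) : ℂ) * ∫ u, e u ∂μ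
      = ∫ u, ((g k u * g l u : ℝ) : ℂ) * (e u - R u) ∂μ
        - ((∫ u, g k u * g l u ∂μ : ℝ) : ℂ) * ∫ u, (e u - R u) ∂μ := by
    simp only [mul_sub]
    rw [integral_sub hie' hiR', integral_sub hie hiR, hind]
    ring
  rw [hsplit]
  have hC : 0 ≤ 2 * s * D * B := (norm_nonneg _).trans (hdiff 0)
  refine (norm_sub_le _ _).trans ?_
  have h1 : ‖∫ u, ((g k u * g l u : ℝ) : ℂ) * (e u - R u) ∂μ‖ ≤ B ^ 2 * (2 * s * D * B) :=
    norm_integral_le_of_forall_norm_le fun u => by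
      rw [norm_mul, Complex.norm_real]
      exact mul_le_mul (hprod u) (hdiff u) (norm_nonneg _) (sq_nonneg _)
  have h2 : ‖((∫ u, g k u * g l u ∂μ : ℝ) : ℂ) * ∫ u, (e u - R u) ∂μ‖
      ≤ B ^ 2 * (2 * s * D * B) := by
    rw [norm_mul, Complex.norm_real]
    exact mul_le_mul (norm_integral_le_of_forall_norm_le hprod)
      (norm_integral_le_of_forall_norm_le hdiff) (norm_nonneg _) (sq_nonneg _)
  calc _ ≤ B ^ 2 * (2 * s * D * B) + B ^ 2 * (2 * s * D * B) := add_le_add h1 h2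
    _ = _ := by ring

/-- Taylor expansion in the contribution of the neighbours of `k` to the exponent. The exponential
without them is independent of the centred `g k`, so its term vanishes; the linear term is the sum
over neighbours, and the quadratic remainder is bounded by `3 (s D B)²`. -/
lemma norm_integral_mul_exp_sub_le (hμ : iIndepFun (fun i (u : ι → ℝ) => u i) μ)
    (hg : ∀ k, Measurable (g k)) (hS : ∀ k, DependsOn (g k) (S k : Set ι))
    (hB0 : 0 ≤ B) (hB : ∀ k u, |g k u| ≤ B)
    (hD : ∀ k, ((neighbours S k).card : ℝ) ≤ D) (k : κ) (hmean : ∫ u, g k u ∂μ = 0) (s : ℝ) :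
    ‖∫ u, (g k u : ℂ) * Complex.exp (Complex.I * ((s * ∑ j, g j u : ℝ) : ℂ)) ∂μ
      - Complex.I * s * ∑ l ∈ neighbours S k, ∫ u, ((g k u * g l u : ℝ) : ℂ)
        * Complex.exp (Complex.I * ((s * ∑ j, g j u : ℝ) : ℂ)) ∂μ‖
      ≤ 3 * s ^ 2 * D ^ 2 * B ^ 3 := by
  set N := neighbours S k with hN
  set e : (ι → ℝ) → ℂ := fun u => Complex.exp (Complex.I * ((s * ∑ j, g j u : ℝ) : ℂ)) with he
  set R : (ι → ℝ) → ℂ := fun u =>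
    Complex.exp (Complex.I * ((s * (∑ j, g j u - ∑ j ∈ N, g j u) : ℝ) : ℂ)) with hR
  have hem : Measurable e := by fun_prop
  have hRm : Measurable R := by fun_prop
  have hgm : Measurable fun u => (g k u : ℂ) := by fun_prop
  have hind : ∫ u, (g k u : ℂ) * R u ∂μ = 0 := by
    rw [integral_mul_of_dependsOn hμ (S := S k) (T := (S k)ᶜ) hgm hRm
      (fun u v h => by simp only [hS k h]) ?_ disjoint_compl_right, integral_complex_ofReal, hmean,
      Complex.ofReal_zero, zero_mul]
    intro u v h
    have h' := dependsOn_sum_sub_sum hS N (S k) (fun j hj => by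
      simpa [hN, neighbours] using hj) h
    simp only at h'
    simp only [hR, h']
  have hie : Integrable (fun u => (g k u : ℂ) * e u) μ :=
    integrable_of_norm_le (hgm.mul hem).aestronglyMeasurable (C := B * 1) fun u => by
      rw [norm_mul, Complex.norm_real]
      exact mul_le_mul (hB k u) (norm_exp_I_mul _).le (norm_nonneg _) hB0
  have hiR : Integrable (fun u => (g k u : ℂ) * R u) μ :=
    integrable_of_norm_le (hgm.mul hRm).aestronglyMeasurable (C := B * 1) fun u => by
      rw [norm_mul, Complex.norm_real]
      exact mul_le_mul (hB k u) (norm_exp_I_mul _).le (norm_nonneg _) hB0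
  have hie2 : ∀ l, Integrable (fun u => ((g k u * g l u : ℝ) : ℂ) * e u) μ := fun l =>
    integrable_of_norm_le (Measurable.aestronglyMeasurable (by fun_prop)) (C := (B * B) * 1)
      fun u => by
        rw [norm_mul, Complex.norm_real, norm_mul]
        exact mul_le_mul (mul_le_mul (hB k u) (hB l u) (abs_nonneg _) hB0)
          (norm_exp_I_mul _).le (norm_nonneg _) (mul_nonneg hB0 hB0)
  have hsplit : ∫ u, (g k u : ℂ) * e u ∂μ
        - Complex.I * s * ∑ l ∈ N, ∫ u, ((g k u * g l u : ℝ) : ℂ) * e u ∂μ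
      = ∫ u, (g k u : ℂ) * (e u - R u
          - e u * (Complex.I * ((s * ∑ j, g j u - s * (∑ j, g j u - ∑ j ∈ N, g j u) : ℝ) : ℂ)))
        ∂μ := by
    have hpt : ∀ u, (g k u : ℂ) * (e u - R u
          - e u * (Complex.I * ((s * ∑ j, g j u - s * (∑ j, g j u - ∑ j ∈ N, g j u) : ℝ) : ℂ)))
        = (g k u : ℂ) * e u - (g k u : ℂ) * R u
          - Complex.I * s * ∑ l ∈ N, ((g k u * g l u : ℝ) : ℂ) * e u := by
      intro u
      have : ∑ l ∈ N, ((g k u * g l u : ℝ) : ℂ) * e u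
          = (g k u : ℂ) * ((∑ l ∈ N, g l u : ℝ) : ℂ) * e u := by
        rw [← Finset.sum_mul]
        congr 1
        push_cast
        rw [Finset.mul_sum]
      rw [this]
      push_cast
      ring
    have hsub : Integrable (fun u => (g k u : ℂ) * e u - (g k u : ℂ) * R u) μ := hie.sub hiR
    have hsum : Integrable
        (fun u => Complex.I * s * ∑ l ∈ N, ((g k u * g l u : ℝ) : ℂ) * e u) μ :=
      (integrable_finsetSum _ fun l _ => hie2 l).const_mul _
    simp only [hpt]
    rw [integral_sub hsub hsum,
      integral_sub hie hiR, hind, integral_const_mul, integral_finsetSum _ fun l _ => hie2 l,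
      sub_zero]
  rw [hsplit]
  refine norm_integral_le_of_forall_norm_le fun u => ?_
  rw [norm_mul, Complex.norm_real]
  have hT : (s * ∑ j, g j u - s * (∑ j, g j u - ∑ j ∈ N, g j u)) ^ 2 ≤ s ^ 2 * D ^ 2 * B ^ 2 := by
    have h1 : s * ∑ j, g j u - s * (∑ j, g j u - ∑ j ∈ N, g j u) = s * ∑ j ∈ N, g j u := by ring
    have h2 : (∑ j ∈ N, g j u) ^ 2 ≤ (D * B) ^ 2 := by
      rw [← sq_abs]
      exact pow_le_pow_left₀ (abs_nonneg _) ((abs_sum_le_card_mul hB N u).trans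
        (mul_le_mul_of_nonneg_right (hD k) hB0)) 2
    rw [h1, mul_pow]
    calc _ ≤ s ^ 2 * (D * B) ^ 2 := mul_le_mul_of_nonneg_left h2 (sq_nonneg s)
      _ = _ := by ring
  calc _ ≤ B * (3 * (s * ∑ j, g j u - s * (∑ j, g j u - ∑ j ∈ N, g j u)) ^ 2) :=
        mul_le_mul (hB k u) (norm_exp_I_mul_sub_exp_I_mul_sub_le _ _) (norm_nonneg _) hB0
    _ ≤ B * (3 * (s ^ 2 * D ^ 2 * B ^ 2)) := by gcongr
    _ = _ := by ring

/-- A quantitative central limit theorem for a sum of bounded centred functions of independent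
coordinates, each of which shares coordinates with at most `D` others. -/
theorem norm_integral_exp_sum_sub_exp_le (hμ : iIndepFun (fun i (u : ι → ℝ) => u i) μ)
    (hg : ∀ k, Measurable (g k)) (hS : ∀ k, DependsOn (g k) (S k : Set ι))
    (hB0 : 0 ≤ B) (hB : ∀ k u, |g k u| ≤ B)
    (hD : ∀ k, ((neighbours S k).card : ℝ) ≤ D) (hmean : ∀ k, ∫ u, g k u ∂μ = 0) :
    ‖∫ u, Complex.exp (Complex.I * ((∑ k, g k u : ℝ) : ℂ)) ∂μ
      - Complex.exp ((-(∫ u, (∑ k, g k u) ^ 2 ∂μ) / 2 : ℝ) : ℂ)‖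
      ≤ 7 * (Fintype.card κ * D ^ 2 * B ^ 3) := by
  set W : (ι → ℝ) → ℝ := fun u => ∑ k, g k u with hW
  set V : ℝ := ∫ u, W u ^ 2 ∂μ with hV
  have hV0 : 0 ≤ V := integral_nonneg fun u => sq_nonneg _
  set C : ℝ := 7 * (Fintype.card κ * D ^ 2 * B ^ 3) with hC
  set φ : ℝ → ℂ := fun s => ∫ u, Complex.exp (Complex.I * ((s * W u : ℝ) : ℂ)) ∂μ with hφ
  set φ' : ℝ → ℂ := fun s =>
    ∫ u, Complex.I * (W u : ℂ) * Complex.exp (Complex.I * ((s * W u : ℝ) : ℂ)) ∂μ with hφ'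
  have hWm : Measurable W := by fun_prop
  have hWb : ∀ u, |W u| ≤ Fintype.card κ * B := fun u => by
    simpa using abs_sum_le_card_mul hB Finset.univ u
  have hderiv : ∀ s, HasDerivAt φ (φ' s) s := by
    intro s
    refine (hasDerivAt_integral_of_dominated_loc_of_deriv_le (μ := μ) (s := Set.univ)
      (bound := fun _ => Fintype.card κ * B) (F := fun s u =>
        Complex.exp (Complex.I * ((s * W u : ℝ) : ℂ))) (F' := fun s u =>
        Complex.I * (W u : ℂ) * Complex.exp (Complex.I * ((s * W u : ℝ) : ℂ))) univ_mem
      (.of_forall fun s => Measurable.aestronglyMeasurable (by fun_prop)) ?_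
      (Measurable.aestronglyMeasurable (by fun_prop)) ?_ (integrable_const _) ?_).2
    · exact integrable_of_norm_le (Measurable.aestronglyMeasurable (by fun_prop))
        fun u => (norm_exp_I_mul _).le
    · refine ae_of_all _ fun u s _ => ?_
      rw [norm_mul, norm_mul, norm_exp_I_mul, Complex.norm_real, Complex.norm_I, one_mul, mul_one]
      exact hWb u
    · refine ae_of_all _ fun u s _ => ?_
      have h1 : HasDerivAt (fun s : ℝ => Complex.I * ((s * W u : ℝ) : ℂ))
          (Complex.I * (W u : ℂ)) s := by
        have := ((hasDerivAt_id s).mul_const (W u)).ofReal_comp.const_mul Complex.I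
        simpa using this
      simpa [mul_comm] using h1.cexp
  have hgi : ∀ k (s : ℝ), Integrable (fun u => (g k u : ℂ)
      * Complex.exp (Complex.I * ((s * W u : ℝ) : ℂ))) μ := fun k s =>
    integrable_of_norm_le (Measurable.aestronglyMeasurable (by fun_prop)) (C := B * 1) fun u => by
      rw [norm_mul, Complex.norm_real]
      exact mul_le_mul (hB k u) (norm_exp_I_mul _).le (norm_nonneg _) hB0
  have hggi : ∀ k l, Integrable (fun u => g k u * g l u) μ := fun k l =>
    integrable_of_norm_le (Measurable.aestronglyMeasurable (by fun_prop)) (C := B * B) fun u => by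
      rw [norm_mul]
      exact mul_le_mul (hB k u) (hB l u) (abs_nonneg _) hB0
  have hφ'_eq : ∀ s, φ' s = Complex.I * ∑ k, ∫ u, (g k u : ℂ)
      * Complex.exp (Complex.I * ((s * W u : ℝ) : ℂ)) ∂μ := by
    intro s
    rw [← integral_finsetSum _ fun k _ => hgi k s, ← integral_const_mul]
    refine integral_congr_ae (ae_of_all _ fun u => ?_)
    simp only [← Finset.sum_mul]
    rw [mul_assoc, hW]
    push_cast
    rfl
  -- Terms that are not neighbours are independent and centred, so only neighbours contribute to the
  -- variance.
  have hV_eq : V = ∑ k, ∑ l ∈ neighbours S k, ∫ u, g k u * g l u ∂μ := by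
    have h1 : ∀ u, W u ^ 2 = ∑ k, ∑ l, g k u * g l u := fun u => by
      rw [sq, hW, Finset.sum_mul_sum]
    simp only [hV, h1]
    rw [integral_finsetSum _ fun k _ => integrable_finsetSum _ fun l _ => hggi k l]
    refine Finset.sum_congr rfl fun k _ => ?_
    rw [integral_finsetSum _ fun l _ => hggi k l]
    refine (Finset.sum_subset (Finset.subset_univ _) fun l _ hl => ?_).symm
    rw [integral_mul_of_dependsOn hμ (hg k) (hg l) (hS k) (hS l)
      (by simpa [neighbours] using hl), hmean, zero_mul]
  -- The approximate differential equation `φ' = -s V φ`, which characterizes the normal law of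
  -- variance `V`.
  have hbound : ∀ s ∈ Set.Ico (0 : ℝ) 1, ‖φ' s + s * V * φ s‖ ≤ C := by
    intro s ⟨hs0, hs1⟩
    set A : κ → ℂ := fun k => ∫ u, (g k u : ℂ)
      * Complex.exp (Complex.I * ((s * W u : ℝ) : ℂ)) ∂μ with hA
    set Q : κ → κ → ℂ := fun k l => ∫ u, ((g k u * g l u : ℝ) : ℂ)
      * Complex.exp (Complex.I * ((s * W u : ℝ) : ℂ)) ∂μ with hQ
    have heq : φ' s + s * V * φ s = ∑ k, (Complex.I
          * (A k - Complex.I * s * ∑ l ∈ neighbours S k, Q k l)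
        - s * ∑ l ∈ neighbours S k, (Q k l - ((∫ u, g k u * g l u ∂μ : ℝ) : ℂ) * φ s)) := by
      have hII : ∀ k, Complex.I * (A k - Complex.I * s * ∑ l ∈ neighbours S k, Q k l)
          - s * ∑ l ∈ neighbours S k, (Q k l - ((∫ u, g k u * g l u ∂μ : ℝ) : ℂ) * φ s)
          = Complex.I * A k
            + s * (∑ l ∈ neighbours S k, ((∫ u, g k u * g l u ∂μ : ℝ) : ℂ)) * φ s := by
        intro k
        rw [Finset.sum_sub_distrib, ← Finset.sum_mul]
        linear_combination (-(s : ℂ) * ∑ l ∈ neighbours S k, Q k l) * Complex.I_mul_I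
      simp only [hII]
      rw [show φ' s = Complex.I * ∑ k, A k from hφ'_eq s, Finset.sum_add_distrib, ← Finset.mul_sum, ← Finset.sum_mul, ← Finset.mul_sum,
        hV_eq]
      push_cast
      rfl
    rw [heq]
    -- 7 is 3 from the Taylor remainder plus 4 from the decoupling of the pairs, using `s ≤ 1`.
    have hterm : ∀ k, ‖Complex.I * (A k - Complex.I * s * ∑ l ∈ neighbours S k, Q k l)
        - s * ∑ l ∈ neighbours S k, (Q k l - ((∫ u, g k u * g l u ∂μ : ℝ) : ℂ) * φ s)‖
        ≤ 7 * (D ^ 2 * B ^ 3) := by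
      intro k
      have hD0 : 0 ≤ D := (Nat.cast_nonneg _).trans (hD k)
      have h1 := norm_integral_mul_exp_sub_le hμ hg hS hB0 hB hD k (hmean k) s
      have h2 : ‖∑ l ∈ neighbours S k, (Q k l - ((∫ u, g k u * g l u ∂μ : ℝ) : ℂ) * φ s)‖
          ≤ D * (4 * s * D * B ^ 3) := by
        refine (norm_sum_le_of_le _ fun l _ =>
          norm_integral_mul_mul_exp_sub_le hμ hg hS hB0 hB hD k l hs0).trans ?_
        rw [Finset.sum_const, nsmul_eq_mul]
        exact mul_le_mul_of_nonneg_right (hD k) (by positivity)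
      refine (norm_sub_le _ _).trans ?_
      rw [norm_mul, norm_mul, Complex.norm_I, one_mul, Complex.norm_real, Real.norm_eq_abs,
        abs_of_nonneg hs0]
      have h3 : s * ‖∑ l ∈ neighbours S k, (Q k l - ((∫ u, g k u * g l u ∂μ : ℝ) : ℂ) * φ s)‖
          ≤ s * (D * (4 * s * D * B ^ 3)) := mul_le_mul_of_nonneg_left h2 hs0
      have h4 : s ^ 2 ≤ 1 := pow_le_one₀ hs0 hs1.le
      have h5 : 0 ≤ D ^ 2 * B ^ 3 := by positivity
      calc _ ≤ 3 * s ^ 2 * D ^ 2 * B ^ 3 + s * (D * (4 * s * D * B ^ 3)) := add_le_add h1 h3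
        _ = 7 * (s ^ 2 * (D ^ 2 * B ^ 3)) := by ring
        _ ≤ 7 * (1 * (D ^ 2 * B ^ 3)) := by gcongr
        _ = _ := by ring
    refine (norm_sum_le_of_le _ fun k _ => hterm k).trans (le_of_eq ?_)
    rw [Finset.sum_const, nsmul_eq_mul, Finset.card_univ, hC]
    ring
  have hgauss : ∀ s : ℝ, HasDerivAt (fun s : ℝ => ((Real.exp (s ^ 2 * V / 2) : ℝ) : ℂ))
      ((Real.exp (s ^ 2 * V / 2) * (s * V) : ℝ) : ℂ) s := by
    intro s
    have h1 : HasDerivAt (fun s : ℝ => s ^ 2 * V / 2) (s * V) s := by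
      have := (((hasDerivAt_id s).pow 2).mul_const V).div_const 2
      convert! this using 1
      simp
      ring
    exact h1.exp.ofReal_comp
  -- The integrating factor `exp(s² V / 2)` makes the derivative small on `[0, 1]`.
  have hmain := norm_image_sub_le_of_norm_deriv_le_segment_01'
    (f := fun s => φ s * ((Real.exp (s ^ 2 * V / 2) : ℝ) : ℂ)) (C := C * Real.exp (V / 2))
    (fun s _ => ((hderiv s).mul (hgauss s)).hasDerivWithinAt) (fun s hs => by
      have h1 : φ' s * ((Real.exp (s ^ 2 * V / 2) : ℝ) : ℂ)
            + φ s * ((Real.exp (s ^ 2 * V / 2) * (s * V) : ℝ) : ℂ)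
          = (φ' s + s * V * φ s) * ((Real.exp (s ^ 2 * V / 2) : ℝ) : ℂ) := by
        push_cast; ring
      rw [h1, norm_mul, Complex.norm_real, Real.norm_eq_abs, abs_of_pos (Real.exp_pos _)]
      refine mul_le_mul (hbound s hs) (Real.exp_le_exp.2 ?_) (Real.exp_pos _).le
        ((norm_nonneg _).trans (hbound s hs))
      have h4 : s ^ 2 ≤ 1 := pow_le_one₀ hs.1 hs.2.le
      nlinarith)
  have h0 : φ 0 = 1 := by simp [hφ]
  simp only [h0, one_pow, one_mul, ne_eq, OfNat.ofNat_ne_zero, not_false_eq_true, zero_pow,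
    zero_mul, zero_div, Real.exp_zero, Complex.ofReal_one, mul_one] at hmain
  have h1 : φ 1 = ∫ u, Complex.exp (Complex.I * ((W u : ℝ) : ℂ)) ∂μ := by simp [hφ]
  rw [← h1]
  -- Multiplying back by `exp(-V/2)` removes `exp(V/2)`, so the final bound contains no factor
  -- depending on `V`.
  have h2 : φ 1 - Complex.exp ((-V / 2 : ℝ) : ℂ)
      = (φ 1 * ((Real.exp (V / 2) : ℝ) : ℂ) - 1) * ((Real.exp (-V / 2) : ℝ) : ℂ) := by
    have h3 : ((Real.exp (V / 2) : ℝ) : ℂ) * ((Real.exp (-V / 2) : ℝ) : ℂ) = 1 := by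
      rw [← Complex.ofReal_mul, ← Real.exp_add]
      simp [neg_div]
    rw [sub_mul, mul_assoc, h3, mul_one, one_mul, Complex.ofReal_exp]
  rw [h2, norm_mul, Complex.norm_real, Real.norm_eq_abs, abs_of_pos (Real.exp_pos _)]
  calc _ ≤ C * Real.exp (V / 2) * Real.exp (-V / 2) :=
        mul_le_mul_of_nonneg_right hmain (Real.exp_pos _).le
    _ = C := by
        rw [mul_assoc, ← Real.exp_add]
        simp [neg_div]

end LocalDependence

/-! ### Moments and fluctuations of the circuit at random parameters -/

lemma gradient_apply {L m : ℕ} {f : Params L m → ℝ} {Θ : Params L m} (hf : DifferentiableAt ℝ f Θ)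
    {i : Fin L × Fin m} {d : ℝ}
    (hd : HasDerivAt (fun s => f (Θ + EuclideanSpace.single i s)) d 0) : gradient f Θ i = d := by
  have h1 : HasDerivAt (fun s : ℝ => Θ + EuclideanSpace.single i s)
      (EuclideanSpace.single i (1 : ℝ)) 0 := by
    have h := ((hasDerivAt_id (0 : ℝ)).smul_const (EuclideanSpace.single i (1 : ℝ))).const_add Θ
    simp only [id, one_smul] at h
    convert! h using 1
    funext s
    congr 1
    ext j
    by_cases hj : j = i <;> simp [hj]
  have h2 : HasFDerivAt f (fderiv ℝ f Θ) (Θ + EuclideanSpace.single i (0 : ℝ)) := by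
    have : Θ + EuclideanSpace.single i (0 : ℝ) = Θ := by
      ext j
      by_cases hj : j = i <;> simp [hj]
    rw [this]
    exact hf.hasFDerivAt
  have h3 := (h2.comp_hasDerivAt (0 : ℝ) h1).unique hd
  rw [← h3, gradient, ← InnerProductSpace.toDual_symm_apply (𝕜 := ℝ) (y := fderiv ℝ f Θ),
    EuclideanSpace.inner_single_right]
  simp

namespace Circuit

variable {𝒳 : Type*} {m L : ℕ} (C : Circuit 𝒳 m L)

lemma card_futureCone_le (i : Fin L × Fin m) : (C.futureCone i).card ≤ C.maxFuture :=
  Finset.le_sup (f := fun i => (C.futureCone i).card) (Finset.mem_univ i)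

lemma card_pastCone_le (k : Fin m) : (C.pastCone k).card ≤ C.maxPast :=
  Finset.le_sup (f := fun k => (C.pastCone k).card) (Finset.mem_univ k)

lemma mem_futureCone {i : Fin L × Fin m} {k : Fin m} : k ∈ C.futureCone i ↔ i ∈ C.pastCone k := by
  simp [futureCone]

/-- The past cones of `k` and `l` meet exactly when `l` lies in the future cone of some parameter in
the past cone of `k`. -/
lemma card_neighbours_pastCone_le (k : Fin m) :
    (neighbours C.pastCone k).card ≤ C.maxPast * C.maxFuture := by
  have h : neighbours C.pastCone k ⊆ (C.pastCone k).biUnion C.futureCone := by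
    intro l hl
    simp only [neighbours, Finset.mem_filter, Finset.mem_univ, true_and] at hl
    obtain ⟨i, hi, hi'⟩ := Finset.not_disjoint_iff.1 hl
    exact Finset.mem_biUnion.2 ⟨i, hi, C.mem_futureCone.2 hi'⟩
  refine (Finset.card_le_card h).trans ((Finset.card_biUnion_le_card_mul _ _ C.maxFuture
    fun i _ => C.card_futureCone_le i).trans ?_)
  exact Nat.mul_le_mul_right _ (C.card_pastCone_le k)

/-- Double counting of the pairs `(l, i)` with `i` in both past cones. -/
lemma sum_card_pastCone_inter_le (k : Fin m) :
    ∑ l, (C.pastCone k ∩ C.pastCone l).card ≤ C.maxPast * C.maxFuture := by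
  have h : ∑ l, (C.pastCone k ∩ C.pastCone l).card
      = ∑ i ∈ C.pastCone k, (C.futureCone i).card := by
    simp only [futureCone, Finset.card_filter, ← Finset.filter_mem_eq_inter]
    exact Finset.sum_comm
  rw [h]
  refine (Finset.sum_le_card_nsmul _ _ _ fun i _ => C.card_futureCone_le i).trans ?_
  rw [smul_eq_mul]
  exact Nat.mul_le_mul_right _ (C.card_pastCone_le k)

lemma measurable_localOutput_toLp (k : Fin m) (x : 𝒳) :
    Measurable fun u : Fin L × Fin m → ℝ => C.localOutput k (WithLp.toLp 2 u) x :=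
  ((C.differentiable_localOutput k x).continuous.comp (PiLp.continuous_toLp 2 _)).measurable

/-- The partial derivatives of the local outputs, given by the parameter-shift rule. -/
def localDeriv (k : Fin m) (i : Fin L × Fin m) (Θ : Params L m) (x : 𝒳) : ℝ :=
  C.localOutput k (Θ + EuclideanSpace.single i (Real.pi / 4)) x
    - C.localOutput k (Θ + EuclideanSpace.single i (-(Real.pi / 4))) x

lemma abs_localDeriv_le (k : Fin m) (i : Fin L × Fin m) (Θ : Params L m) (x : 𝒳) :
    |C.localDeriv k i Θ x| ≤ 2 := by
  refine (abs_sub _ _).trans ?_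
  linarith [C.abs_localOutput_le k (Θ + EuclideanSpace.single i (Real.pi / 4)) x,
    C.abs_localOutput_le k (Θ + EuclideanSpace.single i (-(Real.pi / 4))) x]

lemma localDeriv_of_notMem {k : Fin m} {i : Fin L × Fin m} (hi : i ∉ C.pastCone k)
    (Θ : Params L m) (x : 𝒳) : C.localDeriv k i Θ x = 0 := by
  rw [localDeriv, C.localOutput_add_single_of_notMem hi, C.localOutput_add_single_of_notMem hi,
    sub_self]

lemma continuous_localDeriv (k : Fin m) (i : Fin L × Fin m) (x : 𝒳) :
    Continuous fun Θ => C.localDeriv k i Θ x := by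
  have h := (C.differentiable_localOutput k x).continuous
  exact (h.comp (continuous_id.add continuous_const)).sub
    (h.comp (continuous_id.add continuous_const))

lemma localDeriv_congr (k : Fin m) (i : Fin L × Fin m) (x : 𝒳) {Θ Θ' : Params L m}
    (h : ∀ j ∈ C.pastCone k, Θ j = Θ' j) : C.localDeriv k i Θ x = C.localDeriv k i Θ' x := by
  have h' : ∀ s : ℝ, C.localOutput k (Θ + EuclideanSpace.single i s) x
      = C.localOutput k (Θ' + EuclideanSpace.single i s) x := fun s =>
    C.localOutput_congr k x fun j hj => by simp [h j hj]
  rw [localDeriv, localDeriv, h', h']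

lemma differentiable_model (N : ℝ) (x : 𝒳) : Differentiable ℝ fun Θ => C.model N Θ x :=
  (Differentiable.fun_sum fun k _ => C.differentiable_localOutput k x).const_mul _

lemma gradient_model_apply (N : ℝ) (Θ : Params L m) (x : 𝒳) (i : Fin L × Fin m) :
    gradient (fun θ => C.model N θ x) Θ i = (1 / N) * ∑ k, C.localDeriv k i Θ x :=
  gradient_apply (C.differentiable_model N x Θ)
    ((HasDerivAt.fun_sum fun k _ => C.hasDerivAt_localOutput_add_single k Θ x i).const_mul _)

lemma continuous_gradient_model (N : ℝ) (x : 𝒳) :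
    Continuous fun Θ => gradient (fun θ => C.model N θ x) Θ := by
  have h : Continuous fun (Θ : Params L m) (i : Fin L × Fin m) =>
      (1 / N) * ∑ k, C.localDeriv k i Θ x :=
    continuous_pi fun i =>
      (continuous_finsetSum _ fun k _ => C.continuous_localDeriv k i x).const_mul _
  refine ((PiLp.continuous_toLp 2 _).comp h).congr fun Θ => ?_
  ext i
  simp [gradient_model_apply]

lemma continuous_empiricalNTK (N NK : ℝ) (x x' : 𝒳) :
    Continuous fun Θ => empiricalNTK (C.model N) NK Θ x x' :=
  ((C.continuous_gradient_model N x).inner (C.continuous_gradient_model N x')).const_mul _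

/-- The contribution of a pair of observables to the empirical neural tangent kernel. -/
def pairNTK (x x' : 𝒳) (p : Fin m × Fin m) (Θ : Params L m) : ℝ :=
  ∑ i ∈ C.pastCone p.1 ∩ C.pastCone p.2, C.localDeriv p.1 i Θ x * C.localDeriv p.2 i Θ x'

/-- Writes the kernel as a sum of local functions of the parameters; restricting each inner sum to
the intersection of cones is harmless since the partial derivatives vanish elsewhere. -/
lemma empiricalNTK_eq_sum (N NK : ℝ) (Θ : Params L m) (x x' : 𝒳) :
    empiricalNTK (C.model N) NK Θ x x'
      = 1 / (NK * N ^ 2) * ∑ p, C.pairNTK x x' p Θ := by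
  have h : inner ℝ (gradient (fun θ => C.model N θ x) Θ) (gradient (fun θ => C.model N θ x') Θ)
      = (1 / N ^ 2) * ∑ p, C.pairNTK x x' p Θ := by
    have h1 : ∀ p : Fin m × Fin m, C.pairNTK x x' p Θ
        = ∑ i, C.localDeriv p.1 i Θ x * C.localDeriv p.2 i Θ x' := fun p =>
      Finset.sum_subset (Finset.subset_univ _) fun i _ hi => by
        rw [Finset.mem_inter, not_and_or] at hi
        rcases hi with hi | hi
        · rw [C.localDeriv_of_notMem hi, zero_mul]
        · rw [C.localDeriv_of_notMem hi, mul_zero]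
    rw [PiLp.inner_apply]
    simp only [gradient_model_apply, h1]
    rw [Finset.sum_comm, Finset.mul_sum]
    refine Finset.sum_congr rfl fun i _ => ?_
    simp only [Fintype.sum_prod_type, ← Finset.sum_mul_sum, RCLike.inner_apply, conj_trivial]
    ring
  rw [empiricalNTK, h]
  ring

lemma abs_pairNTK_le (x x' : 𝒳) (p : Fin m × Fin m) (Θ : Params L m) :
    |C.pairNTK x x' p Θ| ≤ 4 * ((C.pastCone p.1 ∩ C.pastCone p.2).card : ℝ) := by
  refine (Finset.abs_sum_le_sum_abs _ _).trans ?_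
  rw [mul_comm, ← nsmul_eq_mul]
  refine Finset.sum_le_card_nsmul _ _ _ fun i _ => ?_
  rw [abs_mul]
  nlinarith [C.abs_localDeriv_le p.1 i Θ x, C.abs_localDeriv_le p.2 i Θ x',
    abs_nonneg (C.localDeriv p.1 i Θ x), abs_nonneg (C.localDeriv p.2 i Θ x')]

lemma pairNTK_congr (x x' : 𝒳) (p : Fin m × Fin m) {Θ Θ' : Params L m}
    (h : ∀ j ∈ C.pastCone p.1 ∪ C.pastCone p.2, Θ j = Θ' j) :
    C.pairNTK x x' p Θ = C.pairNTK x x' p Θ' := by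
  rw [pairNTK, pairNTK]
  refine Finset.sum_congr rfl fun i _ => ?_
  have h1 : C.localDeriv p.1 i Θ x = C.localDeriv p.1 i Θ' x :=
    C.localDeriv_congr p.1 i x fun j hj => h j (by simp [hj])
  have h2 : C.localDeriv p.2 i Θ x' = C.localDeriv p.2 i Θ' x' :=
    C.localDeriv_congr p.2 i x' fun j hj => h j (by simp [hj])
  rw [h1, h2]

/-- If a pair reads `j`, one of its members lies in the future cone of `j`. The factor 2 is the
choice of the member; the other one is summed freely. -/
lemma sum_card_pastCone_inter_of_mem_le (j : Fin L × Fin m) :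
    ∑ p : Fin m × Fin m with j ∈ C.pastCone p.1 ∪ C.pastCone p.2,
        ((C.pastCone p.1 ∩ C.pastCone p.2).card : ℝ)
      ≤ 2 * ((C.futureCone j).card * (C.maxPast * C.maxFuture)) := by
  have h1 : ∑ k ∈ C.futureCone j, ∑ l, ((C.pastCone k ∩ C.pastCone l).card : ℝ)
      ≤ (C.futureCone j).card * (C.maxPast * C.maxFuture) := by
    rw [← nsmul_eq_mul]
    refine Finset.sum_le_card_nsmul _ _ _ fun k _ => ?_
    exact_mod_cast C.sum_card_pastCone_inter_le k
  have h2 : ∑ p : Fin m × Fin m with j ∈ C.pastCone p.1 ∪ C.pastCone p.2,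
        ((C.pastCone p.1 ∩ C.pastCone p.2).card : ℝ)
      ≤ ∑ k ∈ C.futureCone j, ∑ l, ((C.pastCone k ∩ C.pastCone l).card : ℝ)
        + ∑ l ∈ C.futureCone j, ∑ k, ((C.pastCone k ∩ C.pastCone l).card : ℝ) := by
    rw [Finset.sum_filter, Fintype.sum_prod_type, futureCone, Finset.sum_filter, Finset.sum_filter]
    have h3 : ∑ l, (if j ∈ C.pastCone l then
          ∑ k, ((C.pastCone k ∩ C.pastCone l).card : ℝ) else 0)
        = ∑ k, ∑ l, (if j ∈ C.pastCone l then
            ((C.pastCone k ∩ C.pastCone l).card : ℝ) else 0) := by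
      rw [Finset.sum_comm]
      refine Finset.sum_congr rfl fun l _ => ?_
      split_ifs <;> simp
    have h4 : ∑ k, (if j ∈ C.pastCone k then
          ∑ l, ((C.pastCone k ∩ C.pastCone l).card : ℝ) else 0)
        = ∑ k, ∑ l, (if j ∈ C.pastCone k then
            ((C.pastCone k ∩ C.pastCone l).card : ℝ) else 0) := by
      refine Finset.sum_congr rfl fun l _ => ?_
      split_ifs <;> simp
    rw [h3, h4, ← Finset.sum_add_distrib]
    refine Finset.sum_le_sum fun k _ => ?_
    rw [← Finset.sum_add_distrib]
    refine Finset.sum_le_sum fun l _ => ?_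
    by_cases hk : j ∈ C.pastCone k <;> by_cases hl : j ∈ C.pastCone l <;> simp [hk, hl]
  have h5 : ∑ l ∈ C.futureCone j, ∑ k, ((C.pastCone k ∩ C.pastCone l).card : ℝ)
      = ∑ k ∈ C.futureCone j, ∑ l, ((C.pastCone k ∩ C.pastCone l).card : ℝ) :=
    Finset.sum_congr rfl fun l _ => Finset.sum_congr rfl fun k _ => by rw [Finset.inter_comm]
  rw [h5] at h2
  linarith

/-- The general variance bound for the pair decomposition. With `c = 1 / (NK N²)`, a coordinate `j`
collects at most `8 c |ℳ_j| |𝒩| |ℳ|`, and `256 = 4 · 8²`. -/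
lemma integral_sq_empiricalNTK_sub_le {μ : Measure (Fin L × Fin m → ℝ)} [IsProbabilityMeasure μ]
    (hμ : iIndepFun (fun i (u : Fin L × Fin m → ℝ) => u i) μ) {N NK : ℝ} (hN : 0 < N)
    (hNK : 0 < NK) (x x' : 𝒳) :
    ∫ u, (empiricalNTK (C.model N) NK (WithLp.toLp 2 u) x x'
        - ∫ v, empiricalNTK (C.model N) NK (WithLp.toLp 2 v) x x' ∂μ) ^ 2 ∂μ
      ≤ 256 * (1 / NK ^ 2 * ((C.sumFuture 2 : ℝ) * (C.maxFuture : ℝ) ^ 2 * (C.maxPast : ℝ) ^ 2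
          / N ^ 4)) := by
  obtain ⟨c, hc⟩ : ∃ c : ℝ, c = 1 / (NK * N ^ 2) := ⟨_, rfl⟩
  have hc0 : 0 ≤ c := by rw [hc]; positivity
  have hm : ∀ p, Measurable fun u : Fin L × Fin m → ℝ =>
      c * C.pairNTK x x' p (WithLp.toLp 2 u) := fun p => by
    refine Continuous.measurable (Continuous.comp (g := fun Θ => c * C.pairNTK x x' p Θ)
      ((continuous_finsetSum _ fun i _ => ?_).const_mul _) (PiLp.continuous_toLp 2 _))
    exact (C.continuous_localDeriv _ _ _).mul (C.continuous_localDeriv _ _ _)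
  have hdep : ∀ p : Fin m × Fin m, DependsOn (fun u : Fin L × Fin m → ℝ =>
      c * C.pairNTK x x' p (WithLp.toLp 2 u))
      ((C.pastCone p.1 ∪ C.pastCone p.2 : Finset (Fin L × Fin m)) : Set (Fin L × Fin m)) := by
    intro p u v h
    exact congrArg (fun z => c * z) (C.pairNTK_congr x x' p fun i hi => h i hi)
  have h := integral_sq_sub_integral_le hμ hm hdep
    (b := fun p => c * (4 * ((C.pastCone p.1 ∩ C.pastCone p.2).card : ℝ))) fun p u => by
      rw [abs_mul, abs_of_nonneg hc0]
      exact mul_le_mul_of_nonneg_left (C.abs_pairNTK_le x x' p _) hc0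
  simp only [empiricalNTK_eq_sum, ← hc, Finset.mul_sum]
  refine h.trans ?_
  have hj : ∀ j, (∑ p : Fin m × Fin m with j ∈ C.pastCone p.1 ∪ C.pastCone p.2,
      c * (4 * ((C.pastCone p.1 ∩ C.pastCone p.2).card : ℝ))) ^ 2
      ≤ 64 * c ^ 2 * (C.maxPast * C.maxFuture : ℝ) ^ 2 * (C.futureCone j).card ^ 2 := by
    intro j
    rw [← Finset.mul_sum, ← Finset.mul_sum]
    calc _ ≤ (c * (4 * (2 * ((C.futureCone j).card * (C.maxPast * C.maxFuture : ℝ))))) ^ 2 := by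
          refine pow_le_pow_left₀ (mul_nonneg hc0 (mul_nonneg (by norm_num)
            (Finset.sum_nonneg fun _ _ => Nat.cast_nonneg _))) ?_ 2
          exact mul_le_mul_of_nonneg_left (mul_le_mul_of_nonneg_left
            (C.sum_card_pastCone_inter_of_mem_le j) (by norm_num)) hc0
      _ = _ := by ring
  calc _ ≤ 4 * ∑ j, 64 * c ^ 2 * (C.maxPast * C.maxFuture : ℝ) ^ 2 * (C.futureCone j).card ^ 2 :=
        mul_le_mul_of_nonneg_left (Finset.sum_le_sum fun j _ => hj j) (by norm_num)
    _ = _ := by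
        rw [← Finset.mul_sum, sumFuture, hc]
        push_cast
        field_simp
        ring

/-- A linear statistic of the model is a sum over observables of centred local functions bounded by
`(∑ |a x|) / N`, each sharing parameters with at most `|𝒩| |ℳ|` of them. -/
lemma norm_integral_exp_model_sub_le [Fintype 𝒳] {μ : Measure (Fin L × Fin m → ℝ)}
    [IsProbabilityMeasure μ]
    (hμ : iIndepFun (fun i (u : Fin L × Fin m → ℝ) => u i) μ) {N : ℝ} (hN : 0 < N)
    (hmean : ∀ k x, ∫ u, C.localOutput k (WithLp.toLp 2 u) x ∂μ = 0) (a : 𝒳 → ℝ) :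
    ‖∫ u, Complex.exp (Complex.I * ((∑ x, a x * C.model N (WithLp.toLp 2 u) x : ℝ) : ℂ)) ∂μ
      - Complex.exp
        ((-(∫ u, (∑ x, a x * C.model N (WithLp.toLp 2 u) x) ^ 2 ∂μ) / 2 : ℝ) : ℂ)‖
      ≤ 7 * (∑ x, |a x|) ^ 3 * ((m : ℝ) * (C.maxFuture : ℝ) ^ 2 * (C.maxPast : ℝ) ^ 2 / N ^ 3) := by
  set g : Fin m → (Fin L × Fin m → ℝ) → ℝ := fun k u =>
    ∑ x, a x / N * C.localOutput k (WithLp.toLp 2 u) x with hg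
  have hsum : ∀ u, ∑ x, a x * C.model N (WithLp.toLp 2 u) x = ∑ k, g k u := by
    intro u
    simp only [hg, model, Finset.mul_sum]
    rw [Finset.sum_comm]
    refine Finset.sum_congr rfl fun k _ => Finset.sum_congr rfl fun x _ => ?_
    ring
  have hA : 0 ≤ ∑ x, |a x| := Finset.sum_nonneg fun x _ => abs_nonneg _
  have h := norm_integral_exp_sum_sub_exp_le hμ (g := g) (S := C.pastCone)
    (B := (∑ x, |a x|) / N) (D := C.maxPast * C.maxFuture)
    (fun k => Finset.measurable_fun_sum _ fun x _ =>
      (C.measurable_localOutput_toLp k x).const_mul _)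
    (fun k u v h => by
      simp only [hg]
      exact Finset.sum_congr rfl fun x _ => by
        rw [C.localOutput_congr k x fun i hi => h i hi])
    (by positivity)
    (fun k u => by
      rw [Finset.sum_div]
      refine (Finset.abs_sum_le_sum_abs _ _).trans (Finset.sum_le_sum fun x _ => ?_)
      rw [abs_mul, abs_div, abs_of_pos hN]
      exact mul_le_of_le_one_right (by positivity) (C.abs_localOutput_le k _ x))
    (fun k => by exact_mod_cast C.card_neighbours_pastCone_le k)
    (fun k => by
      simp only [hg]
      rw [integral_finsetSum _ fun x _ => Integrable.const_mul (integrable_of_norm_le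
        (C.measurable_localOutput_toLp k x).aestronglyMeasurable
        fun u => C.abs_localOutput_le k _ x) _]
      simp [integral_const_mul, hmean])
  simp only [hsum]
  refine h.trans (le_of_eq ?_)
  rw [Fintype.card_fin]
  field_simp

end Circuit

/-! ### The training dynamics as a linear differential equation -/

/-- `exp(-s A) y(s)` has zero derivative, hence is constant. -/
lemma eq_exp_smul_apply_of_hasDerivWithinAt {E : Type*} [NormedAddCommGroup E] [NormedSpace ℝ E]
    [CompleteSpace E] {A : E →L[ℝ] E} {y : ℝ → E}
    (h : ∀ t, 0 ≤ t → HasDerivWithinAt y (A (y t)) (Set.Ici 0) t) {t : ℝ} (ht : 0 ≤ t) :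
    y t = NormedSpace.exp (t • A) (y 0) := by
  have hz : ∀ s, 0 ≤ s →
      HasDerivWithinAt (fun s => NormedSpace.exp (s • (-A)) (y s)) 0 (Set.Ici 0) s := by
    intro s hs
    have h1 := (hasDerivAt_exp_smul_const (𝕂 := ℝ) (-A) s).hasDerivWithinAt (s := Set.Ici 0)
    have h2 := h1.clm_apply (h s hs)
    convert! h2 using 1
    simp
  have hconst := constant_of_has_deriv_right_zero (a := 0) (b := t)
    (f := fun s => NormedSpace.exp (s • (-A)) (y s))
    (fun s hs => (hz s hs.1).continuousWithinAt.mono Set.Icc_subset_Ici_self)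
    (fun s hs => (hz s hs.1).mono (Set.Ici_subset_Ici.2 hs.1)) t ⟨ht, le_rfl⟩
  simp only [zero_smul, NormedSpace.exp_zero, one_apply_eq_self] at hconst
  let _ : NormedAlgebra ℚ (E →L[ℝ] E) := NormedAlgebra.restrictScalars ℚ ℝ _
  rw [← hconst, ← mul_apply_eq_comp, ← NormedSpace.exp_add_of_commute]
  · simp
  · exact ((Commute.refl A).neg_right.smul_right t).smul_left t

section Flow

variable {𝒳 : Type*} {L m n : ℕ}

lemma hasFDerivAt_linModel (f : Params L m → 𝒳 → ℝ) (Θ₀ Θ : Params L m) (x : 𝒳) :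
    HasFDerivAt (fun Θ => linModel f Θ₀ Θ x)
      (innerSL ℝ (gradient (fun θ => f θ x) Θ₀)) Θ :=
  ((innerSL ℝ (gradient (fun θ => f θ x) Θ₀)).hasFDerivAt.comp Θ
    ((hasFDerivAt_id Θ).sub_const Θ₀)).const_add _

lemma gradient_mse_linModel (X : Fin n → 𝒳) (Y : Fin n → ℝ) (f : Params L m → 𝒳 → ℝ)
    (Θ₀ Θ : Params L m) :
    gradient (fun Θ => mse X Y (linModel f Θ₀ Θ)) Θ
      = (1 / (n : ℝ)) • ∑ i, (linModel f Θ₀ Θ (X i) - Y i) • gradient (fun θ => f θ (X i)) Θ₀ := by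
  refine HasGradientAt.gradient (hasGradientAt_iff_hasFDerivAt.2 ?_)
  have h : ∀ i, HasFDerivAt (fun Θ => 1 / 2 * (linModel f Θ₀ Θ (X i) - Y i) ^ 2) _ Θ := fun i =>
    (((hasFDerivAt_linModel f Θ₀ Θ (X i)).sub_const (Y i)).pow 2).const_mul (1 / 2)
  have h' := (HasFDerivAt.fun_sum fun i (_ : i ∈ Finset.univ) => h i).const_mul (1 / (n : ℝ))
  refine h'.congr_fderiv ?_
  ext v
  simp only [one_div, nsmul_eq_mul, Nat.add_one_sub_one, pow_one, Nat.cast_ofNat,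
    FunLike.coe_smul, FunLike.coe_sum, Pi.smul_apply, Finset.sum_apply, smul_eq_mul,
    map_smul, map_sum, innerSL_apply_apply, InnerProductSpace.toDual_apply_apply]
  congr 1
  exact Finset.sum_congr rfl fun i _ => by ring

variable [Fintype 𝒳]

/-- The map `(g, v) ↦ (K(·, X) v, K(X, Xᵀ) v)`, as a bilinear map in the kernel `K` and `(g, v)`. -/
def flowBilin (X : Fin n → 𝒳) :
    (𝒳 → 𝒳 → ℝ) →ₗ[ℝ] ((𝒳 → ℝ) × (Fin n → ℝ)) →ₗ[ℝ] ((𝒳 → ℝ) × (Fin n → ℝ)) :=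
  LinearMap.mk₂ ℝ
    (fun K y => (fun x => ∑ j, K x (X j) * y.2 j, fun i => ∑ j, K (X i) (X j) * y.2 j))
    (fun K K' y => by
      ext <;> simp [add_mul, Finset.sum_add_distrib])
    (fun c K y => by
      ext <;> simp [Finset.mul_sum, mul_assoc])
    (fun K y y' => by
      ext <;> simp [mul_add, Finset.sum_add_distrib])
    (fun c K y => by
      ext <;> simp [Finset.mul_sum, mul_left_comm])

/-- The generator of the evolution of the linearized model and of its training errors. -/
def flowOp (X : Fin n → 𝒳) (K : 𝒳 → 𝒳 → ℝ) :
    ((𝒳 → ℝ) × (Fin n → ℝ)) →L[ℝ] ((𝒳 → ℝ) × (Fin n → ℝ)) :=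
  LinearMap.toContinuousLinearMap (flowBilin X K)

lemma flowOp_apply (X : Fin n → 𝒳) (K : 𝒳 → 𝒳 → ℝ) (y : (𝒳 → ℝ) × (Fin n → ℝ)) :
    flowOp X K y = (fun x => ∑ j, K x (X j) * y.2 j, fun i => ∑ j, K (X i) (X j) * y.2 j) := rfl

lemma continuous_flowOp (X : Fin n → 𝒳) : Continuous (flowOp X) :=
  (LinearMap.toContinuousLinearMap.toLinearMap ∘ₗ flowBilin X).continuous_of_finiteDimensional

/-- The evolution for the time `t` of the linearized model and of its training errors. -/
def evolution (X : Fin n → 𝒳) (η₀ t : ℝ) (K : 𝒳 → 𝒳 → ℝ) :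
    ((𝒳 → ℝ) × (Fin n → ℝ)) →L[ℝ] ((𝒳 → ℝ) × (Fin n → ℝ)) :=
  NormedSpace.exp (t • (-η₀) • flowOp X K)

lemma continuous_evolution (X : Fin n → 𝒳) (η₀ t : ℝ) : Continuous (evolution X η₀ t) := by
  let _ : NormedAlgebra ℚ (((𝒳 → ℝ) × (Fin n → ℝ)) →L[ℝ] ((𝒳 → ℝ) × (Fin n → ℝ))) :=
    NormedAlgebra.restrictScalars ℚ ℝ _
  have h : Continuous fun K => t • (-η₀) • flowOp X K := by
    have := continuous_flowOp X
    fun_prop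
  exact NormedSpace.exp_continuous.comp h

/-- The linearized model along its gradient flow. -/
lemma linModel_gradientFlow {X : Fin n → 𝒳} {Y : Fin n → ℝ} {f : Params L m → 𝒳 → ℝ}
    {Θ₀ : Params L m} {NK η₀ : ℝ} {γ : ℝ → Params L m}
    (hγ : IsGradientFlow ((n : ℝ) / NK * η₀) (fun Θ => mse X Y (linModel f Θ₀ Θ)) Θ₀ γ)
    {t : ℝ} (ht : 0 ≤ t) :
    linModel f Θ₀ (γ t)
      = (evolution X η₀ t (empiricalNTK f NK Θ₀) (f Θ₀, fun i => f Θ₀ (X i) - Y i)).1 := by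
  set A := (-η₀) • flowOp X (empiricalNTK f NK Θ₀) with hA
  set y : ℝ → (𝒳 → ℝ) × (Fin n → ℝ) := fun s =>
    (linModel f Θ₀ (γ s), fun i => linModel f Θ₀ (γ s) (X i) - Y i) with hy
  -- The `n` in the learning rate cancels the `1/n` of the loss, and `1/NK` turns inner products of
  -- gradients into the empirical kernel.
  have hlin : ∀ s, 0 ≤ s → ∀ x, HasDerivWithinAt (fun s => linModel f Θ₀ (γ s) x)
      (-η₀ * ∑ j, empiricalNTK f NK Θ₀ x (X j) * (linModel f Θ₀ (γ s) (X j) - Y j))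
      (Set.Ici 0) s := by
    intro s hs x
    have h := (hasFDerivAt_linModel f Θ₀ (γ s) x).comp_hasDerivWithinAt s (hγ.flow s hs)
    convert! h using 1
    rw [gradient_mse_linModel]
    simp only [innerSL_apply_apply, inner_neg_right, inner_smul_right, inner_sum, empiricalNTK]
    -- With no training data the cancellation `n / n = 1` fails, but all sums are empty.
    rcases Nat.eq_zero_or_pos n with hn | hn
    · subst hn; simp
    · have hn' : (n : ℝ) ≠ 0 := by positivity
      simp only [Finset.mul_sum, ← Finset.sum_neg_distrib]
      refine Finset.sum_congr rfl fun j _ => ?_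
      field_simp
  have hderiv : ∀ s, 0 ≤ s → HasDerivWithinAt y (A (y s)) (Set.Ici 0) s := by
    intro s hs
    have h1 : HasDerivWithinAt (fun s => (y s).1) (A (y s)).1 (Set.Ici 0) s :=
      hasDerivWithinAt_pi.2 fun x => hlin s hs x
    have h2 : HasDerivWithinAt (fun s => (y s).2) (A (y s)).2 (Set.Ici 0) s :=
      hasDerivWithinAt_pi.2 fun i => (hlin s hs (X i)).sub_const (Y i)
    exact h1.prodMk h2
  have h := eq_exp_smul_apply_of_hasDerivWithinAt hderiv ht
  have h0 : y 0 = (f Θ₀, fun i => f Θ₀ (X i) - Y i) := by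
    simp only [hy, hγ.init]
    congr
    · funext x; simp [linModel]
    · funext i; simp [linModel]
  rw [h0] at h
  exact congrArg Prod.fst h

section MatrixExponential

open Matrix

open scoped Matrix.Norms.Operator in
lemma hasDerivAt_exp_smul_mulVec (G : Matrix (Fin n) (Fin n) ℝ) (c : ℝ) (v : Fin n → ℝ) (t : ℝ) :
    HasDerivAt (fun t : ℝ => NormedSpace.exp (-(c * t) • G) *ᵥ v)
      (-c • (G *ᵥ (NormedSpace.exp (-(c * t) • G) *ᵥ v))) t := by
  have h1 : HasDerivAt (fun u : ℝ => NormedSpace.exp (u • G))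
      (G * NormedSpace.exp ((-(c * t)) • G)) (-(c * t)) :=
    hasDerivAt_exp_smul_const' (𝕂 := ℝ) G (-(c * t))
  have h2 : HasDerivAt (fun t : ℝ => -(c * t)) (-c) t := by
    have h := ((hasDerivAt_id t).const_mul c).neg
    rw [mul_one] at h
    exact h
  have h3 := h1.scomp t h2
  have h4 := ((LinearMap.toContinuousLinearMap
    ((Matrix.mulVecBilin ℝ ℝ).flip v)).hasFDerivAt).comp_hasDerivAt t h3
  convert! h4 using 1
  rw [Matrix.mulVec_mulVec, ← Matrix.smul_mulVec]
  rfl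

/-- The right-hand side, paired with the residuals `exp(-η₀ K̄ s) v`, solves the differential
equation that defines `evolution`, with the same initial value. Positive definiteness is what makes
`G⁻¹ G = 1` available. -/
lemma evolution_apply_fst {X : Fin n → 𝒳} {K : 𝒳 → 𝒳 → ℝ} (hK : (gram K X).PosDef) (η₀ : ℝ)
    {t : ℝ} (ht : 0 ≤ t) (F : 𝒳 → ℝ) (v : Fin n → ℝ) (x : 𝒳) :
    (evolution X η₀ t K (F, v)).1 x
      = F x - (fun i => K x (X i)) ⬝ᵥ (propagator K X η₀ t *ᵥ v) := by
  set G := gram K X with hG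
  have hGG : G⁻¹ * G = 1 := Matrix.nonsing_inv_mul _ ((Matrix.isUnit_iff_isUnit_det _).1 hK.isUnit)
  set w : ℝ → Fin n → ℝ := fun s => NormedSpace.exp (-(η₀ * s) • G) *ᵥ v with hw
  set y : ℝ → (𝒳 → ℝ) × (Fin n → ℝ) := fun s =>
    (fun x => F x - (fun i => K x (X i)) ⬝ᵥ (propagator K X η₀ s *ᵥ v), w s) with hy
  have hw' : ∀ s, HasDerivAt w (-η₀ • (G *ᵥ w s)) s := hasDerivAt_exp_smul_mulVec G η₀ v
  have hp : ∀ s, propagator K X η₀ s *ᵥ v = G⁻¹ *ᵥ (v - w s) := by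
    intro s
    rw [propagator, ← hG, ← Matrix.mulVec_mulVec, Matrix.sub_mulVec, Matrix.one_mulVec]
  have hp' : ∀ s, HasDerivAt (fun s => propagator K X η₀ s *ᵥ v) (η₀ • w s) s := by
    intro s
    simp only [hp]
    have h := ((LinearMap.toContinuousLinearMap (Matrix.mulVecLin G⁻¹)).hasFDerivAt).comp_hasDerivAt
      s ((hw' s).const_sub v)
    convert! h using 1
    simp [Matrix.mulVec_mulVec, hGG]
  have hderiv : ∀ s, 0 ≤ s →
      HasDerivWithinAt y (((-η₀) • flowOp X K) (y s)) (Set.Ici 0) s := by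
    intro s _
    refine HasDerivAt.hasDerivWithinAt ?_
    have h1 : HasDerivAt (fun s => (y s).1) (((-η₀) • flowOp X K) (y s)).1 s := by
      refine hasDerivAt_pi.2 fun x => ?_
      have h := (HasDerivAt.fun_sum fun i (_ : i ∈ Finset.univ) =>
        (hasDerivAt_pi.1 (hp' s) i).const_mul (K x (X i))).const_sub (F x)
      convert! h using 1
      simp [flowOp_apply, hy, Finset.mul_sum, mul_left_comm]
    have h2 : HasDerivAt (fun s => (y s).2) (((-η₀) • flowOp X K) (y s)).2 s := hw' s
    exact h1.prodMk h2
  have h := eq_exp_smul_apply_of_hasDerivWithinAt hderiv ht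
  have h0 : y 0 = (F, v) := by
    simp only [hy, hp]
    simp [hw]
  rw [h0] at h
  exact (congrFun (congrArg Prod.fst h) x).symm

end MatrixExponential

end Flow

/-! ### Convergence in distribution -/

/-- Transports independence to the law of the parameters on the coordinate space, where the
estimates for local functions are formulated. -/
lemma iIndepFun_eval_map {Ω ι : Type*} [MeasurableSpace Ω] [Fintype ι] {P : Measure Ω}
    [IsProbabilityMeasure P] {θ : ι → Ω → ℝ} (hθ : ∀ i, Measurable (θ i)) (h : iIndepFun θ P) :
    iIndepFun (fun i (u : ι → ℝ) => u i) (P.map fun ω i => θ i ω) := by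
  have hm : Measurable fun ω i => θ i ω := measurable_pi_lambda _ hθ
  have : IsProbabilityMeasure (P.map fun ω i => θ i ω) :=
    Measure.isProbabilityMeasure_map hm.aemeasurable
  rw [iIndepFun_iff_map_fun_eq_pi_map fun i => (measurable_pi_apply i).aemeasurable]
  have h1 := (iIndepFun_iff_map_fun_eq_pi_map fun i => (hθ i).aemeasurable).1 h
  have h2 : ∀ i, (P.map fun ω i => θ i ω).map (fun u : ι → ℝ => u i) = P.map (θ i) := fun i => by
    rw [Measure.map_map (measurable_pi_apply i) hm]
    rfl
  simp only [h2, ← h1]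
  exact Measure.map_id

/-- If `A` and `B` differ by little unless some quantity with small mean is large, then their
characteristic functions at `1` have the same limit. -/
lemma tendsto_integral_exp_sub {Ω : ℕ → Type*} [∀ m, MeasurableSpace (Ω m)]
    {P : ∀ m, Measure (Ω m)} [∀ m, IsProbabilityMeasure (P m)] {A B q z : ∀ m, Ω m → ℝ}
    (hA : ∀ m, Measurable (A m)) (hB : ∀ m, Measurable (B m))
    (hq : ∀ m, Integrable (q m) (P m)) (hz : ∀ m, Integrable (z m) (P m))
    (hq0 : ∀ m ω, 0 ≤ q m ω) (hz0 : ∀ m ω, 0 ≤ z m ω)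
    (hAB : ∀ ε, 0 < ε → ∃ δ, 0 < δ ∧ ∀ m ω, |A m ω - B m ω| ≤ ε * z m ω ∨ δ ≤ q m ω)
    (hq_lim : Tendsto (fun m => ∫ ω, q m ω ∂P m) atTop (𝓝 0)) {ζ : ℝ}
    (hz_lim : Tendsto (fun m => ∫ ω, z m ω ∂P m) atTop (𝓝 ζ)) :
    Tendsto (fun m => ∫ ω, Complex.exp (Complex.I * (A m ω : ℂ)) ∂P m
      - ∫ ω, Complex.exp (Complex.I * (B m ω : ℂ)) ∂P m) atTop (𝓝 0) := by
  rw [Metric.tendsto_nhds]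
  intro ε hε
  have hζ : 0 ≤ ζ := ge_of_tendsto' hz_lim fun m => integral_nonneg (hz0 m)
  -- Since the mean of `z` is eventually below `ζ + 1`, this choice leaves at most `ε / 2` for the
  -- good event; the `+ 1` also keeps the denominator positive.
  obtain ⟨δ, hδ, h⟩ := hAB (ε / (2 * (ζ + 1))) (by positivity)
  have h1 : ∀ᶠ m in atTop, 2 / δ * ∫ ω, q m ω ∂P m < ε / 2 := by
    have := hq_lim.const_mul (2 / δ)
    rw [mul_zero] at this
    exact this.eventually_lt_const (by positivity)
  have h2 : ∀ᶠ m in atTop, ∫ ω, z m ω ∂P m < ζ + 1 := hz_lim.eventually_lt_const (by linarith)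
  filter_upwards [h1, h2] with m hm1 hm2
  rw [dist_zero_right]
  have hint : ∀ A : ∀ m, Ω m → ℝ, (∀ m, Measurable (A m)) →
      Integrable (fun ω => Complex.exp (Complex.I * (A m ω : ℂ))) (P m) := fun A hA =>
    integrable_of_norm_le (Measurable.aestronglyMeasurable (by have := hA m; fun_prop))
      fun ω => (norm_exp_I_mul _).le
  rw [← integral_sub (hint A hA) (hint B hB)]
  -- Markov's inequality in pointwise form: where `q ≥ δ`, the trivial bound 2 is at most `(2 / δ)
  -- q`.
  have hpt : ∀ ω, ‖Complex.exp (Complex.I * (A m ω : ℂ)) - Complex.exp (Complex.I * (B m ω : ℂ))‖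
      ≤ 2 / δ * q m ω + ε / (2 * (ζ + 1)) * z m ω := by
    intro ω
    rcases h m ω with h | h
    · have h3 : 0 ≤ 2 / δ * q m ω := mul_nonneg (by positivity) (hq0 m ω)
      linarith [norm_exp_I_mul_sub_exp_I_mul_le (A m ω) (B m ω)]
    · have h3 : 0 ≤ ε / (2 * (ζ + 1)) * z m ω := mul_nonneg (by positivity) (hz0 m ω)
      have h4 := norm_sub_le (Complex.exp (Complex.I * (A m ω : ℂ)))
        (Complex.exp (Complex.I * (B m ω : ℂ)))
      rw [norm_exp_I_mul, norm_exp_I_mul] at h4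
      have h5 : 2 ≤ 2 / δ * q m ω := by
        rw [div_mul_eq_mul_div, le_div_iff₀ hδ]
        linarith
      linarith
  have h3 := norm_integral_le_of_norm_le (((hq m).const_mul (2 / δ)).add
    ((hz m).const_mul (ε / (2 * (ζ + 1))))) (ae_of_all (P m) hpt)
  simp only [Pi.add_apply] at h3
  rw [integral_add ((hq m).const_mul _) ((hz m).const_mul _), integral_const_mul,
    integral_const_mul] at h3
  have h4 : ε / (2 * (ζ + 1)) * ∫ ω, z m ω ∂P m ≤ ε / 2 := by
    calc _ ≤ ε / (2 * (ζ + 1)) * (ζ + 1) :=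
          mul_le_mul_of_nonneg_left hm2.le (by positivity)
      _ = ε / 2 := by field_simp
  linarith

/-- Convergence of the characteristic functions to that of a Gaussian vector implies convergence
in distribution to a Gaussian process. -/
lemma exists_isGaussianProcess_tendstoInDistribution {𝒳 : Type*} [Fintype 𝒳]
    {Ω : ℕ → Type*} [∀ m, MeasurableSpace (Ω m)]
    {P : ∀ m, Measure (Ω m)} [∀ m, IsProbabilityMeasure (P m)] {Z : ∀ m, Ω m → 𝒳 → ℝ}
    (hZ : ∀ m, Measurable (Z m)) (M : 𝒳 → ℝ) {S : Matrix 𝒳 𝒳 ℝ} (hS : S.PosSemidef)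
    (h : ∀ a : 𝒳 → ℝ, Tendsto
      (fun m => ∫ ω, Complex.exp (Complex.I * ((∑ x, a x * Z m ω x : ℝ) : ℂ)) ∂P m) atTop
      (𝓝 (Complex.exp (Complex.I * ((∑ x, a x * M x : ℝ) : ℂ))
        * Complex.exp ((-(∑ x, ∑ y, a x * a y * S x y) / 2 : ℝ) : ℂ)))) :
    ∃ G : ProbabilityMeasure (𝒳 → ℝ),
      IsGaussianProcess (fun (x : 𝒳) (g : 𝒳 → ℝ) => g x) (G : Measure (𝒳 → ℝ)) ∧
      (∀ x, ∫ g, g x ∂(G : Measure (𝒳 → ℝ)) = M x) ∧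
      (∀ x x', cov[fun g => g x, fun g => g x'; (G : Measure (𝒳 → ℝ))] = S x x') ∧
      TendstoInDistribution Z atTop (fun g : 𝒳 → ℝ => g) P (G : Measure (𝒳 → ℝ)) := by
  classical
  set ν : Measure (EuclideanSpace ℝ 𝒳) := multivariateGaussian (WithLp.toLp 2 M) S with hν
  set e : EuclideanSpace ℝ 𝒳 →L[ℝ] (𝒳 → ℝ) :=
    (EuclideanSpace.equiv 𝒳 ℝ : EuclideanSpace ℝ 𝒳 →L[ℝ] (𝒳 → ℝ)) with he
  have hem : Measurable e := e.measurable
  have hprob : IsProbabilityMeasure (ν.map e) :=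
    Measure.isProbabilityMeasure_map hem.aemeasurable
  have hgauss : IsGaussian (ν.map e) := isGaussian_map e
  have htoLp : Measurable (WithLp.toLp 2 : (𝒳 → ℝ) → EuclideanSpace ℝ 𝒳) :=
    (PiLp.continuous_toLp 2 _).measurable
  have hZ' : ∀ m, Measurable fun ω => (WithLp.toLp 2 (Z m ω) : EuclideanSpace ℝ 𝒳) :=
    fun m => htoLp.comp (hZ m)
  have hdist : TendstoInDistribution (fun m ω => (WithLp.toLp 2 (Z m ω) : EuclideanSpace ℝ 𝒳))
      atTop (fun z : EuclideanSpace ℝ 𝒳 => z) P ν := by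
    refine ⟨fun m => (hZ' m).aemeasurable, aemeasurable_id', ?_⟩
    -- Lévy's continuity theorem, applied in Euclidean space; the result is carried back to `𝒳 → ℝ`
    -- along `e`.
    refine ProbabilityMeasure.tendsto_of_tendsto_charFun fun a => ?_
    simp only [ProbabilityMeasure.coe_mk]
    rw [Measure.map_id', hν, charFun_multivariateGaussian hS]
    have h1 : ∀ m, charFun ((P m).map fun ω => (WithLp.toLp 2 (Z m ω) : EuclideanSpace ℝ 𝒳)) a
        = ∫ ω, Complex.exp (Complex.I * ((∑ x, a x * Z m ω x : ℝ) : ℂ)) ∂P m := by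
      intro m
      rw [charFun_apply, integral_map (hZ' m).aemeasurable
        (Measurable.aestronglyMeasurable (by fun_prop))]
      refine integral_congr_ae (ae_of_all _ fun ω => ?_)
      simp only [PiLp.inner_apply, RCLike.inner_apply, conj_trivial]
      rw [mul_comm]
    simp only [h1]
    convert! h a using 2
    rw [← Complex.exp_add]
    congr 1
    simp only [PiLp.inner_apply, RCLike.inner_apply, conj_trivial, dotProduct, Matrix.mulVec]
    rw [show (∑ x, ∑ y, a x * a y * S x y) = ∑ x, a x * ∑ y, S x y * a y by
      refine Finset.sum_congr rfl fun x _ => ?_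
      rw [Finset.mul_sum]
      exact Finset.sum_congr rfl fun y _ => by ring,
      show ∑ x, M x * a x = ∑ x, a x * M x from Finset.sum_congr rfl fun x _ => mul_comm _ _]
    push_cast
    ring
  have hconv : TendstoInDistribution Z atTop (fun g : 𝒳 → ℝ => g) P (ν.map e) := by
    have h2 := hdist.continuous_comp e.continuous
    refine ⟨fun m => (hZ m).aemeasurable, aemeasurable_id', ?_⟩
    convert! h2.tendsto using 2
    simp only [Measure.map_id']
    rfl
  refine ⟨⟨ν.map e, hprob⟩, ?_, ?_, ?_, hconv⟩
  · refine ⟨fun I => ⟨?_⟩⟩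
    exact isGaussian_map (μ := ν.map e)
      (ContinuousLinearMap.pi fun i : I => ContinuousLinearMap.proj (R := ℝ) (i : 𝒳))
  · intro x
    simp only [ProbabilityMeasure.coe_mk]
    rw [integral_map hem.aemeasurable (measurable_pi_apply x).aestronglyMeasurable]
    have h1 := (EuclideanSpace.proj (𝕜 := ℝ) x).integral_comp_id_comm
      (IsGaussian.integrable_id (μ := ν))
    rw [hν, integral_id_multivariateGaussian] at h1
    exact h1
  · intro x x'
    simp only [ProbabilityMeasure.coe_mk]
    rw [covariance_map_fun (measurable_pi_apply x).aestronglyMeasurable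
      (measurable_pi_apply x').aestronglyMeasurable hem.aemeasurable]
    exact covariance_eval_multivariateGaussian hS x x'

/-! ### The limiting mean and covariance -/

section Limit

open Matrix

variable {𝒳 : Type*} {n : ℕ}

/-- The matrix `K̄(x, Xᵀ) K̄⁻¹ (1 - exp (-η₀ K̄ t))`, applied to the training errors at the
initialization. -/
def response (Kbar : 𝒳 → 𝒳 → ℝ) (X : Fin n → 𝒳) (η₀ t : ℝ) (x : 𝒳) : Fin n → ℝ :=
  (fun i => Kbar x (X i)) ᵥ* propagator Kbar X η₀ t

lemma limitMean_eq (Kbar : 𝒳 → 𝒳 → ℝ) (X : Fin n → 𝒳) (Y : Fin n → ℝ) (η₀ t : ℝ) (x : 𝒳) :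
    limitMean Kbar X Y η₀ t x = response Kbar X η₀ t x ⬝ᵥ Y := by
  rw [limitMean, response, Matrix.dotProduct_mulVec]

/-- By symmetry of `Kbar`, the matrix on the right of `𝒦₀(X, Xᵀ)` is the transpose of the
propagator, so the covariance is expressed through `response` alone. -/
lemma limitCov_eq {𝒦₀ Kbar : 𝒳 → 𝒳 → ℝ} (hsymm : ∀ x x', Kbar x x' = Kbar x' x)
    (X : Fin n → 𝒳) (η₀ t : ℝ) (x x' : 𝒳) :
    limitCov 𝒦₀ Kbar X η₀ t x x' = 𝒦₀ x x'
      - ∑ i, response Kbar X η₀ t x i * 𝒦₀ (X i) x'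
      - ∑ i, response Kbar X η₀ t x' i * 𝒦₀ (X i) x
      + ∑ i, ∑ j, response Kbar X η₀ t x i * response Kbar X η₀ t x' j * 𝒦₀ (X i) (X j) := by
  have hG : (gram Kbar X)ᵀ = gram Kbar X := by
    ext i j
    exact hsymm _ _
  have hP : (1 - NormedSpace.exp (-(η₀ * t) • gram Kbar X)) * (gram Kbar X)⁻¹
      = (propagator Kbar X η₀ t)ᵀ := by
    rw [propagator, Matrix.transpose_mul, Matrix.transpose_sub, Matrix.transpose_one,
      ← Matrix.exp_transpose, Matrix.transpose_smul, Matrix.transpose_nonsing_inv, hG]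
  have hK : (fun i => Kbar (X i) x') = fun i => Kbar x' (X i) := funext fun i => hsymm _ _
  rw [limitCov, hP, hK, Matrix.dotProduct_mulVec, Matrix.dotProduct_mulVec,
    ← Matrix.mulVec_mulVec, ← Matrix.mulVec_mulVec, Matrix.mulVec_transpose,
    Matrix.dotProduct_mulVec]
  congr 1
  change response Kbar X η₀ t x ⬝ᵥ (gram 𝒦₀ X *ᵥ response Kbar X η₀ t x') = _
  simp only [dotProduct, Matrix.mulVec, gram, Matrix.of_apply, Finset.mul_sum]
  exact Finset.sum_congr rfl fun i _ => Finset.sum_congr rfl fun j _ => by ring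

lemma limitCov_comm {𝒦₀ Kbar : 𝒳 → 𝒳 → ℝ} (hsymm : ∀ x x', Kbar x x' = Kbar x' x)
    (hsymm₀ : ∀ x x', 𝒦₀ x x' = 𝒦₀ x' x) (X : Fin n → 𝒳) (η₀ t : ℝ) (x x' : 𝒳) :
    limitCov 𝒦₀ Kbar X η₀ t x x' = limitCov 𝒦₀ Kbar X η₀ t x' x := by
  have h : ∀ u v : Fin n → ℝ, ∑ i, ∑ j, u i * v j * 𝒦₀ (X i) (X j)
      = ∑ i, ∑ j, v i * u j * 𝒦₀ (X i) (X j) := fun u v => by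
    rw [Finset.sum_comm]
    refine Finset.sum_congr rfl fun i _ => Finset.sum_congr rfl fun j _ => ?_
    rw [hsymm₀ (X j) (X i), mul_comm (u j)]
  rw [limitCov_eq hsymm, limitCov_eq hsymm, hsymm₀ x x', h]
  ring

variable [Fintype 𝒳]

/-- The adjoint of the evolution of the linearized model, acting on test vectors. -/
def adjointWeight (Kbar : 𝒳 → 𝒳 → ℝ) (X : Fin n → 𝒳) (η₀ t : ℝ) (a : 𝒳 → ℝ) (x : 𝒳) : ℝ :=
  open Classical in
  a x - ∑ j, if X j = x then ∑ y, a y * response Kbar X η₀ t y j else 0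

/-- Duality between `h ↦ h - response · h(X)` and its adjoint. The indicator in the weight sums over
all training indices with the same input, so repeated inputs are allowed. -/
lemma sum_adjointWeight_mul (Kbar : 𝒳 → 𝒳 → ℝ) (X : Fin n → 𝒳) (η₀ t : ℝ) (a h : 𝒳 → ℝ) :
    ∑ x, adjointWeight Kbar X η₀ t a x * h x
      = ∑ x, a x * (h x - ∑ j, response Kbar X η₀ t x j * h (X j)) := by
  classical
  have h1 : ∑ x, (∑ j, if X j = x then ∑ y, a y * response Kbar X η₀ t y j else 0) * h x
      = ∑ x, a x * ∑ j, response Kbar X η₀ t x j * h (X j) := by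
    simp only [Finset.sum_mul, Finset.mul_sum]
    rw [Finset.sum_comm]
    conv_rhs => rw [Finset.sum_comm]
    refine Finset.sum_congr rfl fun j _ => ?_
    simp [ite_mul, Finset.sum_mul, mul_assoc]
  simp only [adjointWeight, sub_mul, mul_sub, Finset.sum_sub_distrib]
  rw [← h1]

/-- The limiting covariance is the image of `𝒦₀` under a linear map, so its quadratic form is that
of `𝒦₀` at the adjoint weights. This gives both its positivity and the variance in the limiting
characteristic function. -/
lemma sum_sum_mul_limitCov {𝒦₀ Kbar : 𝒳 → 𝒳 → ℝ} (hsymm : ∀ x x', Kbar x x' = Kbar x' x)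
    (hsymm₀ : ∀ x x', 𝒦₀ x x' = 𝒦₀ x' x) (X : Fin n → 𝒳) (η₀ t : ℝ) (a : 𝒳 → ℝ) :
    ∑ x, ∑ y, a x * a y * limitCov 𝒦₀ Kbar X η₀ t x y
      = ∑ x, ∑ y, adjointWeight Kbar X η₀ t a x * adjointWeight Kbar X η₀ t a y * 𝒦₀ x y := by
  simp only [mul_assoc, ← Finset.mul_sum]
  rw [sum_adjointWeight_mul]
  refine Finset.sum_congr rfl fun x _ => ?_
  congr 1
  simp only [sum_adjointWeight_mul, Finset.mul_sum]
  rw [Finset.sum_comm, ← Finset.sum_sub_distrib]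
  refine Finset.sum_congr rfl fun y _ => ?_
  rw [limitCov_eq hsymm]
  have h1 : ∀ j, response Kbar X η₀ t x j * (a y * (𝒦₀ (X j) y
      - ∑ i, response Kbar X η₀ t y i * 𝒦₀ (X j) (X i)))
      = a y * (response Kbar X η₀ t x j * 𝒦₀ (X j) y
        - ∑ i, response Kbar X η₀ t x j * response Kbar X η₀ t y i * 𝒦₀ (X j) (X i)) := by
    intro j
    simp only [mul_assoc, ← Finset.mul_sum]
    ring
  have h2 : ∀ j, 𝒦₀ x (X j) = 𝒦₀ (X j) x := fun j => hsymm₀ _ _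
  simp only [h2, h1, ← Finset.mul_sum, Finset.sum_sub_distrib]
  ring

/-- With the deterministic kernel the evolution is affine in the initial values: the part linear in
`F` moves to the test vector, and the labels give the mean. -/
lemma sum_mul_evolution {X : Fin n → 𝒳} {Kbar : 𝒳 → 𝒳 → ℝ} (hK : (gram Kbar X).PosDef) (η₀ : ℝ)
    {t : ℝ} (ht : 0 ≤ t) (Y : Fin n → ℝ) (F a : 𝒳 → ℝ) :
    ∑ x, a x * (evolution X η₀ t Kbar (F, fun i => F (X i) - Y i)).1 x
      = ∑ x, adjointWeight Kbar X η₀ t a x * F x + ∑ x, a x * limitMean Kbar X Y η₀ t x := by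
  rw [sum_adjointWeight_mul, ← Finset.sum_add_distrib]
  refine Finset.sum_congr rfl fun x _ => ?_
  rw [evolution_apply_fst hK η₀ ht, limitMean_eq, Matrix.dotProduct_mulVec]
  change a x * (F x - response Kbar X η₀ t x ⬝ᵥ fun i => F (X i) - Y i) = _
  simp only [dotProduct, mul_sub, Finset.sum_sub_distrib]
  ring

end Limit

/-! ### Replacing the empirical kernel by its limit -/

lemma continuous_evolution_apply {𝒳 : Type*} [Fintype 𝒳] {n : ℕ} (X : Fin n → 𝒳)
    (Y : Fin n → ℝ) (η₀ t : ℝ) {E : Type*} [TopologicalSpace E] {K : E → 𝒳 → 𝒳 → ℝ}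
    {F : E → 𝒳 → ℝ} (hK : Continuous K) (hF : Continuous F) :
    Continuous fun u => (evolution X η₀ t (K u) (F u, fun i => F u (X i) - Y i)).1 := by
  have h1 : Continuous fun u => ((F u, fun i => F u (X i) - Y i) : (𝒳 → ℝ) × (Fin n → ℝ)) :=
    hF.prodMk (continuous_pi fun i => ((continuous_apply (X i)).comp hF).sub continuous_const)
  have h2 : Continuous fun u => evolution X η₀ t (K u) := (continuous_evolution X η₀ t).comp hK
  exact continuous_fst.comp (h2.clm_apply h1)

lemma measurable_evolution {𝒳 : Type*} [Fintype 𝒳] {n : ℕ} (X : Fin n → 𝒳)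
    (Y : Fin n → ℝ) (η₀ t : ℝ) {Ω : Type*} [MeasurableSpace Ω]
    {K : Ω → 𝒳 → 𝒳 → ℝ} {F : Ω → 𝒳 → ℝ} (hK : Measurable K) (hF : Measurable F) :
    Measurable fun ω => (evolution X η₀ t (K ω) (F ω, fun i => F ω (X i) - Y i)).1 := by
  obtain ⟨G, hG⟩ : ∃ G : (𝒳 → 𝒳 → ℝ) × (𝒳 → ℝ) → 𝒳 → ℝ, G = fun p =>
      (evolution X η₀ t p.1 (p.2, fun i => p.2 (X i) - Y i)).1 := ⟨_, rfl⟩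
  have hGc : Continuous G := by
    rw [hG]
    exact continuous_evolution_apply X Y η₀ t continuous_fst continuous_snd
  have h : Measurable fun ω => G (K ω, F ω) := hGc.measurable.comp (hK.prodMk hF)
  rw [hG] at h
  exact h

lemma measurable_sum_mul_evolution {𝒳 : Type*} [Fintype 𝒳] {n : ℕ} (X : Fin n → 𝒳)
    (Y : Fin n → ℝ) (η₀ t : ℝ) (a : 𝒳 → ℝ) {Ω : Type*} [MeasurableSpace Ω]
    {K : Ω → 𝒳 → 𝒳 → ℝ} {F : Ω → 𝒳 → ℝ} (hK : Measurable K) (hF : Measurable F) :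
    Measurable fun ω =>
      ∑ x, a x * (evolution X η₀ t (K ω) (F ω, fun i => F ω (X i) - Y i)).1 x :=
  Finset.measurable_fun_sum _ fun x _ =>
    ((measurable_pi_apply x).comp (measurable_evolution X Y η₀ t hK hF)).const_mul (a x)

/-- The Slutsky step. Near `Kbar` the two evolutions differ by at most `ε` in operator norm, hence
by `ε` times the size of the initial data, whose mean stays bounded because second moments converge.
Away from `Kbar` the squared deviation of the kernel is bounded below, while its mean tends to 0. -/
lemma tendsto_integral_exp_evolution_sub {𝒳 : Type*} [Fintype 𝒳] {n : ℕ} (X : Fin n → 𝒳)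
    (Y : Fin n → ℝ) (η₀ t : ℝ) {Ω : ℕ → Type*} [∀ m, MeasurableSpace (Ω m)]
    {P : ∀ m, Measure (Ω m)} [∀ m, IsProbabilityMeasure (P m)]
    {F : ∀ m, Ω m → 𝒳 → ℝ} {K : ∀ m, Ω m → 𝒳 → 𝒳 → ℝ} {Kbar : 𝒳 → 𝒳 → ℝ}
    (hF : ∀ m, Measurable (F m)) (hK : ∀ m, Measurable (K m))
    (hF_int : ∀ m x, Integrable (fun ω => F m ω x ^ 2) (P m))
    (hK_int : ∀ m x x', Integrable (fun ω => (K m ω x x' - Kbar x x') ^ 2) (P m))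
    {V : 𝒳 → ℝ} (hF_lim : ∀ x, Tendsto (fun m => ∫ ω, F m ω x ^ 2 ∂P m) atTop (𝓝 (V x)))
    (hK_lim : ∀ x x', Tendsto (fun m => ∫ ω, (K m ω x x' - Kbar x x') ^ 2 ∂P m) atTop (𝓝 0))
    (a : 𝒳 → ℝ) :
    Tendsto (fun m =>
      ∫ ω, Complex.exp (Complex.I * ((∑ x, a x *
        (evolution X η₀ t (K m ω) (F m ω, fun i => F m ω (X i) - Y i)).1 x : ℝ) : ℂ)) ∂P m
      - ∫ ω, Complex.exp (Complex.I * ((∑ x, a x *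
        (evolution X η₀ t Kbar (F m ω, fun i => F m ω (X i) - Y i)).1 x : ℝ) : ℂ)) ∂P m)
      atTop (𝓝 0) := by
  have hF1 : ∀ m, ∀ x ∈ Finset.univ, Integrable (fun ω => 1 + F m ω x ^ 2) (P m) :=
    fun m x _ => (integrable_const _).add (hF_int m x)
  have hF2 : ∀ m, Integrable (fun ω => ∑ x, (1 + F m ω x ^ 2)) (P m) := fun m =>
    integrable_finsetSum _ (hF1 m)
  have hF3 : ∀ m, Integrable (fun ω => ∑ x, (1 + F m ω x ^ 2) + ‖Y‖) (P m) := fun m =>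
    (hF2 m).add (integrable_const _)
  have hz : ∀ m, Integrable (fun ω => (∑ x, |a x|) * (∑ x, (1 + F m ω x ^ 2) + ‖Y‖)) (P m) :=
    fun m => (hF3 m).const_mul _
  refine tendsto_integral_exp_sub
    (A := fun m ω => ∑ x, a x *
      (evolution X η₀ t (K m ω) (F m ω, fun i => F m ω (X i) - Y i)).1 x)
    (B := fun m ω => ∑ x, a x *
      (evolution X η₀ t Kbar (F m ω, fun i => F m ω (X i) - Y i)).1 x)
    (q := fun m ω => ∑ x, ∑ x', (K m ω x x' - Kbar x x') ^ 2)
    (z := fun m ω => (∑ x, |a x|) * (∑ x, (1 + F m ω x ^ 2) + ‖Y‖))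
    (ζ := (∑ x, |a x|) * (∑ x, (1 + V x) + ‖Y‖))
    (fun m => measurable_sum_mul_evolution X Y η₀ t a (hK m) (hF m)) (fun m =>
      measurable_sum_mul_evolution X Y η₀ t a measurable_const (hF m))
    (fun m => integrable_finsetSum _ fun x _ => integrable_finsetSum _ fun x' _ => hK_int m x x')
    hz (fun m ω => by positivity) (fun m ω => by positivity) ?_ ?_ ?_
  · intro ε hε
    obtain ⟨δ, hδ, h⟩ := Metric.continuousAt_iff.1
      ((continuous_evolution X η₀ t).continuousAt (x := Kbar)) ε hε
    refine ⟨δ ^ 2, by positivity, fun m ω => ?_⟩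
    rcases lt_or_ge (dist (K m ω) Kbar) δ with hd | hd
    · left
      have h1 := h hd
      rw [dist_eq_norm] at h1
      obtain ⟨y, hy⟩ : ∃ y : (𝒳 → ℝ) × (Fin n → ℝ), y = (F m ω, fun i => F m ω (X i) - Y i) :=
        ⟨_, rfl⟩
      rw [← hy]
      -- `|r| ≤ 1 + r²` bounds the norm of the data by second moments, the only ones whose
      -- convergence is given.
      have hF1 : ‖F m ω‖ ≤ ∑ x, (1 + F m ω x ^ 2) := by
        refine (pi_norm_le_iff_of_nonneg (by positivity)).2 fun x => ?_
        refine le_trans ?_ (Finset.single_le_sum (f := fun x => 1 + F m ω x ^ 2)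
          (fun x _ => by positivity) (Finset.mem_univ x))
        rw [Real.norm_eq_abs, ← sq_abs (F m ω x)]
        nlinarith [sq_nonneg (|F m ω x| - 1), abs_nonneg (F m ω x)]
      have hy1 : ‖y‖ ≤ ∑ x, (1 + F m ω x ^ 2) + ‖Y‖ := by
        rw [hy]
        refine norm_prod_le_iff.2 ⟨hF1.trans (le_add_of_nonneg_right (norm_nonneg _)), ?_⟩
        refine (pi_norm_le_iff_of_nonneg (by positivity)).2 fun i => ?_
        exact (norm_sub_le _ _).trans
          (add_le_add ((norm_le_pi_norm (F m ω) _).trans hF1) (norm_le_pi_norm Y i))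
      have hx : ∀ x, |(evolution X η₀ t (K m ω) y).1 x - (evolution X η₀ t Kbar y).1 x|
          ≤ ε * (∑ x, (1 + F m ω x ^ 2) + ‖Y‖) := by
        intro x
        calc |(evolution X η₀ t (K m ω) y).1 x - (evolution X η₀ t Kbar y).1 x|
            = ‖((evolution X η₀ t (K m ω) - evolution X η₀ t Kbar) y).1 x‖ := by
              simp
          _ ≤ ‖((evolution X η₀ t (K m ω) - evolution X η₀ t Kbar) y).1‖ := norm_le_pi_norm _ x
          _ ≤ ‖(evolution X η₀ t (K m ω) - evolution X η₀ t Kbar) y‖ := norm_fst_le _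
          _ ≤ ‖evolution X η₀ t (K m ω) - evolution X η₀ t Kbar‖ * ‖y‖ :=
              ContinuousLinearMap.le_opNorm _ _
          _ ≤ ε * (∑ x, (1 + F m ω x ^ 2) + ‖Y‖) :=
              mul_le_mul h1.le hy1 (norm_nonneg _) hε.le
      rw [← Finset.sum_sub_distrib]
      refine (Finset.abs_sum_le_sum_abs _ _).trans ?_
      calc ∑ x, |a x * (evolution X η₀ t (K m ω) y).1 x - a x * (evolution X η₀ t Kbar y).1 x|
          ≤ ∑ x, |a x| * (ε * (∑ x, (1 + F m ω x ^ 2) + ‖Y‖)) := by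
            refine Finset.sum_le_sum fun x _ => ?_
            rw [← mul_sub, abs_mul]
            exact mul_le_mul_of_nonneg_left (hx x) (abs_nonneg _)
        _ = ε * ((∑ x, |a x|) * (∑ x, (1 + F m ω x ^ 2) + ‖Y‖)) := by
            rw [← Finset.sum_mul]; ring
    · right
      have hle : ∀ x x', |K m ω x x' - Kbar x x'|
          ≤ √(∑ x, ∑ x', (K m ω x x' - Kbar x x') ^ 2) := by
        intro x x'
        refine Real.abs_le_sqrt ?_
        refine le_trans ?_ (Finset.single_le_sum (f := fun x => ∑ x', (K m ω x x' - Kbar x x') ^ 2)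
          (fun x _ => by positivity) (Finset.mem_univ x))
        exact Finset.single_le_sum (f := fun x' => (K m ω x x' - Kbar x x') ^ 2)
          (fun x' _ => by positivity) (Finset.mem_univ x')
      have hdist : dist (K m ω) Kbar ≤ √(∑ x, ∑ x', (K m ω x x' - Kbar x x') ^ 2) :=
        (dist_pi_le_iff (Real.sqrt_nonneg _)).2 fun x =>
          (dist_pi_le_iff (Real.sqrt_nonneg _)).2 fun x' => hle x x'
      exact (Real.le_sqrt' hδ).1 (hd.trans hdist)
  · have h : ∀ m, ∫ ω, ∑ x, ∑ x', (K m ω x x' - Kbar x x') ^ 2 ∂P m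
        = ∑ x, ∑ x', ∫ ω, (K m ω x x' - Kbar x x') ^ 2 ∂P m := by
      intro m
      rw [integral_finsetSum _ fun x _ => integrable_finsetSum _ fun x' _ => hK_int m x x']
      exact Finset.sum_congr rfl fun x _ => integral_finsetSum _ fun x' _ => hK_int m x x'
    simp only [h]
    have h1 := tendsto_finsetSum Finset.univ fun x _ =>
      tendsto_finsetSum Finset.univ fun x' (_ : x' ∈ Finset.univ) => hK_lim x x'
    simpa using h1
  · have h : ∀ m, ∫ ω, (∑ x, |a x|) * (∑ x, (1 + F m ω x ^ 2) + ‖Y‖) ∂P m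
        = (∑ x, |a x|) * (∑ x, (1 + ∫ ω, F m ω x ^ 2 ∂P m) + ‖Y‖) := by
      intro m
      rw [integral_const_mul, integral_add (hF2 m) (integrable_const _),
        integral_finsetSum _ (hF1 m)]
      congr 2
      · refine Finset.sum_congr rfl fun x _ => ?_
        rw [integral_add (integrable_const _) (hF_int m x)]
        simp
      · simp
    simp only [h]
    exact ((tendsto_finsetSum _ fun x _ => (hF_lim x).const_add 1).add_const _).const_mul _

/-! ### Transfer of the estimates to the probability space of the initialization -/

lemma integral_map_apply_toLp {Ω ι : Type*} [Fintype ι] [MeasurableSpace Ω] {P : Measure Ω}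
    {Θ : Ω → EuclideanSpace ℝ ι} (hΘ : ∀ i, Measurable fun ω => Θ ω i)
    {E : Type*} [NormedAddCommGroup E] [NormedSpace ℝ E] [MeasurableSpace E] [BorelSpace E]
    [SecondCountableTopology E] {F : EuclideanSpace ℝ ι → E} (hF : Measurable F) :
    ∫ u, F (WithLp.toLp 2 u) ∂(P.map fun ω i => Θ ω i) = ∫ ω, F (Θ ω) ∂P := by
  rw [integral_map (measurable_pi_lambda _ hΘ).aemeasurable]
  exact (hF.comp (PiLp.continuous_toLp 2 _).measurable).aestronglyMeasurable

lemma integrable_comp_of_continuous {Ω ι : Type*} [Fintype ι] [MeasurableSpace Ω] {P : Measure Ω}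
    [IsFiniteMeasure P] {Θ : Ω → EuclideanSpace ℝ ι} {F : EuclideanSpace ℝ ι → ℝ} (hF : Continuous F) {B : ℝ}
    (hB : ∀ Θ, |F Θ| ≤ B) (hΘ : ∀ i, Measurable fun ω => Θ ω i) :
    Integrable (fun ω => F (Θ ω)) P := by
  have hΘm : Measurable Θ :=
    (PiLp.continuous_toLp 2 _).measurable.comp (measurable_pi_lambda _ hΘ)
  exact integrable_of_norm_le (hF.measurable.comp hΘm).aestronglyMeasurable fun ω => hB (Θ ω)

namespace Circuit

variable {𝒳 : Type*} {m L : ℕ} (C : Circuit 𝒳 m L) {Ω : Type*} [MeasurableSpace Ω]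
  {P : Measure Ω} [IsProbabilityMeasure P] {Θ : Ω → Params L m}

lemma continuous_model (N : ℝ) (x : 𝒳) : Continuous fun Θ => C.model N Θ x :=
  (C.differentiable_model N x).continuous

lemma abs_model_le (N : ℝ) (Θ : Params L m) (x : 𝒳) : |C.model N Θ x| ≤ |1 / N| * m := by
  rw [model, abs_mul]
  refine mul_le_mul_of_nonneg_left ((Finset.abs_sum_le_sum_abs _ _).trans ?_) (abs_nonneg _)
  refine (Finset.sum_le_sum fun k _ => C.abs_localOutput_le k Θ x).trans ?_
  simp

lemma integrable_model_mul_model (hΘ : ∀ i, Measurable fun ω => Θ ω i) (N : ℝ) (x x' : 𝒳) :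
    Integrable (fun ω => C.model N (Θ ω) x * C.model N (Θ ω) x') P := by
  refine integrable_comp_of_continuous (B := (|1 / N| * m) * (|1 / N| * m))
    (F := fun Θ => C.model N Θ x * C.model N Θ x')
    ((C.continuous_model N x).mul (C.continuous_model N x')) (fun Θ => ?_) hΘ
  rw [abs_mul]
  exact mul_le_mul (C.abs_model_le N _ x) (C.abs_model_le N _ x') (abs_nonneg _) (by positivity)

lemma exists_abs_empiricalNTK_le (N NK : ℝ) (x x' : 𝒳) :
    ∃ B, ∀ Θ, |empiricalNTK (C.model N) NK Θ x x'| ≤ B := by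
  refine ⟨|1 / (NK * N ^ 2)| * ∑ p : Fin m × Fin m,
    4 * ((C.pastCone p.1 ∩ C.pastCone p.2).card : ℝ), fun Θ => ?_⟩
  rw [empiricalNTK_eq_sum, abs_mul]
  exact mul_le_mul_of_nonneg_left ((Finset.abs_sum_le_sum_abs _ _).trans
    (Finset.sum_le_sum fun p _ => C.abs_pairNTK_le x x' p Θ)) (abs_nonneg _)

/-- The mean squared distance of the empirical neural tangent kernel from a constant. -/
lemma integral_sq_empiricalNTK_sub_const_le (hΘ : ∀ i, Measurable fun ω => Θ ω i)
    (hindep : iIndepFun (fun i ω => Θ ω i) P) {N NK : ℝ} (hN : 0 < N) (hNK : 0 < NK)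
    (x x' : 𝒳) (c : ℝ) :
    Integrable (fun ω => (empiricalNTK (C.model N) NK (Θ ω) x x' - c) ^ 2) P ∧
    ∫ ω, (empiricalNTK (C.model N) NK (Θ ω) x x' - c) ^ 2 ∂P
      ≤ 512 * (1 / NK ^ 2 * (C.sumFuture 2 * C.maxFuture ^ 2 * C.maxPast ^ 2 / N ^ 4))
        + 2 * (∫ ω, empiricalNTK (C.model N) NK (Θ ω) x x' ∂P - c) ^ 2 := by
  have hprob : IsProbabilityMeasure (P.map fun ω i => Θ ω i) :=
    Measure.isProbabilityMeasure_map (measurable_pi_lambda _ hΘ).aemeasurable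
  have hcont := C.continuous_empiricalNTK N NK x x'
  obtain ⟨B, hB⟩ := C.exists_abs_empiricalNTK_le N NK x x'
  have hint : ∀ d : ℝ,
      Integrable (fun ω => (empiricalNTK (C.model N) NK (Θ ω) x x' - d) ^ 2) P := by
    intro d
    refine integrable_comp_of_continuous (B := (B + |d|) ^ 2)
      (F := fun Θ => (empiricalNTK (C.model N) NK Θ x x' - d) ^ 2)
      ((hcont.sub continuous_const).pow 2) (fun Θ => ?_) hΘ
    rw [abs_pow]
    exact pow_le_pow_left₀ (abs_nonneg _)
      ((abs_sub _ _).trans (add_le_add_left (hB Θ) _)) 2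
  refine ⟨hint c, ?_⟩
  have h := C.integral_sq_empiricalNTK_sub_le (iIndepFun_eval_map hΘ hindep) hN hNK x x'
  rw [integral_map_apply_toLp hΘ (F := fun Θ => empiricalNTK (C.model N) NK Θ x x')
    hcont.measurable] at h
  obtain ⟨d, hd⟩ : ∃ d, d = ∫ ω, empiricalNTK (C.model N) NK (Θ ω) x x' ∂P := ⟨_, rfl⟩
  rw [← hd] at h ⊢
  rw [integral_map_apply_toLp hΘ (F := fun Θ => (empiricalNTK (C.model N) NK Θ x x' - d) ^ 2)
    ((hcont.sub continuous_const).pow 2).measurable] at h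
  -- With `d` the mean, `(u - c)² ≤ 2 (u - d)² + 2 (d - c)²`; this doubles 256 to 512.
  have h1 : ∫ ω, (empiricalNTK (C.model N) NK (Θ ω) x x' - c) ^ 2 ∂P
      ≤ ∫ ω, (2 * (empiricalNTK (C.model N) NK (Θ ω) x x' - d) ^ 2 + 2 * (d - c) ^ 2) ∂P := by
    refine integral_mono (hint c) (((hint d).const_mul 2).add (integrable_const _)) fun ω => ?_
    nlinarith [sq_nonneg (empiricalNTK (C.model N) NK (Θ ω) x x' - d - (d - c))]
  rw [integral_add ((hint d).const_mul 2) (integrable_const _), integral_const_mul] at h1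
  simp only [integral_const, probReal_univ, one_smul] at h1
  linarith

lemma integral_sum_mul_model_sq [Fintype 𝒳] (hΘ : ∀ i, Measurable fun ω => Θ ω i) (N : ℝ)
    (a : 𝒳 → ℝ) :
    ∫ ω, (∑ x, a x * C.model N (Θ ω) x) ^ 2 ∂P
      = ∑ x, ∑ y, a x * a y * ∫ ω, C.model N (Θ ω) x * C.model N (Θ ω) y ∂P := by
  have hi : ∀ x y, Integrable
      (fun ω => a x * a y * (C.model N (Θ ω) x * C.model N (Θ ω) y)) P := fun x y =>
    (C.integrable_model_mul_model hΘ N x y).const_mul _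
  simp only [← integral_const_mul]
  have h2 : ∀ ω, (∑ x, a x * C.model N (Θ ω) x) ^ 2
      = ∑ x, ∑ y, a x * a y * (C.model N (Θ ω) x * C.model N (Θ ω) y) := by
    intro ω
    rw [sq, Finset.sum_mul_sum]
    exact Finset.sum_congr rfl fun x _ => Finset.sum_congr rfl fun y _ => by ring
  simp only [h2]
  rw [integral_finsetSum _ fun x _ => integrable_finsetSum _ fun y _ => hi x y]
  exact Finset.sum_congr rfl fun x _ => integral_finsetSum _ fun y _ => hi x y

/-- The law of the model at a random initialization is close to a centred normal law. -/
lemma norm_integral_exp_model_sub_exp_le [Fintype 𝒳] (hΘ : ∀ i, Measurable fun ω => Θ ω i)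
    (hindep : iIndepFun (fun i ω => Θ ω i) P) {N : ℝ} (hN : 0 < N)
    (hmean : ∀ k x, ∫ ω, C.localOutput k (Θ ω) x ∂P = 0) (a : 𝒳 → ℝ) :
    ‖∫ ω, Complex.exp (Complex.I * ((∑ x, a x * C.model N (Θ ω) x : ℝ) : ℂ)) ∂P
      - Complex.exp ((-(∑ x, ∑ y, a x * a y * ∫ ω, C.model N (Θ ω) x * C.model N (Θ ω) y ∂P) / 2
        : ℝ) : ℂ)‖
      ≤ 7 * (∑ x, |a x|) ^ 3 * (m * C.maxFuture ^ 2 * C.maxPast ^ 2 / N ^ 3) := by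
  have hprob : IsProbabilityMeasure (P.map fun ω i => Θ ω i) :=
    Measure.isProbabilityMeasure_map (measurable_pi_lambda _ hΘ).aemeasurable
  have hcont : Continuous fun Θ => ∑ x, a x * C.model N Θ x := by
    have := C.continuous_model N
    fun_prop
  have h := C.norm_integral_exp_model_sub_le (iIndepFun_eval_map hΘ hindep) hN
    (fun k x => by
      rw [integral_map_apply_toLp hΘ
        (F := fun Θ => C.localOutput k Θ x) (C.differentiable_localOutput k x).continuous.measurable]
      exact hmean k x) a
  rw [integral_map_apply_toLp hΘ
      (F := fun Θ => Complex.exp (Complex.I * ((∑ x, a x * C.model N Θ x : ℝ) : ℂ)))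
      (Continuous.measurable (by fun_prop)),
    integral_map_apply_toLp hΘ (F := fun Θ => (∑ x, a x * C.model N Θ x) ^ 2)
      (hcont.pow 2).measurable] at h
  rwa [C.integral_sum_mul_model_sq hΘ N a] at h

end Circuit

end QNN

end

/-! ### The main theorem -/

theorem corollary5p5
    {𝒳 : Type*} [Finite 𝒳]
    -- the circuits: for every number `m` of qubits, `L m` layers
    (L : ℕ → ℕ) (C : ∀ m : ℕ, QNN.Circuit 𝒳 m (L m))
    -- the normalizations of the model and of the neural tangent kernel
    (N NK : ℕ → ℝ) (hN : ∀ m, 0 < N m) (hNK : ∀ m, 0 < NK m)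
    -- the training set
    {n : ℕ} (X : Fin n → 𝒳) (Y : Fin n → ℝ)
    -- the random initialization, with independent parameters
    {Ω : ℕ → Type*} [∀ m, MeasurableSpace (Ω m)] (P : ∀ m, Measure (Ω m))
    [∀ m, IsProbabilityMeasure (P m)]
    (Θ₀ : ∀ m, Ω m → QNN.Params (L m) m)
    (hmeas : ∀ m i, Measurable fun ω => Θ₀ m ω i)
    (hindep : ∀ m, iIndepFun (fun i ω => Θ₀ m ω i) (P m))
    -- the outputs are centred, and their covariance converges uniformly to `𝒦₀`
    (hmean : ∀ m k x, ∫ ω, (C m).localOutput k (Θ₀ m ω) x ∂(P m) = 0)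
    (𝒦₀ : 𝒳 → 𝒳 → ℝ)
    (hcov : TendstoUniformly
      (fun m (p : 𝒳 × 𝒳) =>
        ∫ ω, (C m).model (N m) (Θ₀ m ω) p.1 * (C m).model (N m) (Θ₀ m ω) p.2 ∂(P m))
      (fun p => 𝒦₀ p.1 p.2) atTop)
    (hcov_pos : ∀ x, 0 < 𝒦₀ x x)
    -- the analytic neural tangent kernel converges uniformly to `Kbar`, which is positive definite
    -- on the training inputs
    (Kbar : 𝒳 → 𝒳 → ℝ)
    (hNTK : TendstoUniformly
      (fun m (p : 𝒳 × 𝒳) =>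
        ∫ ω, QNN.empiricalNTK ((C m).model (N m)) (NK m) (Θ₀ m ω) p.1 p.2 ∂(P m))
      (fun p => Kbar p.1 p.2) atTop)
    (hKbar_pos : (QNN.gram Kbar X).PosDef)
    -- the growth conditions on the light cones
    (hgrowth : Tendsto
      (fun m : ℕ => (m : ℝ) * ((C m).maxFuture : ℝ) ^ 2 * ((C m).maxPast : ℝ) ^ 2 / N m ^ 3)
      atTop (𝓝 0))
    (hgrowthNTK : Tendsto
      (fun m : ℕ => 1 / NK m ^ 2 *
        (((C m).sumFuture 2 : ℝ) * ((C m).maxFuture : ℝ) ^ 2 * ((C m).maxPast : ℝ) ^ 2 / N m ^ 4))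
      atTop (𝓝 0))
    -- training of the linearized model by gradient flow, with learning rate `n η₀ / N_K(m)`
    (η₀ : ℝ) (hη₀ : 0 < η₀)
    (Θlin : ∀ m, Ω m → ℝ → QNN.Params (L m) m)
    (hflow : ∀ m ω, QNN.IsGradientFlow ((n : ℝ) / NK m * η₀)
      (fun Θ => QNN.mse X Y (QNN.linModel ((C m).model (N m)) (Θ₀ m ω) Θ))
      (Θ₀ m ω) (Θlin m ω)) :
    ∀ t : ℝ, 0 ≤ t →
      -- `G` is the law of the limiting process
      ∃ G : ProbabilityMeasure (𝒳 → ℝ),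
        IsGaussianProcess (fun (x : 𝒳) (g : 𝒳 → ℝ) => g x) (G : Measure (𝒳 → ℝ)) ∧
        (∀ x, ∫ g, g x ∂(G : Measure (𝒳 → ℝ)) = QNN.limitMean Kbar X Y η₀ t x) ∧
        (∀ x x', cov[fun g => g x, fun g => g x'; (G : Measure (𝒳 → ℝ))]
          = QNN.limitCov 𝒦₀ Kbar X η₀ t x x') ∧
        TendstoInDistribution
          (fun m ω x => QNN.linModel ((C m).model (N m)) (Θ₀ m ω) (Θlin m ω t) x)
          atTop (fun g : 𝒳 → ℝ => g) P (G : Measure (𝒳 → ℝ)) := by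
  intro t ht
  have := Fintype.ofFinite 𝒳
  have hΘm : ∀ m, Measurable (Θ₀ m) := fun m =>
    (PiLp.continuous_toLp 2 _).measurable.comp (measurable_pi_lambda _ (hmeas m))
  obtain ⟨F, hF⟩ : ∃ F : ∀ m, Ω m → 𝒳 → ℝ, F = fun m ω => (C m).model (N m) (Θ₀ m ω) := ⟨_, rfl⟩
  obtain ⟨K, hK⟩ : ∃ K : ∀ m, Ω m → 𝒳 → 𝒳 → ℝ,
      K = fun m ω => QNN.empiricalNTK ((C m).model (N m)) (NK m) (Θ₀ m ω) := ⟨_, rfl⟩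
  have hFm : ∀ m, Measurable (F m) := fun m => measurable_pi_lambda _ fun x => by
    rw [hF]
    exact ((C m).continuous_model (N m) x).measurable.comp (hΘm m)
  have hKm : ∀ m, Measurable (K m) := fun m =>
    measurable_pi_lambda _ fun x => measurable_pi_lambda _ fun x' => by
      rw [hK]
      exact ((C m).continuous_empiricalNTK (N m) (NK m) x x').measurable.comp (hΘm m)
  have hFF : ∀ x x', Tendsto (fun m => ∫ ω, F m ω x * F m ω x' ∂(P m)) atTop (𝓝 (𝒦₀ x x')) :=
    fun x x' => by
      rw [hF]
      exact hcov.tendsto_at (x, x')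
  have hKE : ∀ x x', Tendsto (fun m => ∫ ω, K m ω x x' ∂(P m)) atTop (𝓝 (Kbar x x')) :=
    fun x x' => by
      rw [hK]
      exact hNTK.tendsto_at (x, x')
  -- Symmetry of the limits `𝒦₀` and `Kbar` is inherited from the kernels at finite `m`.
  have hsymm₀ : ∀ x x', 𝒦₀ x x' = 𝒦₀ x' x := fun x x' => by
    refine tendsto_nhds_unique (hFF x x') ?_
    simp only [mul_comm (F _ _ x)]
    exact hFF x' x
  have hsymm : ∀ x x', Kbar x x' = Kbar x' x := fun x x' => by
    refine tendsto_nhds_unique (hKE x x') ?_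
    have h : ∀ m ω, K m ω x x' = K m ω x' x := fun m ω => by
      rw [hK]
      simp only [QNN.empiricalNTK]
      rw [real_inner_comm]
    simp only [h]
    exact hKE x' x
  -- the squared deviation of the empirical kernel
  have hK2 := fun m x x' => (C m).integral_sq_empiricalNTK_sub_const_le (hmeas m) (hindep m)
    (hN m) (hNK m) x x' (Kbar x x')
  have hK_lim : ∀ x x', Tendsto (fun m => ∫ ω, (K m ω x x' - Kbar x x') ^ 2 ∂(P m)) atTop
      (𝓝 0) := by
    intro x x'
    have h := (hgrowthNTK.const_mul 512).add ((((hNTK.tendsto_at (x, x')).sub_const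
      (Kbar x x')).pow 2).const_mul 2)
    simp only [sub_self, mul_zero, ne_eq, OfNat.ofNat_ne_zero, not_false_eq_true, zero_pow,
      add_zero] at h
    refine squeeze_zero (fun m => integral_nonneg fun ω => sq_nonneg _) (fun m => ?_) h
    rw [hK]
    exact (hK2 m x x').2
  -- the central limit theorem at initialization
  have hclt : ∀ b : 𝒳 → ℝ, Tendsto
      (fun m => ∫ ω, Complex.exp (Complex.I * ((∑ x, b x * F m ω x : ℝ) : ℂ)) ∂(P m)) atTop
      (𝓝 (Complex.exp ((-(∑ x, ∑ y, b x * b y * 𝒦₀ x y) / 2 : ℝ) : ℂ))) := by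
    intro b
    have h1 : Tendsto (fun m => Complex.exp
        ((-(∑ x, ∑ y, b x * b y * ∫ ω, F m ω x * F m ω y ∂(P m)) / 2 : ℝ) : ℂ)) atTop
        (𝓝 (Complex.exp ((-(∑ x, ∑ y, b x * b y * 𝒦₀ x y) / 2 : ℝ) : ℂ))) := by
      refine (Complex.continuous_exp.tendsto _).comp
        ((Complex.continuous_ofReal.tendsto _).comp (Tendsto.div_const (Tendsto.neg ?_) 2))
      exact tendsto_finsetSum _ fun x _ => tendsto_finsetSum _ fun y _ =>
        (hFF x y).const_mul (b x * b y)
    have h2 : Tendsto (fun m =>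
        ∫ ω, Complex.exp (Complex.I * ((∑ x, b x * F m ω x : ℝ) : ℂ)) ∂(P m)
        - Complex.exp ((-(∑ x, ∑ y, b x * b y * ∫ ω, F m ω x * F m ω y ∂(P m)) / 2 : ℝ) : ℂ))
        atTop (𝓝 0) := by
      have h3 := hgrowth.const_mul (7 * (∑ x, |b x|) ^ 3)
      rw [mul_zero] at h3
      refine squeeze_zero_norm (fun m => ?_) h3
      rw [hF]
      exact (C m).norm_integral_exp_model_sub_exp_le (hmeas m) (hindep m) (hN m) (hmean m) b
    simpa using h2.add h1
  -- the limiting covariance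
  have hpsd : ∀ b : 𝒳 → ℝ, 0 ≤ ∑ x, ∑ y, b x * b y * 𝒦₀ x y := by
    intro b
    have h1 : Tendsto (fun m => ∑ x, ∑ y, b x * b y * ∫ ω, F m ω x * F m ω y ∂(P m)) atTop
        (𝓝 (∑ x, ∑ y, b x * b y * 𝒦₀ x y)) :=
      tendsto_finsetSum _ fun x _ => tendsto_finsetSum _ fun y _ =>
        (hFF x y).const_mul (b x * b y)
    refine ge_of_tendsto' h1 fun m => ?_
    rw [hF]
    dsimp only
    rw [← (C m).integral_sum_mul_model_sq (hmeas m) (N m) b]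
    exact integral_nonneg fun ω => sq_nonneg _
  -- Positivity of `𝒦₀`, a limit of second-moment forms, passes to `limitCov` through the adjoint
  -- weights.
  have hS : (Matrix.of (QNN.limitCov 𝒦₀ Kbar X η₀ t)).PosSemidef := by
    refine Matrix.PosSemidef.of_dotProduct_mulVec_nonneg ?_ fun a => ?_
    · refine Matrix.IsHermitian.ext fun x x' => ?_
      simp only [Matrix.of_apply, star_trivial]
      exact QNN.limitCov_comm hsymm hsymm₀ X η₀ t x' x
    · have h := hpsd (QNN.adjointWeight Kbar X η₀ t a)
      rw [← QNN.sum_sum_mul_limitCov hsymm hsymm₀ X η₀ t a] at h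
      refine h.trans_eq ?_
      simp only [dotProduct, Matrix.mulVec, Matrix.of_apply, Pi.star_apply, star_trivial,
        Finset.mul_sum]
      exact Finset.sum_congr rfl fun x _ => Finset.sum_congr rfl fun y _ => by ring
  have hlin : ∀ m ω, QNN.linModel ((C m).model (N m)) (Θ₀ m ω) (Θlin m ω t)
      = (QNN.evolution X η₀ t (K m ω) (F m ω, fun i => F m ω (X i) - Y i)).1 := fun m ω => by
    rw [hF, hK]
    exact QNN.linModel_gradientFlow (hflow m ω) ht
  have hlin_meas : ∀ m, Measurable fun ω =>
      QNN.linModel ((C m).model (N m)) (Θ₀ m ω) (Θlin m ω t) := by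
    intro m
    simp only [hlin]
    exact QNN.measurable_evolution X Y η₀ t (hKm m) (hFm m)
  refine QNN.exists_isGaussianProcess_tendstoInDistribution hlin_meas
    (QNN.limitMean Kbar X Y η₀ t) hS fun a => ?_
  have hsub := QNN.tendsto_integral_exp_evolution_sub X Y η₀ t hFm hKm
    (fun m x => by
      rw [hF]
      simp only [sq]
      exact (C m).integrable_model_mul_model (hmeas m) (N m) x x)
    (fun m x x' => by
      rw [hK]
      exact (hK2 m x x').1)
    (V := fun x => 𝒦₀ x x)
    (fun x => by
      simp only [sq]
      exact hFF x x) hK_lim a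
  have hlim := ((hclt (QNN.adjointWeight Kbar X η₀ t a)).const_mul
    (Complex.exp (Complex.I * ((∑ x, a x * QNN.limitMean Kbar X Y η₀ t x : ℝ) : ℂ))))
  rw [← QNN.sum_sum_mul_limitCov hsymm hsymm₀ X η₀ t a] at hlim
  -- With `Kbar` in place of the empirical kernel the characteristic function splits into the phase
  -- of the mean and that of a linear statistic at initialization, to which the central limit
  -- theorem applies.
  have h1 : ∀ m, ∫ ω, Complex.exp (Complex.I * ((∑ x, a x *
        (QNN.evolution X η₀ t Kbar (F m ω, fun i => F m ω (X i) - Y i)).1 x : ℝ) : ℂ)) ∂(P m)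
      = Complex.exp (Complex.I * ((∑ x, a x * QNN.limitMean Kbar X Y η₀ t x : ℝ) : ℂ))
        * ∫ ω, Complex.exp (Complex.I *
          ((∑ x, QNN.adjointWeight Kbar X η₀ t a x * F m ω x : ℝ) : ℂ)) ∂(P m) := by
    intro m
    rw [← integral_const_mul]
    refine integral_congr_ae (ae_of_all _ fun ω => ?_)
    dsimp only
    rw [QNN.sum_mul_evolution hKbar_pos η₀ ht, ← Complex.exp_add, ← mul_add,
      ← Complex.ofReal_add, add_comm]
  have hsum := hsub.add (hlim.congr fun m => (h1 m).symm)
  rw [zero_add] at hsum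
  simp only [hlin]
  refine hsum.congr fun m => ?_
  rw [sub_add_cancel]
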